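/- Let $N\ge 1$ and let $J\in C_c^\infty(\mathbb R^N)$ be radially symmetric, $J\ge 0$, $\int J=1$. Put $\mathfrak a=\frac1{2N}\int_{\mathbb R^N}J(z)|z|^2\,dz$ and let $U_{\mathfrak a}(x,t)=(4\pi\mathfrak a t)^{-N/2}e^{-|x|^2/(4\mathfrak a t)}$ be the fundamental solution of the heat equation with diffusivity $\mathfrak a$. Let $0<\alpha\le N$, $A>0$, $p>1+\frac2\alpha$, and let $u_0\in L^\infty(\mathbb R^N)$, $u_0\ge0$, satisfy $|x|^\alpha u_0(x)\to A$ as $|x|\to\infty$. Let $u$, bounded on $\mathbb R^N\times[0,T]$ for every $T>0$, be the solution of $$u_t(x,t)=\int_{\mathbb R^N} J(x-y)\big(u(y,t)-u(x,t)\big)\,dy-|u(x,t)|^{p-1}u(x,t)\quad\text{in }\mathbb R^N\times(0,\infty),\qquad u(x,0)=u_0(x)$$ (the absorption term is $u^p$ where $u\ge0$; as usual for $L^\infty$ data, all conditions on $u_0$ and $u$ are understood for almost every $x$). (i) If $\alpha<N$, then for every $K>0$ $$t^{\alpha/2}\,\|u(\cdot,t)-U_{\alpha,A}(\cdot,t)\|_{L^\infty(|x|\le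 K\sqrt t)}\to0\quad\text{as }t\to\infty,$$ where $U_{\alpha,A}$ is the solution of $U_t=\mathfrak a\Delta U$ in $\mathbb R^N\times(0,\infty)$, $U(x,0)=A|x|^{-\alpha}$, that is, the classical solution that attains its datum in $L^1_{\rm loc}(\mathbb R^N)$ as $t\to0^+$ and satisfies $\sup_{0<t<T}\sup_{x}\int_{|y-x|<1}|U(y,t)|\,dy<\infty$ for every $T>0$. (ii) If $\alpha=N$, then for every $K>0$ $$t^{N/2}\,\Big\|\frac{u(\cdot,t)}{\log t}-C_{A,N}\,U_{\mathfrak a}(\cdot,t)\Big\|_{L^\infty(|x|\le K\sqrt t)}\to0\quad\text{as }t\to\infty,$$ where $C_{A,N}$ is a constant that depends only on $A$ and $N$. -/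

import Mathlib

open MeasureTheory Filter Set Topology
open scoped ENNReal NNReal ContDiff

/-- Admissible dispersal kernels on `ℝ^N`: smooth, compactly supported, radially symmetric,
nonnegative, with unit integral. -/
structure IsDispersalKernel {N : ℕ} (J : EuclideanSpace ℝ (Fin N) → ℝ) : Prop where
  smooth : ContDiff ℝ ∞ J
  compactSupport : HasCompactSupport J
  radial : ∀ x y, ‖x‖ = ‖y‖ → J x = J y
  nonneg : ∀ x, 0 ≤ J x
  integral_eq_one : ∫ x, J x = 1

/-- The diffusivity `𝔞 = (1 / (2N)) ∫ J(z) |z|² dz` of the heat operator `𝔞 Δ` that is the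
diffusive scaling limit of the nonlocal operator `u ↦ J * u - u`. -/
noncomputable def diffusivity {N : ℕ} (J : EuclideanSpace ℝ (Fin N) → ℝ) : ℝ :=
  (1 / (2 * (N : ℝ))) * ∫ z, J z * ‖z‖ ^ 2

/-- The fundamental solution `(4π𝔞t)^{-N/2} exp (-|x|² / (4𝔞t))` of `U_t = 𝔞 Δ U` in `ℝ^N`. -/
noncomputable def heatKernel {N : ℕ} (𝔞 : ℝ) (x : EuclideanSpace ℝ (Fin N)) (t : ℝ) : ℝ :=
  (4 * Real.pi * 𝔞 * t) ^ (-((N : ℝ) / 2)) * Real.exp (-‖x‖ ^ 2 / (4 * 𝔞 * t))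

/-- `u` is a bounded (on finite time intervals) solution of
`u_t(x,t) = ∫ J(x-y) (u(y,t) - u(x,t)) dy - |u(x,t)|^{p-1} u(x,t)`, `u(x,0) = u₀(x)`.
The absorption term is `u^p` wherever `u ≥ 0`. As the data are in `L^∞`, everything is required
for almost every `x` only, with one null set for all times. -/
structure IsNonlocalAbsorptionSolution {N : ℕ} (J : EuclideanSpace ℝ (Fin N) → ℝ) (p : ℝ)
    (u₀ : EuclideanSpace ℝ (Fin N) → ℝ) (u : EuclideanSpace ℝ (Fin N) → ℝ → ℝ) : Prop where
  measurable : ∀ t, 0 ≤ t → AEStronglyMeasurable (fun x => u x t) volume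
  bounded : ∀ T > 0, ∃ M : ℝ, ∀ᵐ x, ∀ t ∈ Icc 0 T, |u x t| ≤ M
  initial : ∀ᵐ x, u x 0 = u₀ x
  continuous_zero : ∀ᵐ x, ContinuousWithinAt (u x) (Ici 0) 0
  equation : ∀ᵐ x, ∀ t > 0,
    HasDerivAt (u x) ((∫ y, J (x - y) * (u y t - u x t)) - |u x t| ^ (p - 1) * u x t) t

/-- `U` is a classical solution of the Cauchy problem `U_t = 𝔞 Δ U` in `ℝ^N × (0,∞)`,
`U(·,0) = f`. It has the regularity of `C^{2,1}`, the datum is attained in `L¹_loc`, and, to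
single out the standard solution among those with the same datum, `U(·,t)` is bounded in
uniformly local `L¹` on finite time intervals. -/
structure IsHeatSolution {N : ℕ} (𝔞 : ℝ) (f : EuclideanSpace ℝ (Fin N) → ℝ)
    (U : EuclideanSpace ℝ (Fin N) → ℝ → ℝ) : Prop where
  contDiff_space : ∀ t > 0, ContDiff ℝ 2 (fun x => U x t)
  continuous_laplacian : ContinuousOn
    (fun z : EuclideanSpace ℝ (Fin N) × ℝ =>
      (Laplacian.laplacian (fun x => U x z.2) : EuclideanSpace ℝ (Fin N) → ℝ) z.1)
    (univ ×ˢ Ioi 0)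
  equation : ∀ x, ∀ t > 0, HasDerivAt (U x)
    (𝔞 * (Laplacian.laplacian (fun y => U y t) : EuclideanSpace ℝ (Fin N) → ℝ) x) t
  bounded_uloc : ∀ T > 0, ∃ M : ℝ≥0, ∀ t ∈ Ioo 0 T, ∀ x,
    ∫⁻ y in Metric.ball x 1, ‖U y t‖ₑ ≤ M
  initial : ∀ R > 0, Tendsto (fun t => ∫⁻ y in Metric.ball 0 R, ‖U y t - f y‖ₑ)
    (𝓝[>] 0) (𝓝 0)

/-! For large times only low frequencies matter. The linear equation `v_t = J * v - v` with datum
`f` is solved by `v = e^{-t} f + k_t * f`, where `k_t = e^{-t} ∑_{n ≥ 1} t^n / n! J^{*n}`. With `σ`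
the Fourier transform of `J`, the transform of `k_t` is `e^{-t(1-σ)} - e^{-t}`. Unit mass and radial
symmetry give `1 - σ(ξ) = 4π²𝔞|ξ|² + O(|ξ|⁴)` near the origin, and `σ ≤ 1 - δ` away from it. Fourier
inversion then bounds `k_t` minus the heat kernel `G_t` by `C t^{-N/2-1}`, uniformly in space
(`exists_abs_nonlocalKernel_sub_heatKernel_le`).

Absorption is of lower order. By comparison (`nonneg_of_supersolution`) `0 ≤ u ≤ v`, and `v - u`
solves the linear equation with a source of size at most `v^p`. Choose `β < α` with `β(p-1) > 2`. As
`v = O((1+t)^{-β/2})`, the factor `v^{p-1}` is integrable in time. Split the datum into a far part,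
which is uniformly small, and a compactly supported part, and let `a` and `b` be their evolutions. A
barrier `θ(t)(c₁ a + c₂ b)` with bounded `θ` gives `v - u ≤ ε v + C b`, and `b = O(t^{-N/2})`
(`IsNonlocalAbsorptionSolution.exists_nonlocalEvol_sub_le`). Both terms are negligible at the scale
`t^{-α/2}` if `α < N`, and at the scale `t^{-N/2} log t` if `α = N`.

What remains is linear. If `α < N`, replace `k_t` by `G_t` and `f` by `A|y|^{-α}`: the first error
is small by the local limit theorem, the second because the data differ by `o(|y|^{-α})` at
infinity. The heat solution `U` is `G_t * A|y|^{-α}` by uniqueness (`IsHeatSolution.eq_integral`),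
proved by testing against the backward heat kernel. If `α = N`, the part of `f` in the ball of
radius `√t` has mass `(A N |B₁| / 2) log t + o(log t)`. Up to `O(t^{-N/2})` it acts as a point
source at the origin, and the part outside contributes `O(t^{-N/2})`. Dividing by `log t` leaves `C
G_t`.

All estimates are uniform over the whole space, hence hold on every ball of radius `K√t`. -/

/-- Euclidean space of dimension `N`. -/
abbrev Euc (N : ℕ) : Type := EuclideanSpace ℝ (Fin N)

/-! ### Comparison principle for `w_t ≥ J * w` -/

section Comparison

open Nat in
/-- A function which starts nonnegative and decreases at most at the rate `M t ^ n / n!` while it is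
negative stays above `-M t ^ (n + 1) / (n + 1)!`. -/
theorem lower_bound_of_deriv_of_neg {f : ℝ → ℝ} {M T : ℝ} (hM : 0 ≤ M) (n : ℕ) (h0 : 0 ≤ f 0)
    (hc : ContinuousWithinAt f (Ici 0) 0)
    (hd : ∀ t > 0, ∃ f', HasDerivAt f f' t ∧ (t ≤ T → f t < 0 → -(M * t ^ n / n !) ≤ f')) :
    ∀ t ∈ Icc 0 T, -(M * t ^ (n + 1) / (n + 1)!) ≤ f t := by
  rintro t ⟨ht0, htT⟩
  rcases ht0.eq_or_lt with rfl | ht0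
  · simpa using h0
  choose! f' hf' hneg using hd
  refine le_of_forall_pos_le_add fun ε hε => ?_
  set η : ℝ := ε / (1 + t) with hη
  have hη0 : 0 < η := by positivity
  obtain ⟨δ, hδ, hδ0, hδt⟩ : ∃ δ, -η < f δ ∧ 0 < δ ∧ δ < t := by
    have h1 : ∀ᶠ s in 𝓝[>] (0 : ℝ), -η < f s :=
      (hc.mono Ioi_subset_Ici_self).eventually_const_lt (by linarith)
    have h2 : ∀ᶠ s in 𝓝[>] (0 : ℝ), s ∈ Ioo 0 t := Ioo_mem_nhdsGT ht0
    obtain ⟨s, hs1, hs2⟩ := (h1.and h2).exists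
    exact ⟨s, hs1, hs2.1, hs2.2⟩
  -- The barrier for `-f` has the extra slope `η`, which makes the derivative inequality strict.
  -- Where `-f` touches it, `f` is negative, so the one-sided hypothesis applies. The argument
  -- starts at `δ > 0` because no derivative is available at `0`.
  have key := image_le_of_deriv_right_lt_deriv_boundary' (f := fun s => -f s)
    (f' := fun s => -f' s) (a := δ) (b := t)
    (B := fun s => M * s ^ (n + 1) / (n + 1)! + η * (1 + s))
    (B' := fun s => M * s ^ n / n ! + η) ?_ ?_ ?_ ?_ ?_ ?_ (right_mem_Icc.2 hδt.le)
  · have : η * (1 + t) = ε := by rw [hη]; field_simp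
    linarith
  · intro s hs
    exact (hf' s (hδ0.trans_le hs.1)).neg.continuousAt.continuousWithinAt
  · intro s hs
    exact (hf' s (hδ0.trans_le hs.1)).neg.hasDerivWithinAt
  · have : 0 ≤ M * δ ^ (n + 1) / (n + 1)! := by positivity
    nlinarith
  · fun_prop
  · intro s hs
    have h1 := (((hasDerivAt_pow (n + 1) s).const_mul M).div_const ((n + 1)! : ℝ)).add
      (((hasDerivAt_id s).const_add 1).const_mul η)
    refine (h1.congr_deriv ?_).hasDerivWithinAt
    rw [Nat.factorial_succ]
    push_cast
    have : (n ! : ℝ) ≠ 0 := by positivity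
    field_simp
  · intro s hs heq
    have hs0 : 0 < s := hδ0.trans_le hs.1
    have : 0 ≤ M * s ^ (n + 1) / (n + 1)! := by positivity
    have hneg' : f s < 0 := by nlinarith
    have := hneg s hs0 (hs.2.le.trans htT) hneg'
    linarith

variable {N : ℕ} {J : Euc N → ℝ}

theorem IsDispersalKernel.continuous (hJ : IsDispersalKernel J) : Continuous J :=
  hJ.smooth.continuous

theorem IsDispersalKernel.integrable (hJ : IsDispersalKernel J) : Integrable J :=
  hJ.continuous.integrable_of_hasCompactSupport hJ.compactSupport

theorem IsDispersalKernel.neg_eq (hJ : IsDispersalKernel J) (x : Euc N) : J (-x) = J x :=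
  hJ.radial _ _ (norm_neg x)

theorem integrable_sub_mul {k g : Euc N → ℝ} (hk : Integrable k) (hg : AEStronglyMeasurable g)
    {M : ℝ} (hM : ∀ᵐ y, |g y| ≤ M) (x : Euc N) : Integrable fun y => k (x - y) * g y :=
  (hk.comp_sub_left x).mul_bdd hg hM

theorem integral_sub_left_eq (k : Euc N → ℝ) (x : Euc N) : ∫ y, k (x - y) = ∫ y, k y :=
  integral_sub_left_eq_self k volume x

open Nat in
/-- **Comparison principle**: a bounded function whose initial values are nonnegative, and which
satisfies `w_t ≥ J * w` wherever it is negative, is nonnegative. -/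
theorem nonneg_of_supersolution (hJ : IsDispersalKernel J) {w : Euc N → ℝ → ℝ}
    (hmeas : ∀ t, 0 ≤ t → AEStronglyMeasurable (fun x => w x t) volume)
    (hb : ∀ T > 0, ∃ M : ℝ, ∀ᵐ x, ∀ t ∈ Icc 0 T, |w x t| ≤ M)
    (h0 : ∀ᵐ x, 0 ≤ w x 0) (hc : ∀ᵐ x, ContinuousWithinAt (w x) (Ici 0) 0)
    (hd : ∀ᵐ x, ∀ t > 0, ∃ w', HasDerivAt (w x) w' t ∧
      (w x t < 0 → ∫ y, J (x - y) * w y t ≤ w')) :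
    ∀ᵐ x, ∀ t, 0 ≤ t → 0 ≤ w x t := by
  have main : ∀ T > 0, ∀ᵐ x, ∀ t ∈ Icc 0 T, 0 ≤ w x t := by
    intro T hT
    obtain ⟨M₀, hM₀⟩ := hb T hT
    set M := max M₀ 0
    have hM : 0 ≤ M := le_max_right _ _
    have hMb : ∀ᵐ x, ∀ t ∈ Icc 0 T, |w x t| ≤ M := by
      filter_upwards [hM₀] with x hx t ht using (hx t ht).trans (le_max_left _ _)
    -- Picard iteration of lower bounds: convolution with `J` preserves constants, so each
    -- integration in time gains one factor `t / (n + 1)`, and the bounds tend to `0`.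
    have iter : ∀ n : ℕ, ∀ᵐ x, ∀ t ∈ Icc 0 T, -(M * t ^ n / n !) ≤ w x t := by
      intro n
      induction n with
      | zero =>
        filter_upwards [hMb] with x hx t ht
        simpa using (abs_le.1 (hx t ht)).1
      | succ n ih =>
        filter_upwards [h0, hc, hd] with x hx0 hxc hxd
        refine lower_bound_of_deriv_of_neg hM n hx0 hxc fun t ht => ?_
        obtain ⟨w', hw', hneg⟩ := hxd t ht
        refine ⟨w', hw', fun htT hlt => (hneg hlt).trans' ?_⟩
        have hint := integrable_sub_mul hJ.integrable (hmeas t ht.le)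
          (hMb.mono fun y hy => hy t ⟨ht.le, htT⟩) x
        calc -(M * t ^ n / n !) = ∫ y, J (x - y) * -(M * t ^ n / n !) := by
              rw [integral_mul_const, integral_sub_left_eq, hJ.integral_eq_one, one_mul]
          _ ≤ _ := by
              refine integral_mono_ae ((hJ.integrable.comp_sub_left x).mul_const _) hint ?_
              filter_upwards [ih] with y hy
              exact mul_le_mul_of_nonneg_left (hy t ⟨ht.le, htT⟩) (hJ.nonneg _)
    filter_upwards [ae_all_iff.2 iter] with x hx t ht
    have hlim : Tendsto (fun n : ℕ => -(M * t ^ n / n !)) atTop (𝓝 0) := by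
      have := ((FloorSemiring.tendsto_pow_div_factorial_atTop t).const_mul M).neg
      simpa [mul_div_assoc] using this
    exact le_of_tendsto' hlim fun n => hx n t ht
  filter_upwards [ae_all_iff.2 fun n : ℕ => main (n + 1) (by positivity)] with x hx t ht
  obtain ⟨n, hn⟩ := exists_nat_ge t
  exact hx n t ⟨ht, by linarith⟩

end Comparison

/-! ### The linear nonlocal evolution as an exponential series -/

section Semigroup

open Nat

theorem summable_pow_div_factorial_mul {a : ℕ → ℝ} {M : ℝ} (ha : ∀ n, |a n| ≤ M) (t : ℝ) :
    Summable fun n : ℕ => t ^ n / n ! * a n := by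
  refine Summable.of_norm_bounded (g := fun n : ℕ => |t| ^ n / n ! * M)
    ((Real.summable_pow_div_factorial |t|).mul_right M) fun n => ?_
  rw [norm_mul, norm_div, norm_pow, Real.norm_eq_abs, Real.norm_natCast]
  exact mul_le_mul_of_nonneg_left (ha n) (by positivity)

theorem summable_pow_succ_div_factorial_mul {a : ℕ → ℝ} {M : ℝ} (ha : ∀ n, |a n| ≤ M) (t : ℝ) :
    Summable fun n : ℕ => t ^ (n + 1) / (n + 1)! * a n :=
  (summable_nat_add_iff 1 (f := fun n : ℕ => t ^ n / n ! * a (n - 1))).2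
    (summable_pow_div_factorial_mul (fun n => ha (n - 1)) t)

theorem hasSum_pow_succ_div_factorial (t : ℝ) :
    HasSum (fun n : ℕ => t ^ (n + 1) / (n + 1)!) (Real.exp t - 1) := by
  have h : HasSum (fun n : ℕ => t ^ n / n !) (Real.exp t) := by
    rw [Real.exp_eq_exp_ℝ]
    exact NormedSpace.expSeries_div_hasSum_exp t
  simpa using (hasSum_nat_add_iff' 1).2 h

/-- Differentiation in time shifts the coefficient sequence. For `a n = J^{*n} * f` that shift is
convolution with `J`, and this is how the series comes to solve the evolution equation. -/
theorem hasDerivAt_tsum_pow_div_factorial {a : ℕ → ℝ} {M : ℝ} (ha : ∀ n, |a n| ≤ M) (t : ℝ) :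
    HasDerivAt (fun s : ℝ => ∑' n : ℕ, s ^ n / n ! * a n)
      (∑' n : ℕ, t ^ n / n ! * a (n + 1)) t := by
  have hM : 0 ≤ M := (abs_nonneg _).trans (ha 0)
  set T : ℝ := |t| + 1
  have hT : 0 ≤ T := by positivity
  -- The ball of radius `|t| + 1` contains both `t` and the base point `0`. The derivative of the
  -- constant term is zero, hence the case distinction, which also guards against truncated
  -- subtraction in `n - 1`.
  have key := hasDerivAt_tsum_of_isPreconnected
    (u := fun n : ℕ => (if n = 0 then 0 else T ^ (n - 1) / (n - 1)!) * M)
    (g := fun (n : ℕ) (s : ℝ) => s ^ n / n ! * a n)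
    (g' := fun (n : ℕ) (s : ℝ) => (if n = 0 then 0 else s ^ (n - 1) / (n - 1)!) * a n)
    (t := Metric.ball 0 T) (y₀ := 0) (y := t) ?_ Metric.isOpen_ball
    (convex_ball _ _).isPreconnected ?_ ?_ ?_ ?_ ?_
  · refine key.congr_deriv ?_
    rw [Summable.tsum_eq_zero_add]
    · simp
    · refine (summable_nat_add_iff 1).1 ?_
      simpa using summable_pow_div_factorial_mul (fun n => ha (n + 1)) t
  · refine (summable_nat_add_iff 1).1 ?_
    simpa using (Real.summable_pow_div_factorial T).mul_right M
  · intro n s _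
    rcases n with _ | n
    · simpa using hasDerivAt_const s (a 0)
    · refine (((hasDerivAt_pow (n + 1) s).div_const _).mul_const _).congr_deriv ?_
      rw [Nat.factorial_succ]
      have : (n ! : ℝ) ≠ 0 := by positivity
      push_cast
      rw [mul_div_mul_left _ _ (by positivity)]
  · intro n s hs
    have hs' : |s| ≤ T := by simpa using (Metric.mem_ball.1 hs).le
    rw [norm_mul]
    refine mul_le_mul ?_ (ha n) (norm_nonneg _) (by split_ifs <;> positivity)
    rcases n with _ | n
    · simp
    · simp only [add_tsub_cancel_right, Nat.succ_ne_zero, if_false, norm_div, norm_pow,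
        Real.norm_eq_abs, Nat.abs_cast]
      gcongr
  · simp [T]; positivity
  · exact summable_pow_div_factorial_mul ha 0
  · simp [T]

/-- The iterated convolutions `J, J * J, J * J * J, …`. -/
noncomputable def iterKernel {N : ℕ} (J : Euc N → ℝ) : ℕ → Euc N → ℝ
  | 0 => J
  | n + 1 => fun x => ∫ y, J (x - y) * iterKernel J n y

/-- The regular part `e^{-t} ∑_{n ≥ 1} t ^ n / n! J^{*n}` of the fundamental solution of
`u_t = J * u - u`. -/
noncomputable def nonlocalKernel {N : ℕ} (J : Euc N → ℝ) (t : ℝ) (x : Euc N) : ℝ :=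
  Real.exp (-t) * ∑' n : ℕ, t ^ (n + 1) / (n + 1)! * iterKernel J n x

/-- The solution of `u_t = J * u - u` with datum `f`. -/
noncomputable def nonlocalEvol {N : ℕ} (J f : Euc N → ℝ) (x : Euc N) (t : ℝ) : ℝ :=
  Real.exp (-t) * f x + ∫ y, nonlocalKernel J t (x - y) * f y

variable {N : ℕ} {J f : Euc N → ℝ} {M : ℝ}

theorem iterKernel_succ_eq_convolution (J : Euc N → ℝ) (n : ℕ) :
    iterKernel J (n + 1) =
      convolution J (iterKernel J n) (ContinuousLinearMap.lsmul ℝ ℝ) volume := by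
  funext x
  rw [convolution_lsmul_swap]
  rfl

theorem IsDispersalKernel.exists_bound (hJ : IsDispersalKernel J) :
    ∃ B, 0 ≤ B ∧ ∀ x, J x ≤ B := by
  obtain ⟨B, hB⟩ := hJ.compactSupport.exists_bound_of_continuous hJ.continuous
  exact ⟨B, (norm_nonneg _).trans (hB 0), fun x => (le_abs_self _).trans (hB x)⟩

theorem iterKernel_nonneg (hJ : IsDispersalKernel J) (n : ℕ) (x : Euc N) :
    0 ≤ iterKernel J n x := by
  induction n generalizing x with
  | zero => exact hJ.nonneg x
  | succ n ih => exact integral_nonneg fun y => mul_nonneg (hJ.nonneg _) (ih y)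

theorem integrable_iterKernel (hJ : IsDispersalKernel J) (n : ℕ) :
    Integrable (iterKernel J n) := by
  induction n with
  | zero => exact hJ.integrable
  | succ n ih =>
    rw [iterKernel_succ_eq_convolution]
    exact hJ.integrable.integrable_convolution _ ih

theorem integral_iterKernel (hJ : IsDispersalKernel J) (n : ℕ) :
    ∫ x, iterKernel J n x = 1 := by
  induction n with
  | zero => exact hJ.integral_eq_one
  | succ n ih =>
    rw [iterKernel_succ_eq_convolution, integral_convolution _ hJ.integrable
      (integrable_iterKernel hJ n), ih, hJ.integral_eq_one]
    simp

theorem continuous_iterKernel (hJ : IsDispersalKernel J) (n : ℕ) :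
    Continuous (iterKernel J n) := by
  induction n with
  | zero => exact hJ.continuous
  | succ n ih =>
    rw [iterKernel_succ_eq_convolution]
    exact hJ.compactSupport.continuous_convolution_left _ hJ.continuous ih.locallyIntegrable

theorem iterKernel_le (hJ : IsDispersalKernel J) {B : ℝ} (hB : ∀ x, J x ≤ B) (n : ℕ)
    (x : Euc N) : iterKernel J n x ≤ B := by
  induction n generalizing x with
  | zero => exact hB x
  | succ n ih =>
    calc iterKernel J (n + 1) x ≤ ∫ y, J (x - y) * B := by
          refine integral_mono (integrable_sub_mul hJ.integrable
            (continuous_iterKernel hJ n).aestronglyMeasurable (M := B) ?_ x)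
            ((hJ.integrable.comp_sub_left x).mul_const _)
            fun y => mul_le_mul_of_nonneg_left (ih y) (hJ.nonneg _)
          exact ae_of_all _ fun y => (abs_of_nonneg (iterKernel_nonneg hJ n y)).trans_le (ih y)
      _ = B := by rw [integral_mul_const, integral_sub_left_eq, hJ.integral_eq_one, one_mul]

theorem exists_abs_iterKernel_le (hJ : IsDispersalKernel J) :
    ∃ B, 0 ≤ B ∧ ∀ n x, |iterKernel J n x| ≤ B := by
  obtain ⟨B, hB0, hB⟩ := hJ.exists_bound
  exact ⟨B, hB0, fun n x => (abs_of_nonneg (iterKernel_nonneg hJ n x)).trans_le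
    (iterKernel_le hJ hB n x)⟩

theorem nonlocalKernel_nonneg (hJ : IsDispersalKernel J) {t : ℝ} (ht : 0 ≤ t) (x : Euc N) :
    0 ≤ nonlocalKernel J t x :=
  mul_nonneg (Real.exp_pos _).le (tsum_nonneg fun n =>
    mul_nonneg (by positivity) (iterKernel_nonneg hJ n x))

theorem continuous_nonlocalKernel (hJ : IsDispersalKernel J) (t : ℝ) :
    Continuous (nonlocalKernel J t) := by
  obtain ⟨B, hB0, hB⟩ := exists_abs_iterKernel_le hJ
  refine continuous_const.mul (continuous_tsum (u := fun n : ℕ => |t| ^ (n + 1) / (n + 1)! * B)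
    (fun n => continuous_const.mul (continuous_iterKernel hJ n)) ?_ fun n x => ?_)
  · exact ((summable_nat_add_iff 1).2 (Real.summable_pow_div_factorial |t|)).mul_right B
  · rw [norm_mul, norm_div, norm_pow, Real.norm_eq_abs, Real.norm_natCast]
    exact mul_le_mul_of_nonneg_left (hB n x) (by positivity)

/-- Integrating the series of the kernel term by term. -/
theorem hasSum_integral_nonlocalKernel_smul (hJ : IsDispersalKernel J) {t : ℝ} (ht : 0 ≤ t)
    {F : Type*} [NormedAddCommGroup F] [NormedSpace ℝ F] {g : Euc N → F}
    (hg : AEStronglyMeasurable g) (hM : ∀ y, ‖g y‖ ≤ M) :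
    HasSum (fun n : ℕ => (Real.exp (-t) * (t ^ (n + 1) / (n + 1)!)) • ∫ y, iterKernel J n y • g y)
      (∫ y, nonlocalKernel J t y • g y) := by
  obtain ⟨B, hB0, hB⟩ := exists_abs_iterKernel_le hJ
  have hint : ∀ n, Integrable fun y => iterKernel J n y • g y := fun n =>
    (integrable_iterKernel hJ n).smul_bdd M hg (ae_of_all _ hM)
  have key := hasSum_integral_of_summable_integral_norm (μ := (volume : Measure (Euc N)))
    (F := fun (n : ℕ) y => (Real.exp (-t) * (t ^ (n + 1) / (n + 1)!)) • (iterKernel J n y • g y))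
    (fun n => (hint n).smul _) ?_
  · simp only [integral_smul] at key
    convert key using 3 with y
    rw [nonlocalKernel, ← tsum_mul_left, ← Summable.tsum_smul_const]
    · simp only [smul_smul, mul_assoc]
    · exact (summable_pow_succ_div_factorial_mul (fun n => hB n y) t).mul_left _
  · refine Summable.of_nonneg_of_le (fun n => integral_nonneg fun y => norm_nonneg _) (fun n => ?_)
      (((hasSum_pow_succ_div_factorial t).summable.mul_left (Real.exp (-t))).mul_right M)
    have hc : 0 ≤ Real.exp (-t) * (t ^ (n + 1) / (n + 1)!) := by positivity
    simp only [norm_smul, Real.norm_of_nonneg hc, integral_const_mul]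
    refine mul_le_mul_of_nonneg_left ?_ hc
    calc ∫ y, ‖iterKernel J n y‖ * ‖g y‖ ≤ ∫ y, iterKernel J n y * M := by
          refine integral_mono ?_ ((integrable_iterKernel hJ n).mul_const M) fun y => ?_
          · simpa only [norm_smul] using (hint n).norm
          · simp only [Real.norm_of_nonneg (iterKernel_nonneg hJ n y)]
            exact mul_le_mul_of_nonneg_left (hM y) (iterKernel_nonneg hJ n y)
      _ = M := by rw [integral_mul_const, integral_iterKernel hJ, one_mul]

theorem integral_nonlocalKernel (hJ : IsDispersalKernel J) {t : ℝ} (ht : 0 ≤ t) :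
    ∫ y, nonlocalKernel J t y = 1 - Real.exp (-t) := by
  have h := hasSum_integral_nonlocalKernel_smul hJ ht (g := fun _ => (1 : ℝ)) (M := 1)
    aestronglyMeasurable_const (by simp)
  simp only [smul_eq_mul, mul_one, integral_iterKernel hJ] at h
  rw [h.unique ((hasSum_pow_succ_div_factorial t).mul_left (Real.exp (-t))), mul_sub,
    ← Real.exp_add]
  simp

theorem integrable_nonlocalKernel (hJ : IsDispersalKernel J) {t : ℝ} (ht : 0 ≤ t) :
    Integrable (nonlocalKernel J t) := by
  rcases ht.eq_or_lt with rfl | ht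
  · have : nonlocalKernel J 0 = fun _ => 0 := by
      funext x
      simp [nonlocalKernel]
    rw [this]
    exact integrable_zero _ _ _
  -- The Bochner integral of a nonintegrable function is `0`, whereas the mass `1 - e^{-t}` is
  -- positive for `t > 0`.
  · by_contra h
    have h1 := integral_nonlocalKernel hJ ht.le
    rw [integral_undef h] at h1
    have : Real.exp (-t) < 1 := (Real.exp_lt_exp.2 (neg_lt_zero.2 ht)).trans_eq Real.exp_zero
    linarith

/-- The successive images of a function under convolution with `J`. -/
noncomputable def iterApply (J f : Euc N → ℝ) : ℕ → Euc N → ℝ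
  | 0 => f
  | n + 1 => fun x => ∫ y, iterKernel J n (x - y) * f y

theorem abs_iterApply_le (hJ : IsDispersalKernel J) (hf : Measurable f) (hM : ∀ x, |f x| ≤ M)
    (n : ℕ) (x : Euc N) : |iterApply J f n x| ≤ M := by
  rcases n with _ | n
  · exact hM x
  · calc |iterApply J f (n + 1) x| ≤ ∫ y, |iterKernel J n (x - y) * f y| :=
          abs_integral_le_integral_abs
      _ ≤ ∫ y, iterKernel J n (x - y) * M := by
          refine integral_mono (integrable_sub_mul (integrable_iterKernel hJ n)
            hf.aestronglyMeasurable (ae_of_all _ hM) x).abs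
            (((integrable_iterKernel hJ n).comp_sub_left x).mul_const M) fun y => ?_
          simp only [abs_mul, abs_of_nonneg (iterKernel_nonneg hJ n _)]
          exact mul_le_mul_of_nonneg_left (hM y) (iterKernel_nonneg hJ n _)
      _ = M := by
          rw [integral_mul_const, integral_sub_left_eq, integral_iterKernel hJ, one_mul]

theorem measurable_integral_sub_mul {k g : Euc N → ℝ} (hk : Measurable k) (hg : Measurable g) :
    Measurable fun x => ∫ y, k (x - y) * g y := by
  have h : StronglyMeasurable fun z : Euc N × Euc N => k (z.1 - z.2) * g z.2 :=
    ((hk.comp (measurable_fst.sub measurable_snd)).mul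
      (hg.comp measurable_snd)).stronglyMeasurable
  exact h.integral_prod_right.measurable

theorem measurable_iterApply (hJ : IsDispersalKernel J) (hf : Measurable f) (n : ℕ) :
    Measurable (iterApply J f n) := by
  rcases n with _ | n
  · exact hf
  · exact measurable_integral_sub_mul (continuous_iterKernel hJ n).measurable hf

/-- Associativity of convolution, `(J * J^{*n}) * f = J * (J^{*n} * f)`. Integrability of the
kernels and boundedness of `f` give the absolute convergence required by `convolution_assoc`. Recall
that `iterKernel J n` is the power `J^{*(n+1)}`. -/
theorem iterApply_succ (hJ : IsDispersalKernel J) (hf : Measurable f) (hM : ∀ x, |f x| ≤ M)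
    (n : ℕ) (x : Euc N) :
    iterApply J f (n + 1) x = ∫ y, J (x - y) * iterApply J f n y := by
  rcases n with _ | n
  · rfl
  set L : ℝ →L[ℝ] ℝ →L[ℝ] ℝ := ContinuousLinearMap.lsmul ℝ ℝ
  have hex : ∀ k h : Euc N → ℝ, Integrable k → Measurable h → (∀ x, |h x| ≤ M) → ∀ x,
      ConvolutionExistsAt k h x L volume := fun k h hk hh hhM x =>
    (convolutionExistsAt_iff_integrable_swap).2
      (integrable_sub_mul hk hh.aestronglyMeasurable (ae_of_all _ hhM) x)
  have h1 : iterApply J f (n + 2) x = convolution (iterKernel J (n + 1)) f L volume x := by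
    rw [convolution_lsmul_swap]
    rfl
  have h2 : iterApply J f (n + 1) = convolution (iterKernel J n) f L volume := by
    funext x
    rw [convolution_lsmul_swap]
    rfl
  have h3 : (fun x => ‖iterKernel J n x‖) = iterKernel J n :=
    funext fun x => Real.norm_of_nonneg (iterKernel_nonneg hJ n x)
  have h4 : (fun x => ‖J x‖) = J := funext fun x => Real.norm_of_nonneg (hJ.nonneg x)
  rw [h1, iterKernel_succ_eq_convolution, convolution_assoc L L L L (by simp [L, mul_assoc])
    hJ.continuous.aestronglyMeasurable (continuous_iterKernel hJ n).aestronglyMeasurable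
    hf.aestronglyMeasurable, ← h2, convolution_lsmul_swap]
  · rfl
  · refine ae_of_all _ fun y => ?_
    obtain ⟨B, hB0, hB⟩ := exists_abs_iterKernel_le hJ
    exact (convolutionExistsAt_iff_integrable_swap).2
      (integrable_sub_mul hJ.integrable (continuous_iterKernel hJ n).aestronglyMeasurable
        (ae_of_all _ (hB n)) y)
  · refine ae_of_all _ fun y => ?_
    rw [h3]
    exact hex _ _ (integrable_iterKernel hJ n) hf.norm (by simpa using hM) y
  · rw [h3, h4]
    have h5 : convolution (iterKernel J n) (fun x => ‖f x‖) (ContinuousLinearMap.mul ℝ ℝ) volume =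
        iterApply J (fun x => ‖f x‖) (n + 1) := by
      funext x
      rw [convolution_mul_swap]
      rfl
    rw [h5]
    exact hex _ _ hJ.integrable (measurable_iterApply hJ hf.norm _)
      (abs_iterApply_le hJ hf.norm (by simpa using hM) _) x

/-- The summand `e^{-t} f`, which comes from the Dirac mass in the fundamental solution, is the term
`n = 0`. The full series is the convenient form for differentiating in time. -/
theorem nonlocalEvol_eq_tsum (hJ : IsDispersalKernel J) (hf : Measurable f)
    (hM : ∀ x, |f x| ≤ M) {t : ℝ} (ht : 0 ≤ t) (x : Euc N) :
    nonlocalEvol J f x t = Real.exp (-t) * ∑' n : ℕ, t ^ n / n ! * iterApply J f n x := by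
  have hsub : ∀ k : Euc N → ℝ, ∫ y, k (x - y) * f y = ∫ y, k y * f (x - y) := fun k => by
    rw [← integral_sub_left_eq (fun y => k y * f (x - y)) x]
    simp
  have h := (hasSum_integral_nonlocalKernel_smul hJ ht (g := fun y => f (x - y)) (M := M)
    (hf.comp (measurable_const.sub measurable_id)).aestronglyMeasurable fun y => hM _).tsum_eq
  rw [nonlocalEvol, hsub, Summable.tsum_eq_zero_add
    (summable_pow_div_factorial_mul (fun n => abs_iterApply_le hJ hf hM n x) t), mul_add]
  simp only [smul_eq_mul] at h
  rw [← h, ← tsum_mul_left]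
  simp [iterApply, hsub, mul_assoc]

theorem nonlocalEvol_zero (J f : Euc N → ℝ) (x : Euc N) : nonlocalEvol J f x 0 = f x := by
  simp [nonlocalEvol, nonlocalKernel]

theorem measurable_nonlocalEvol (hJ : IsDispersalKernel J) (hf : Measurable f) (t : ℝ) :
    Measurable fun x => nonlocalEvol J f x t :=
  (hf.const_mul _).add
    (measurable_integral_sub_mul (continuous_nonlocalKernel hJ t).measurable hf)

theorem nonlocalEvol_nonneg (hJ : IsDispersalKernel J) (hf : ∀ x, 0 ≤ f x) {t : ℝ} (ht : 0 ≤ t)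
    (x : Euc N) : 0 ≤ nonlocalEvol J f x t :=
  add_nonneg (mul_nonneg (Real.exp_pos _).le (hf x))
    (integral_nonneg fun _ => mul_nonneg (nonlocalKernel_nonneg hJ ht _) (hf _))

theorem abs_nonlocalEvol_le (hJ : IsDispersalKernel J) (hf : Measurable f) (hM : ∀ x, |f x| ≤ M)
    {t : ℝ} (ht : 0 ≤ t) (x : Euc N) : |nonlocalEvol J f x t| ≤ M := by
  have h1 : |∫ y, nonlocalKernel J t (x - y) * f y| ≤ (1 - Real.exp (-t)) * M := by
    refine abs_integral_le_integral_abs.trans ?_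
    rw [← integral_nonlocalKernel hJ ht, ← integral_sub_left_eq (nonlocalKernel J t) x,
      ← integral_mul_const]
    refine integral_mono (integrable_sub_mul (integrable_nonlocalKernel hJ ht)
      hf.aestronglyMeasurable (ae_of_all _ hM) x).abs
      (((integrable_nonlocalKernel hJ ht).comp_sub_left x).mul_const M) fun y => ?_
    simp only [abs_mul, abs_of_nonneg (nonlocalKernel_nonneg hJ ht _)]
    exact mul_le_mul_of_nonneg_left (hM y) (nonlocalKernel_nonneg hJ ht _)
  have h2 : |Real.exp (-t) * f x| ≤ Real.exp (-t) * M := by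
    rw [abs_mul, abs_of_pos (Real.exp_pos _)]
    exact mul_le_mul_of_nonneg_left (hM x) (Real.exp_pos _).le
  calc _ ≤ _ := abs_add_le _ _
    _ ≤ M := by linarith

theorem nonlocalEvol_add (hJ : IsDispersalKernel J) {g : Euc N → ℝ} (hf : Measurable f)
    (hM : ∀ x, |f x| ≤ M) (hg : Measurable g) {M' : ℝ} (hM' : ∀ x, |g x| ≤ M') {t : ℝ}
    (ht : 0 ≤ t) (x : Euc N) :
    nonlocalEvol J (fun y => f y + g y) x t = nonlocalEvol J f x t + nonlocalEvol J g x t := by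
  simp only [nonlocalEvol, mul_add]
  rw [integral_add (integrable_sub_mul (integrable_nonlocalKernel hJ ht)
      hf.aestronglyMeasurable (ae_of_all _ hM) x) (integrable_sub_mul
      (integrable_nonlocalKernel hJ ht) hg.aestronglyMeasurable (ae_of_all _ hM') x)]
  ring

/-- `nonlocalEvol` solves `v_t = J * v - v`, classically in time, for positive times. -/
theorem hasDerivAt_nonlocalEvol (hJ : IsDispersalKernel J) (hf : Measurable f)
    (hM : ∀ x, |f x| ≤ M) (x : Euc N) {t : ℝ} (ht : 0 < t) :
    HasDerivAt (nonlocalEvol J f x)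
      ((∫ y, J (x - y) * nonlocalEvol J f y t) - nonlocalEvol J f x t) t := by
  have hb := abs_iterApply_le hJ hf hM
  have heq : (fun s => Real.exp (-s) * ∑' n : ℕ, s ^ n / n ! * iterApply J f n x) =ᶠ[𝓝 t]
      nonlocalEvol J f x := by
    filter_upwards [lt_mem_nhds ht] with s hs
    exact (nonlocalEvol_eq_tsum hJ hf hM hs.le x).symm
  have hder := ((hasDerivAt_neg t).exp.mul
    (hasDerivAt_tsum_pow_div_factorial (fun n => hb n x) t)).congr_of_eventuallyEq heq.symm
  refine hder.congr_deriv ?_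
  -- Sum and integral may be exchanged by absolute summability, and convolving with `J` raises every
  -- index by one, matching the derivative of the series.
  have hconv : ∫ y, J (x - y) * nonlocalEvol J f y t =
      Real.exp (-t) * ∑' n : ℕ, t ^ n / n ! * iterApply J f (n + 1) x := by
    have key := hasSum_integral_of_summable_integral_norm (μ := (volume : Measure (Euc N)))
      (F := fun (n : ℕ) y => t ^ n / n ! * (J (x - y) * iterApply J f n y)) ?_ ?_
    · simp only [integral_const_mul, ← iterApply_succ hJ hf hM] at key
      rw [key.tsum_eq, ← integral_const_mul]
      congr 1 with y
      rw [nonlocalEvol_eq_tsum hJ hf hM ht.le y, ← mul_assoc, mul_comm (J (x - y)), mul_assoc,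
        ← tsum_mul_left]
      congr 2 with n
      ring
    · exact fun n => (integrable_sub_mul hJ.integrable
        (measurable_iterApply hJ hf n).aestronglyMeasurable (ae_of_all _ (hb n)) x).const_mul _
    · refine Summable.of_nonneg_of_le (fun n => integral_nonneg fun y => norm_nonneg _)
        (fun n => ?_) ((Real.summable_pow_div_factorial t).mul_right M)
      have hc : 0 ≤ t ^ n / n ! := by positivity
      simp only [norm_mul, Real.norm_of_nonneg hc, integral_const_mul]
      refine mul_le_mul_of_nonneg_left ?_ hc
      calc ∫ y, ‖J (x - y)‖ * ‖iterApply J f n y‖ ≤ ∫ y, J (x - y) * M := by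
            refine integral_mono ?_ ((hJ.integrable.comp_sub_left x).mul_const M) fun y => ?_
            · simpa only [norm_mul] using (integrable_sub_mul hJ.integrable
                (measurable_iterApply hJ hf n).aestronglyMeasurable (ae_of_all _ (hb n)) x).norm
            · simp only [Real.norm_of_nonneg (hJ.nonneg _)]
              exact mul_le_mul_of_nonneg_left (hb n y) (hJ.nonneg _)
        _ = M := by rw [integral_mul_const, integral_sub_left_eq, hJ.integral_eq_one, one_mul]
  rw [hconv, nonlocalEvol_eq_tsum hJ hf hM ht.le x]
  ring

theorem continuousWithinAt_nonlocalEvol (hJ : IsDispersalKernel J) (hf : Measurable f)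
    (hM : ∀ x, |f x| ≤ M) (x : Euc N) :
    ContinuousWithinAt (nonlocalEvol J f x) (Ici 0) 0 := by
  have h := (((hasDerivAt_neg 0).exp.mul (hasDerivAt_tsum_pow_div_factorial
    (fun n => abs_iterApply_le hJ hf hM n x) 0)).continuousAt).continuousWithinAt (s := Ici 0)
  exact h.congr (fun s hs => nonlocalEvol_eq_tsum hJ hf hM hs x)
    (nonlocalEvol_eq_tsum hJ hf hM le_rfl x)

end Semigroup

/-! ### Fourier symbol and local limit theorem -/

section Fourier

open FourierTransform RealInnerProductSpace

theorem exists_pow_mul_exp_neg_le (n : ℕ) {δ : ℝ} (hδ : 0 < δ) :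
    ∃ C, 0 < C ∧ ∀ x : ℝ, 0 ≤ x → x ^ n * Real.exp (-(δ * x)) ≤ C := by
  refine ⟨n.factorial / δ ^ n, by positivity, fun x hx => ?_⟩
  have h := Real.pow_div_factorial_le_exp (δ * x) (by positivity) n
  rw [Real.exp_neg, ← div_eq_mul_inv, div_le_iff₀ (Real.exp_pos _), div_mul_eq_mul_div,
    le_div_iff₀ (by positivity)]
  rw [div_le_iff₀ (by positivity), mul_pow] at h
  linarith

theorem exists_rpow_mul_exp_neg_le (s : ℝ) {δ : ℝ} (hδ : 0 < δ) :
    ∃ C, 0 < C ∧ ∀ t : ℝ, 1 ≤ t → t ^ s * Real.exp (-(δ * t)) ≤ C := by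
  obtain ⟨C, hC, h⟩ := exists_pow_mul_exp_neg_le ⌈s⌉₊ hδ
  refine ⟨C, hC, fun t ht => le_trans ?_ (h t (by linarith))⟩
  refine mul_le_mul_of_nonneg_right ?_ (Real.exp_pos _).le
  rw [← Real.rpow_natCast]
  exact Real.rpow_le_rpow_of_exponent_le ht (Nat.le_ceil s)

variable {N : ℕ} {J : Euc N → ℝ}

/-- The integral is known and nonzero, which excludes the default value of the integral of a
nonintegrable function. -/
theorem integrable_exp_neg_mul_norm_sq {b : ℝ} (hb : 0 < b) :
    Integrable fun x : Euc N => Real.exp (-b * ‖x‖ ^ 2) := by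
  by_contra h
  have h1 := GaussianFourier.integral_rexp_neg_mul_sq_norm (V := Euc N) hb
  rw [integral_undef h] at h1
  have : 0 < (Real.pi / b) ^ ((Module.finrank ℝ (Euc N) : ℝ) / 2) := by positivity
  linarith

theorem integral_exp_neg_mul_norm_sq {b : ℝ} (hb : 0 < b) :
    ∫ x : Euc N, Real.exp (-b * ‖x‖ ^ 2) = (Real.pi / b) ^ ((N : ℝ) / 2) := by
  simpa using GaussianFourier.integral_rexp_neg_mul_sq_norm (V := Euc N) hb

/-- The Fourier symbol of convolution with an even kernel. -/
noncomputable def symbol (J : Euc N → ℝ) (ξ : Euc N) : ℝ :=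
  ∫ z, J z * Real.cos (2 * Real.pi * ⟪z, ξ⟫)

theorem integrable_mul_cos (hJ : IsDispersalKernel J) (ξ : Euc N) :
    Integrable fun z => J z * Real.cos (2 * Real.pi * ⟪z, ξ⟫) :=
  hJ.integrable.mul_bdd (c := 1) (Continuous.aestronglyMeasurable (by fun_prop))
    (ae_of_all _ fun z => Real.abs_cos_le_one _)

theorem integrable_complex_ofReal {k : Euc N → ℝ} (hk : Integrable k) :
    Integrable fun z => (k z : ℂ) :=
  hk.ofReal

theorem fourier_ofReal_eq_symbol (hJ : IsDispersalKernel J) (ξ : Euc N) :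
    𝓕 (fun z => (J z : ℂ)) ξ = (symbol J ξ : ℂ) := by
  have hsin : Integrable fun z => J z * Real.sin (2 * Real.pi * ⟪z, ξ⟫) :=
    hJ.integrable.mul_bdd (c := 1) (Continuous.aestronglyMeasurable (by fun_prop))
      (ae_of_all _ fun z => Real.abs_sin_le_one _)
  -- A radial kernel is even, so the imaginary part of its transform vanishes.
  have hzero : ∫ z, J z * Real.sin (2 * Real.pi * ⟪z, ξ⟫) = 0 := by
    have h := integral_neg_eq_self (fun z => J z * Real.sin (2 * Real.pi * ⟪z, ξ⟫)) volume
    simp only [hJ.neg_eq, inner_neg_left, mul_neg, Real.sin_neg, integral_neg] at h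
    linarith
  rw [Real.fourier_eq']
  have : ∀ z : Euc N, Complex.exp (↑(-2 * Real.pi * ⟪z, ξ⟫) * Complex.I) • (J z : ℂ) =
      ((J z * Real.cos (2 * Real.pi * ⟪z, ξ⟫) : ℝ) : ℂ) -
        ((J z * Real.sin (2 * Real.pi * ⟪z, ξ⟫) : ℝ) : ℂ) * Complex.I := by
    intro z
    rw [Complex.exp_mul_I, ← Complex.ofReal_cos, ← Complex.ofReal_sin, neg_mul, neg_mul,
      Real.cos_neg, Real.sin_neg, smul_eq_mul]
    push_cast
    ring
  simp only [this]
  rw [integral_sub (integrable_complex_ofReal (integrable_mul_cos hJ ξ))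
      ((integrable_complex_ofReal hsin).mul_const _),
    integral_mul_const, integral_complex_ofReal, integral_complex_ofReal, hzero]
  simp [symbol]

theorem fourier_iterKernel (hJ : IsDispersalKernel J) (n : ℕ) (ξ : Euc N) :
    𝓕 (fun z => (iterKernel J n z : ℂ)) ξ = (symbol J ξ : ℂ) ^ (n + 1) := by
  induction n with
  | zero => simpa [iterKernel] using fourier_ofReal_eq_symbol hJ ξ
  | succ n ih =>
    have : (fun z => (iterKernel J (n + 1) z : ℂ)) =
        convolution (fun z => (J z : ℂ)) (fun z => (iterKernel J n z : ℂ))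
          (ContinuousLinearMap.lsmul ℂ ℂ) volume := by
      funext x
      rw [convolution_lsmul_swap, iterKernel]
      dsimp only
      rw [← integral_complex_ofReal]
      simp
    rw [this, Real.fourier_smul_convolution_eq (integrable_complex_ofReal hJ.integrable)
      (integrable_complex_ofReal (integrable_iterKernel hJ n)), ih, fourier_ofReal_eq_symbol hJ, smul_eq_mul]
    ring

/-- Convolution powers become powers of the symbol, so the series sums to an exponential. The `-1`
is the missing term `n = 0`, the Dirac mass that is not part of the kernel. -/
theorem fourier_nonlocalKernel (hJ : IsDispersalKernel J) {t : ℝ} (ht : 0 ≤ t) (ξ : Euc N) :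
    𝓕 (fun z => (nonlocalKernel J t z : ℂ)) ξ =
      ((Real.exp (-t) * (Real.exp (t * symbol J ξ) - 1) : ℝ) : ℂ) := by
  have hswap : ∀ k : Euc N → ℝ, 𝓕 (fun z => (k z : ℂ)) ξ =
      ∫ z, k z • Complex.exp (↑(-2 * Real.pi * ⟪z, ξ⟫) * Complex.I) := fun k => by
    rw [Real.fourier_eq']
    refine integral_congr_ae (ae_of_all _ fun z => ?_)
    simp [mul_comm]
  have h := hasSum_integral_nonlocalKernel_smul hJ ht (M := 1)
    (g := fun z => Complex.exp (↑(-2 * Real.pi * ⟪z, ξ⟫) * Complex.I))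
    (Continuous.aestronglyMeasurable (by fun_prop))
    (fun z => (Complex.norm_exp_ofReal_mul_I _).le)
  simp only [← hswap, fourier_iterKernel hJ] at h
  refine h.unique ?_
  have h2 : HasSum (fun n : ℕ => ((Real.exp (-t) * ((t * symbol J ξ) ^ (n + 1) /
      (n + 1).factorial) : ℝ) : ℂ)) ((Real.exp (-t) * (Real.exp (t * symbol J ξ) - 1) : ℝ) : ℂ) :=
    Complex.hasSum_ofReal.2 ((hasSum_pow_succ_div_factorial (t * symbol J ξ)).mul_left _)
  have h3 : (fun n : ℕ => (Real.exp (-t) * (t ^ (n + 1) / (n + 1).factorial)) •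
      (symbol J ξ : ℂ) ^ (n + 1)) = fun n : ℕ =>
      ((Real.exp (-t) * ((t * symbol J ξ) ^ (n + 1) / (n + 1).factorial) : ℝ) : ℂ) := by
    funext n
    rw [Complex.real_smul]
    push_cast
    ring
  rw [h3]
  exact h2

/-- Unit mass and continuity. The segment in a prescribed direction is used to avoid the origin in
`diffusivity_pos` and the hyperplanes where the cosine equals `1` in `symbol_lt_one`. -/
theorem exists_pos_along_line (hJ : IsDispersalKernel J) (ξ : Euc N) :
    ∃ z, ∃ ε > 0, ∀ s : ℝ, |s| < ε → 0 < J (z + s • ξ) := by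
  obtain ⟨z, hz⟩ : ∃ z, 0 < J z := by
    by_contra! h
    have : J = fun _ => 0 := funext fun z => le_antisymm (h z) (hJ.nonneg z)
    have h1 := hJ.integral_eq_one
    rw [this] at h1
    simp at h1
  have hc : Continuous fun s : ℝ => J (z + s • ξ) := hJ.continuous.comp (by fun_prop)
  have h : ∀ᶠ s in 𝓝 (0 : ℝ), 0 < J (z + s • ξ) :=
    (hc.tendsto 0).eventually_const_lt (by simpa using hz)
  obtain ⟨ε, hε, h⟩ := Metric.eventually_nhds_iff.1 h
  exact ⟨z, ε, hε, fun s hs => h (by simpa using hs)⟩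

theorem diffusivity_pos [NeZero N] (hJ : IsDispersalKernel J) : 0 < diffusivity J := by
  have hN : (0 : ℝ) < N := by exact_mod_cast Nat.pos_of_ne_zero (NeZero.ne N)
  refine mul_pos (by positivity) ?_
  obtain ⟨ξ, hξ⟩ : ∃ ξ : Euc N, ξ ≠ 0 := ⟨EuclideanSpace.single 0 1, by simp⟩
  obtain ⟨z₀, ε, hε, h⟩ := exists_pos_along_line hJ ξ
  obtain ⟨z, hz, hz0⟩ : ∃ z, 0 < J z ∧ z ≠ 0 := by
    by_cases h0 : z₀ = 0
    · refine ⟨z₀ + (ε / 2) • ξ, h _ (by rw [abs_of_pos (by positivity)]; linarith), ?_⟩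
      simp [h0, hξ, hε.ne']
    · exact ⟨z₀, by simpa using h 0 (by simpa using hε), h0⟩
  refine (hJ.continuous.mul (by fun_prop)).integral_pos_of_hasCompactSupport_nonneg_nonzero
    hJ.compactSupport.mul_right (fun z => mul_nonneg (hJ.nonneg z) (by positivity)) (x := z) ?_
  exact mul_ne_zero hz.ne' (by simpa using hz0)

theorem fourier_heatKernel {a t : ℝ} (ha : 0 < a) (ht : 0 < t) (ξ : Euc N) :
    𝓕 (fun z => (heatKernel a z t : ℂ)) ξ =
      ((Real.exp (-(4 * Real.pi ^ 2 * a * t * ‖ξ‖ ^ 2)) : ℝ) : ℂ) := by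
  have hb : 0 < 1 / (4 * a * t) := by positivity
  have h := fourier_gaussian_innerProductSpace (V := Euc N) (b := ((1 / (4 * a * t) : ℝ) : ℂ))
    (by simpa using hb) ξ
  rw [Real.fourier_eq'] at h ⊢
  have heq : ∀ z : Euc N, Complex.exp (↑(-2 * Real.pi * ⟪z, ξ⟫) * Complex.I) •
        (heatKernel a z t : ℂ) =
      (((4 * Real.pi * a * t) ^ (-((N : ℝ) / 2)) : ℝ) : ℂ) *
        (Complex.exp (↑(-2 * Real.pi * ⟪z, ξ⟫) * Complex.I) •
          Complex.exp (-((1 / (4 * a * t) : ℝ) : ℂ) * ‖z‖ ^ 2)) := by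
    intro z
    have : ((heatKernel a z t : ℝ) : ℂ) = (((4 * Real.pi * a * t) ^ (-((N : ℝ) / 2)) : ℝ) : ℂ) *
        Complex.exp (-((1 / (4 * a * t) : ℝ) : ℂ) * ‖z‖ ^ 2) := by
      rw [heatKernel, Complex.ofReal_mul, Complex.ofReal_exp]
      congr 2
      push_cast
      ring
    rw [this, smul_eq_mul, smul_eq_mul]
    ring
  simp only [heq]
  rw [integral_const_mul, h]
  have hpow : ((Real.pi : ℂ) / ((1 / (4 * a * t) : ℝ) : ℂ)) ^
      ((Module.finrank ℝ (Euc N) : ℂ) / 2) =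
      (((4 * Real.pi * a * t) ^ ((N : ℝ) / 2) : ℝ) : ℂ) := by
    rw [Complex.ofReal_cpow (by positivity)]
    congr 1
    · push_cast
      field_simp
    · simp
  rw [hpow, ← mul_assoc, ← Complex.ofReal_mul, ← Real.rpow_add (by positivity), neg_add_cancel,
    Real.rpow_zero, Complex.ofReal_one, one_mul, Complex.ofReal_exp]
  congr 1
  push_cast
  have : (a : ℂ) ≠ 0 := by exact_mod_cast ha.ne'
  have : (t : ℂ) ≠ 0 := by exact_mod_cast ht.ne'
  field_simp

/-- Isotropy of the second moments of a radial kernel. -/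
theorem integral_mul_inner_sq [NeZero N] (hJ : IsDispersalKernel J) (ξ : Euc N) :
    ∫ z, J z * ⟪z, ξ⟫ ^ 2 = 2 * diffusivity J * ‖ξ‖ ^ 2 := by
  have hint : ∀ g : Euc N → ℝ, Continuous g → Integrable fun z => J z * g z := fun g hg =>
    (hJ.continuous.mul hg).integrable_of_hasCompactSupport hJ.compactSupport.mul_right
  have hrefl : ∀ v w : Euc N, ‖v‖ = ‖w‖ → ∫ z, J z * ⟪z, v⟫ ^ 2 = ∫ z, J z * ⟪z, w⟫ ^ 2 := by
    intro v w hvw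
    -- This reflection exchanges `v` and `w` and preserves both `J` and Lebesgue measure. The second
    -- moment therefore depends only on the length of the direction, and summing over an orthonormal
    -- basis computes it.
    set R := (ℝ ∙ (v - w))ᗮ.reflection with hR
    have hRv : R v = w := Submodule.reflection_sub hvw
    rw [← R.measurePreserving.integral_comp' (f := R.toMeasurableEquiv)]
    refine integral_congr_ae (ae_of_all _ fun z => ?_)
    simp only
    rw [LinearIsometryEquiv.coe_toMeasurableEquiv, hJ.radial (R z) z (R.norm_map z), ← hRv,
      ← R.inner_map_map (R z) v, Submodule.reflection_reflection]
  set e := EuclideanSpace.basisFun (Fin N) ℝ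
  have hN : (N : ℝ) ≠ 0 := by exact_mod_cast NeZero.ne N
  have hsum : (N : ℝ) * ∫ z, J z * ⟪z, ξ⟫ ^ 2 = ‖ξ‖ ^ 2 * ∫ z, J z * ‖z‖ ^ 2 := by
    calc (N : ℝ) * ∫ z, J z * ⟪z, ξ⟫ ^ 2 = ∑ i : Fin N, ∫ z, J z * ⟪z, ‖ξ‖ • e i⟫ ^ 2 := by
          rw [Finset.sum_congr rfl fun i _ => hrefl (‖ξ‖ • e i) ξ (by simp [norm_smul])]
          simp
      _ = ∫ z, ∑ i : Fin N, J z * ⟪z, ‖ξ‖ • e i⟫ ^ 2 := by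
          rw [integral_finsetSum]
          exact fun i _ => hint _ (by fun_prop)
      _ = ∫ z, ‖ξ‖ ^ 2 * (J z * ‖z‖ ^ 2) := by
          congr 1 with z
          rw [← e.sum_sq_inner_left z, ← Finset.mul_sum, mul_left_comm, Finset.mul_sum]
          simp only [inner_smul_right, mul_pow, Finset.mul_sum]
      _ = _ := integral_const_mul _ _
  rw [diffusivity]
  field_simp
  linarith

/-- Taylor expansion of the cosine under the integral. The quadratic term is `(2π)² / 2` times the
second moment `2𝔞|ξ|²` in direction `ξ`. -/
theorem exists_abs_one_sub_symbol_sub_le [NeZero N] (hJ : IsDispersalKernel J) :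
    ∃ C r, 0 < C ∧ 0 < r ∧ ∀ ξ : Euc N, ‖ξ‖ ≤ r →
      |1 - symbol J ξ - 4 * Real.pi ^ 2 * diffusivity J * ‖ξ‖ ^ 2| ≤ C * ‖ξ‖ ^ 4 := by
  obtain ⟨ρ, hρ0, hρ⟩ : ∃ ρ : ℝ, 0 < ρ ∧ ∀ z, J z ≠ 0 → ‖z‖ ≤ ρ := by
    obtain ⟨ρ, hρ⟩ := hJ.compactSupport.isBounded.exists_norm_le
    exact ⟨max ρ 1, by positivity,
      fun z hz => (hρ z (subset_tsupport _ hz)).trans (le_max_left _ _)⟩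
  have hpi := Real.pi_pos
  -- This radius keeps the phase `2π⟪z, ξ⟫` in `[-1, 1]` wherever `J z ≠ 0`, the range in which
  -- `Real.cos_bound` is valid.
  refine ⟨(2 * Real.pi * ρ) ^ 4, 1 / (2 * Real.pi * ρ), by positivity, by positivity,
    fun ξ hξ => ?_⟩
  have hsq : Integrable fun z => J z * ⟪z, ξ⟫ ^ 2 :=
    (hJ.continuous.mul (by fun_prop)).integrable_of_hasCompactSupport
      hJ.compactSupport.mul_right
  have heq : 1 - symbol J ξ - 4 * Real.pi ^ 2 * diffusivity J * ‖ξ‖ ^ 2 =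
      ∫ z, J z * (1 - (2 * Real.pi * ⟪z, ξ⟫) ^ 2 / 2 - Real.cos (2 * Real.pi * ⟪z, ξ⟫)) := by
    have h1 : ∀ z, J z * (1 - (2 * Real.pi * ⟪z, ξ⟫) ^ 2 / 2 - Real.cos (2 * Real.pi * ⟪z, ξ⟫)) =
        J z - 2 * Real.pi ^ 2 * (J z * ⟪z, ξ⟫ ^ 2) - J z * Real.cos (2 * Real.pi * ⟪z, ξ⟫) :=
      fun z => by ring
    have h2 : Integrable fun z => J z - 2 * Real.pi ^ 2 * (J z * ⟪z, ξ⟫ ^ 2) :=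
      hJ.integrable.sub (hsq.const_mul _)
    simp only [h1]
    rw [integral_sub h2 (integrable_mul_cos hJ ξ),
      integral_sub hJ.integrable (hsq.const_mul _), integral_const_mul, integral_mul_inner_sq hJ,
      hJ.integral_eq_one, symbol]
    ring
  rw [heq]
  refine abs_integral_le_integral_abs.trans ?_
  calc _ ≤ ∫ z, J z * ((2 * Real.pi * ρ) ^ 4 * ‖ξ‖ ^ 4) := by
        refine integral_mono_of_nonneg (ae_of_all _ fun z => abs_nonneg _)
          (hJ.integrable.mul_const _) (ae_of_all _ fun z => ?_)
        simp only [abs_mul, abs_of_nonneg (hJ.nonneg z)]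
        by_cases hz : J z = 0
        · simp [hz]
        have hθ : |2 * Real.pi * ⟪z, ξ⟫| ≤ 2 * Real.pi * ρ * ‖ξ‖ := by
          rw [abs_mul, abs_of_pos (by positivity), mul_assoc _ ρ]
          refine mul_le_mul_of_nonneg_left ((abs_real_inner_le_norm z ξ).trans ?_) (by positivity)
          exact mul_le_mul_of_nonneg_right (hρ z hz) (norm_nonneg _)
        have hθ1 : |2 * Real.pi * ⟪z, ξ⟫| ≤ 1 := hθ.trans (by
          rwa [le_div_iff₀ (by positivity), mul_comm] at hξ)
        refine mul_le_mul_of_nonneg_left ?_ (hJ.nonneg z)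
        rw [abs_sub_comm]
        refine (Real.cos_bound hθ1).trans ?_
        rw [← mul_pow]
        have := pow_le_pow_left₀ (abs_nonneg _) hθ 4
        have h0 : 0 ≤ |2 * Real.pi * ⟪z, ξ⟫| ^ 4 := by positivity
        linarith
    _ = _ := by rw [integral_mul_const, hJ.integral_eq_one, one_mul]

/-- A smooth compactly supported function is Schwartz, and so is its Fourier transform. This makes
the high-frequency error integrable. -/
theorem integrable_symbol (hJ : IsDispersalKernel J) : Integrable (symbol J) := by
  have hsm : ContDiff ℝ ∞ fun z => (J z : ℂ) := Complex.ofRealCLM.contDiff.comp hJ.smooth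
  have hcs : HasCompactSupport fun z => (J z : ℂ) :=
    hJ.compactSupport.comp_left (g := fun r : ℝ => (r : ℂ)) Complex.ofReal_zero
  have h := (𝓕 (hcs.toSchwartzMap hsm)).integrable (μ := volume)
  rw [SchwartzMap.fourier_coe] at h
  have h2 : (𝓕 (hcs.toSchwartzMap hsm : Euc N → ℂ)) = fun ξ => (symbol J ξ : ℂ) :=
    funext fun ξ => fourier_ofReal_eq_symbol hJ ξ
  rw [h2] at h
  simpa using h.re

theorem continuous_symbol (hJ : IsDispersalKernel J) : Continuous (symbol J) := by
  refine continuous_of_dominated (bound := J)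
    (fun ξ => (integrable_mul_cos hJ ξ).aestronglyMeasurable) (fun ξ => ae_of_all _ fun z => ?_)
    hJ.integrable (ae_of_all _ fun z => by fun_prop)
  rw [Real.norm_eq_abs, abs_mul, abs_of_nonneg (hJ.nonneg z)]
  exact mul_le_of_le_one_right (hJ.nonneg z) (Real.abs_cos_le_one _)

/-- The Riemann–Lebesgue lemma. -/
theorem tendsto_symbol_cocompact (hJ : IsDispersalKernel J) :
    Tendsto (symbol J) (cocompact _) (𝓝 0) := by
  have h := tendsto_integral_exp_inner_smul_cocompact fun z => (J z : ℂ)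
  have h2 : (fun w : Euc N => ∫ v, Real.fourierChar (-⟪v, w⟫) • (J v : ℂ)) =
      fun ξ => (symbol J ξ : ℂ) := funext fun ξ => by
    rw [← fourier_ofReal_eq_symbol hJ, Real.fourier_eq]
  rw [h2] at h
  exact (Complex.continuous_re.tendsto _).comp h

/-- The difference `1 - σ(ξ)` is the integral of the continuous nonnegative function `J (1 - cos)`,
which is positive at some point. -/
theorem symbol_lt_one (hJ : IsDispersalKernel J) {ξ : Euc N} (hξ : ξ ≠ 0) : symbol J ξ < 1 := by
  have hcont : Continuous fun z => J z * (1 - Real.cos (2 * Real.pi * ⟪z, ξ⟫)) :=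
    hJ.continuous.mul (by fun_prop)
  have hcs : HasCompactSupport fun z => J z * (1 - Real.cos (2 * Real.pi * ⟪z, ξ⟫)) :=
    hJ.compactSupport.mul_right
  have h0 : ∀ z, 0 ≤ J z * (1 - Real.cos (2 * Real.pi * ⟪z, ξ⟫)) := fun z =>
    mul_nonneg (hJ.nonneg z) (by linarith [Real.cos_le_one (2 * Real.pi * ⟪z, ξ⟫)])
  have heq : ∫ z, J z * (1 - Real.cos (2 * Real.pi * ⟪z, ξ⟫)) = 1 - symbol J ξ := by
    simp only [mul_sub, mul_one]
    rw [integral_sub hJ.integrable (integrable_mul_cos hJ ξ), hJ.integral_eq_one, symbol]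
  obtain ⟨z₀, ε, hε, hpos⟩ := exists_pos_along_line hJ ξ
  obtain ⟨z₁, hz₁, hcos⟩ : ∃ z, 0 < J z ∧ Real.cos (2 * Real.pi * ⟪z, ξ⟫) ≠ 1 := by
    by_cases h : Real.cos (2 * Real.pi * ⟪z₀, ξ⟫) = 1
    · have hn : 0 < ‖ξ‖ ^ 2 := by positivity
      -- Moving from `z₀` by `s • ξ` stays where `J > 0` and adds `2πs|ξ|² ∈ (0, π]` to the phase,
      -- which cannot be a multiple of `2π`.
      set s : ℝ := min (ε / 2) (1 / (2 * ‖ξ‖ ^ 2))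
      have hs0 : 0 < s := lt_min (by positivity) (by positivity)
      have hs1 : s * ‖ξ‖ ^ 2 ≤ 1 / 2 := by
        calc s * ‖ξ‖ ^ 2 ≤ 1 / (2 * ‖ξ‖ ^ 2) * ‖ξ‖ ^ 2 :=
              mul_le_mul_of_nonneg_right (min_le_right _ _) hn.le
          _ = 1 / 2 := by field_simp
      refine ⟨z₀ + s • ξ, hpos s ?_, fun hc => ?_⟩
      · rw [abs_of_pos hs0]
        exact (min_le_left _ _).trans_lt (by linarith)
      · have hsin : Real.sin (2 * Real.pi * ⟪z₀, ξ⟫) = 0 := Real.sin_eq_zero_iff_cos_eq.2 (Or.inl h)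
        rw [inner_add_left, inner_smul_left, real_inner_self_eq_norm_sq, mul_add, Real.cos_add, h,
          hsin, one_mul, zero_mul, sub_zero] at hc
        simp only [conj_trivial] at hc
        have h1 : 0 < s * ‖ξ‖ ^ 2 := by positivity
        have := (Real.cos_eq_one_iff_of_lt_of_lt (by nlinarith [Real.pi_pos])
          (by nlinarith [Real.pi_pos])).1 hc
        have : 0 < 2 * Real.pi * (s * ‖ξ‖ ^ 2) := by positivity
        linarith
    · exact ⟨z₀, by simpa using hpos 0 (by simpa using hε), h⟩
  have hint : 0 < ∫ z, J z * (1 - Real.cos (2 * Real.pi * ⟪z, ξ⟫)) := by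
    refine hcont.integral_pos_of_hasCompactSupport_nonneg_nonzero hcs h0 (x := z₁) ?_
    exact mul_ne_zero hz₁.ne' (sub_ne_zero.2 hcos.symm)
  linarith

/-- Spectral gap: the symbol is below `1 / 2` outside a compact set, and on the compact remainder
its maximum is attained and is less than `1`. -/
theorem exists_symbol_le_one_sub (hJ : IsDispersalKernel J) {r : ℝ} (hr : 0 < r) :
    ∃ δ, 0 < δ ∧ δ ≤ 1 ∧ ∀ ξ : Euc N, r ≤ ‖ξ‖ → symbol J ξ ≤ 1 - δ := by
  have h1 : ∀ᶠ ξ in cocompact (Euc N), symbol J ξ < 1 / 2 :=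
    (tendsto_symbol_cocompact hJ).eventually_lt_const (by norm_num)
  obtain ⟨K, hK, hKs⟩ := mem_cocompact.1 h1
  have hK' : IsCompact (K ∩ {ξ | r ≤ ‖ξ‖}) :=
    hK.inter_right (isClosed_le continuous_const continuous_norm)
  rcases (K ∩ {ξ | r ≤ ‖ξ‖}).eq_empty_or_nonempty with he | hne
  · refine ⟨1 / 2, by norm_num, by norm_num, fun ξ hξ => ?_⟩
    have : ξ ∉ K := fun hk => (he ▸ (⟨hk, hξ⟩ : ξ ∈ K ∩ {ξ | r ≤ ‖ξ‖}) : ξ ∈ (∅ : Set (Euc N)))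
    have := hKs this
    simp only [mem_ofPred_eq] at this
    linarith
  · obtain ⟨ξ₀, hξ₀, hmax⟩ := hK'.exists_isMaxOn hne (continuous_symbol hJ).continuousOn
    have hlt := symbol_lt_one hJ (norm_pos_iff.1 (hr.trans_le hξ₀.2))
    refine ⟨min (1 / 2) (1 - symbol J ξ₀), lt_min (by norm_num) (by linarith),
      (min_le_left _ _).trans (by norm_num), fun ξ hξ => ?_⟩
    by_cases hk : ξ ∈ K
    · have : symbol J ξ ≤ symbol J ξ₀ := hmax ⟨hk, hξ⟩
      linarith [min_le_right (1 / 2) (1 - symbol J ξ₀)]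
    · have := hKs hk
      simp only [mem_ofPred_eq] at this
      linarith [min_le_left (1 / 2) (1 - symbol J ξ₀)]

theorem abs_exp_neg_sub_exp_neg_le {a b c : ℝ} (ha : c ≤ a) (hb : c ≤ b) :
    |Real.exp (-a) - Real.exp (-b)| ≤ |a - b| * Real.exp (-c) := by
  wlog h : a ≤ b generalizing a b
  · rw [abs_sub_comm, abs_sub_comm a]
    exact this hb ha (le_of_not_ge h)
  rw [abs_of_nonneg (sub_nonneg.2 (Real.exp_le_exp.2 (neg_le_neg h))), abs_sub_comm a,
    abs_of_nonneg (sub_nonneg.2 h)]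
  have h1 : Real.exp (-b) = Real.exp (-a) * Real.exp (-(b - a)) := by
    rw [← Real.exp_add]
    ring_nf
  have h2 := Real.add_one_le_exp (-(b - a))
  have h3 : Real.exp (-a) ≤ Real.exp (-c) := Real.exp_le_exp.2 (neg_le_neg ha)
  have h4 := Real.exp_pos (-a)
  calc Real.exp (-a) - Real.exp (-b) = Real.exp (-a) * (1 - Real.exp (-(b - a))) := by
        rw [h1]; ring
    _ ≤ Real.exp (-a) * (b - a) := mul_le_mul_of_nonneg_left (by linarith) h4.le
    _ ≤ (b - a) * Real.exp (-c) := by nlinarith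

theorem abs_exp_sub_one_le_mul_exp {y z : ℝ} (hz : 0 ≤ z) (hy : y ≤ z) :
    |Real.exp y - 1| ≤ |y| * Real.exp z := by
  have := abs_exp_neg_sub_exp_neg_le (a := -y) (b := 0) (c := -z) (by linarith) (by linarith)
  simpa using this

/-- Fourier inversion: the sup norm of a function is at most the `L¹` norm of its transform. -/
theorem abs_le_integral_of_fourier_eq {D φ g : Euc N → ℝ} (hc : Continuous D) (hi : Integrable D)
    (h : ∀ ξ, 𝓕 (fun x => (D x : ℂ)) ξ = (φ ξ : ℂ)) (hφ : Continuous φ) (hg : Integrable g)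
    (hb : ∀ ξ, |φ ξ| ≤ g ξ) (x : Euc N) : |D x| ≤ ∫ ξ, g ξ := by
  have hF : 𝓕 (fun x => (D x : ℂ)) = fun ξ => (φ ξ : ℂ) := funext h
  have hφi : Integrable φ := hg.mono' hφ.aestronglyMeasurable (ae_of_all _ hb)
  have hinv := Continuous.fourierInv_fourier_eq (Complex.continuous_ofReal.comp hc)
    (integrable_complex_ofReal hi) (by
      change Integrable (𝓕 (fun x => (D x : ℂ)))
      rw [hF]
      exact integrable_complex_ofReal hφi)
  have hx := congrFun hinv x
  change 𝓕⁻ (𝓕 (fun x => (D x : ℂ))) x = (D x : ℂ) at hx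
  rw [hF, Real.fourierInv_eq'] at hx
  rw [← Real.norm_eq_abs, ← Complex.norm_real, ← hx]
  refine norm_integral_le_of_norm_le hg (ae_of_all _ fun ξ => ?_)
  rw [norm_smul, Complex.norm_exp_ofReal_mul_I, one_mul, Complex.norm_real]
  exact hb ξ

/-- At low frequencies the quartic Taylor error costs a factor `t|ξ|⁴ = t⁻¹(t|ξ|²)²`, and the
Gaussian absorbs the square. At high frequencies each of the two terms is small by itself. The
factor `|symbol J ξ|` is kept there so that the bound is integrable in `ξ`. -/
theorem exists_abs_symbol_error_le [NeZero N] (hJ : IsDispersalKernel J) :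
    ∃ C c δ, 0 < C ∧ 0 < c ∧ 0 < δ ∧ ∀ t : ℝ, 1 ≤ t → ∀ ξ : Euc N,
      |Real.exp (-t) * (Real.exp (t * symbol J ξ) - 1) -
        Real.exp (-(4 * Real.pi ^ 2 * diffusivity J * t * ‖ξ‖ ^ 2))| ≤
      C / t * Real.exp (-(c * t) * ‖ξ‖ ^ 2) + t * Real.exp (-(δ * t)) * |symbol J ξ| := by
  obtain ⟨C₁, r₁, hC₁, hr₁, h₁⟩ := exists_abs_one_sub_symbol_sub_le hJ
  set B : ℝ := 4 * Real.pi ^ 2 * diffusivity J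
  have hB : 0 < B := by have := diffusivity_pos hJ; have := Real.pi_pos; positivity
  -- For `|ξ| ≤ r` the quartic error is at most half of the quadratic term, so `1 - σ ≥ (B/2)|ξ|²`.
  -- The bound `r ≤ 1` serves to dominate `e^{-t/2}` by a Gaussian in `ξ`.
  set r : ℝ := min (min r₁ 1) (√(B / (2 * C₁)))
  have hr : 0 < r := lt_min (lt_min hr₁ one_pos) (Real.sqrt_pos.2 (by positivity))
  have hr2 : C₁ * r ^ 2 ≤ B / 2 := by
    have : r ^ 2 ≤ B / (2 * C₁) := by
      rw [← Real.sq_sqrt (show 0 ≤ B / (2 * C₁) by positivity)]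
      exact pow_le_pow_left₀ hr.le (min_le_right _ _) 2
    calc C₁ * r ^ 2 ≤ C₁ * (B / (2 * C₁)) := mul_le_mul_of_nonneg_left this hC₁.le
      _ = B / 2 := by field_simp
  obtain ⟨δ, hδ, hδ1, hgap⟩ := exists_symbol_le_one_sub hJ hr
  obtain ⟨K₁, hK₁, hk₁⟩ := exists_pow_mul_exp_neg_le 2 (show 0 < B / 4 by positivity)
  obtain ⟨K₂, hK₂, hk₂⟩ := exists_pow_mul_exp_neg_le 1 (show (0 : ℝ) < 1 / 2 by norm_num)
  obtain ⟨K₃, hK₃, hk₃⟩ := exists_pow_mul_exp_neg_le 1 (show 0 < B / 2 * r ^ 2 by positivity)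
  -- The decays `e^{-(B/2)t|ξ|²}` and `e^{-t}` are each split into two equal factors: one absorbs
  -- powers of the exponent, the other survives as the common Gaussian.
  set c : ℝ := min (B / 4) (1 / 2)
  have hc : 0 < c := lt_min (by positivity) (by norm_num)
  refine ⟨C₁ * K₁ + K₂ + K₃, c, δ, by positivity, hc, hδ, fun t ht ξ => ?_⟩
  have ht0 : 0 < t := by linarith
  have hmono : ∀ b, c ≤ b → Real.exp (-(b * (t * ‖ξ‖ ^ 2))) ≤
      Real.exp (-(c * t) * ‖ξ‖ ^ 2) := fun b hb => by
    rw [neg_mul, mul_assoc]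
    exact Real.exp_le_exp.2 (neg_le_neg (mul_le_mul_of_nonneg_right hb (by positivity)))
  set E := Real.exp (-(c * t) * ‖ξ‖ ^ 2)
  have hE : 0 < E := Real.exp_pos _
  have hsplit : Real.exp (-t) * (Real.exp (t * symbol J ξ) - 1) =
      Real.exp (-(t * (1 - symbol J ξ))) - Real.exp (-t) := by
    rw [mul_sub, ← Real.exp_add]
    ring_nf
  have hlast : 0 ≤ t * Real.exp (-(δ * t)) * |symbol J ξ| := by positivity
  rcases le_total ‖ξ‖ r with hξ | hξ
  · have hq := h₁ ξ (hξ.trans ((min_le_left _ _).trans (min_le_left _ _)))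
    have hξ1 : ‖ξ‖ ≤ 1 := hξ.trans ((min_le_left _ _).trans (min_le_right _ _))
    have h4 : C₁ * ‖ξ‖ ^ 4 ≤ B / 2 * ‖ξ‖ ^ 2 := by
      have : ‖ξ‖ ^ 2 ≤ r ^ 2 := pow_le_pow_left₀ (norm_nonneg _) hξ 2
      calc C₁ * ‖ξ‖ ^ 4 = C₁ * ‖ξ‖ ^ 2 * ‖ξ‖ ^ 2 := by ring
        _ ≤ C₁ * r ^ 2 * ‖ξ‖ ^ 2 := by gcongr
        _ ≤ B / 2 * ‖ξ‖ ^ 2 := by gcongr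
    have hlow : B / 2 * ‖ξ‖ ^ 2 ≤ 1 - symbol J ξ := by
      have := (abs_le.1 hq).1
      linarith
    have hdiff := abs_exp_neg_sub_exp_neg_le (a := t * (1 - symbol J ξ)) (b := B * t * ‖ξ‖ ^ 2)
      (c := B / 2 * (t * ‖ξ‖ ^ 2)) (by nlinarith) (by
        have : 0 ≤ B * (t * ‖ξ‖ ^ 2) := by positivity
        linarith)
    have hx : 0 ≤ t * ‖ξ‖ ^ 2 := by positivity
    have hmain : |t * (1 - symbol J ξ) - B * t * ‖ξ‖ ^ 2| * Real.exp (-(B / 2 * (t * ‖ξ‖ ^ 2))) ≤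
        C₁ * K₁ / t * E := by
      have e1 : |t * (1 - symbol J ξ) - B * t * ‖ξ‖ ^ 2| ≤ C₁ / t * (t * ‖ξ‖ ^ 2) ^ 2 := by
        have : t * (1 - symbol J ξ) - B * t * ‖ξ‖ ^ 2 =
          t * (1 - symbol J ξ - B * ‖ξ‖ ^ 2) := by ring
        rw [this, abs_mul, abs_of_pos ht0]
        calc _ ≤ t * (C₁ * ‖ξ‖ ^ 4) := mul_le_mul_of_nonneg_left hq ht0.le
          _ = _ := by field_simp
      have e2 : Real.exp (-(B / 2 * (t * ‖ξ‖ ^ 2))) = Real.exp (-(B / 4 * (t * ‖ξ‖ ^ 2))) *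
          Real.exp (-(B / 4 * (t * ‖ξ‖ ^ 2))) := by
        rw [← Real.exp_add]
        ring_nf
      rw [e2]
      calc _ ≤ C₁ / t * (t * ‖ξ‖ ^ 2) ^ 2 * (Real.exp (-(B / 4 * (t * ‖ξ‖ ^ 2))) * E) := by
            refine mul_le_mul e1 ?_ (by positivity) (by positivity)
            exact mul_le_mul_of_nonneg_left (hmono _ (min_le_left _ _)) (Real.exp_pos _).le
        _ = C₁ / t * ((t * ‖ξ‖ ^ 2) ^ 2 * Real.exp (-(B / 4 * (t * ‖ξ‖ ^ 2)))) * E := by ring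
        _ ≤ C₁ / t * K₁ * E := by gcongr; exact hk₁ _ hx
        _ = _ := by ring
    have hexp : Real.exp (-t) ≤ K₂ / t * E := by
      have e1 : Real.exp (-t) = Real.exp (-(1 / 2 * t)) * Real.exp (-(1 / 2 * t)) := by
        rw [← Real.exp_add]
        ring_nf
      have e2 : Real.exp (-(1 / 2 * t)) ≤ K₂ / t := by
        rw [le_div_iff₀ ht0, mul_comm]
        simpa using hk₂ t ht0.le
      have e3 : Real.exp (-(1 / 2 * t)) ≤ E := by
        refine le_trans (Real.exp_le_exp.2 (neg_le_neg ?_)) (hmono (1 / 2) (min_le_right _ _))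
        have : ‖ξ‖ ^ 2 ≤ 1 := pow_le_one₀ (norm_nonneg _) hξ1
        nlinarith
      rw [e1]
      exact mul_le_mul e2 e3 (Real.exp_pos _).le (by positivity)
    have h0 : 0 ≤ K₃ / t * E := by positivity
    rw [hsplit]
    calc _ = |(Real.exp (-(t * (1 - symbol J ξ))) - Real.exp (-(B * t * ‖ξ‖ ^ 2))) -
            Real.exp (-t)| := by ring_nf
      _ ≤ |Real.exp (-(t * (1 - symbol J ξ))) - Real.exp (-(B * t * ‖ξ‖ ^ 2))| +
          |Real.exp (-t)| := abs_sub _ _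
      _ ≤ C₁ * K₁ / t * E + K₂ / t * E := by
          rw [abs_of_pos (Real.exp_pos (-t))]
          exact add_le_add (hdiff.trans hmain) hexp
      _ ≤ (C₁ * K₁ + K₂ + K₃) / t * E := by
          have : (C₁ * K₁ + K₂ + K₃) / t * E = C₁ * K₁ / t * E + K₂ / t * E + K₃ / t * E := by ring
          linarith
      _ ≤ _ := le_add_of_nonneg_right hlast
  -- High frequencies: `|e^{tσ} - 1| ≤ t|σ| e^{t(1-δ)}` by the gap, and the heat symbol is
  -- exponentially small in `t`.
  · have hs := hgap ξ hξ
    have h1 : |Real.exp (-t) * (Real.exp (t * symbol J ξ) - 1)| ≤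
        t * Real.exp (-(δ * t)) * |symbol J ξ| := by
      have := abs_exp_sub_one_le_mul_exp (y := t * symbol J ξ) (z := t * (1 - δ))
        (mul_nonneg ht0.le (by linarith)) (mul_le_mul_of_nonneg_left hs ht0.le)
      rw [abs_mul, abs_of_pos (Real.exp_pos _)]
      calc _ ≤ Real.exp (-t) * (|t * symbol J ξ| * Real.exp (t * (1 - δ))) :=
            mul_le_mul_of_nonneg_left this (Real.exp_pos _).le
        _ = |t * symbol J ξ| * (Real.exp (-t) * Real.exp (t * (1 - δ))) := by ring
        _ = _ := by
          rw [← Real.exp_add, abs_mul, abs_of_pos ht0]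
          ring_nf
    have h2 : Real.exp (-(B * t * ‖ξ‖ ^ 2)) ≤ K₃ / t * E := by
      have e1 : Real.exp (-(B * t * ‖ξ‖ ^ 2)) = Real.exp (-(B / 2 * t * ‖ξ‖ ^ 2)) *
          Real.exp (-(B / 2 * (t * ‖ξ‖ ^ 2))) := by
        rw [← Real.exp_add]
        ring_nf
      have e2 : Real.exp (-(B / 2 * t * ‖ξ‖ ^ 2)) ≤ K₃ / t := by
        have : Real.exp (-(B / 2 * t * ‖ξ‖ ^ 2)) ≤ Real.exp (-(B / 2 * r ^ 2 * t)) := by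
          refine Real.exp_le_exp.2 (neg_le_neg ?_)
          have : r ^ 2 ≤ ‖ξ‖ ^ 2 := pow_le_pow_left₀ hr.le hξ 2
          have : B / 2 * t * r ^ 2 ≤ B / 2 * t * ‖ξ‖ ^ 2 := by gcongr
          linarith
        refine this.trans ?_
        rw [le_div_iff₀ ht0, mul_comm]
        simpa using hk₃ t ht0.le
      rw [e1]
      refine mul_le_mul e2 (hmono _ ((min_le_left _ _).trans (by linarith)))
        (Real.exp_pos _).le (by positivity)
    have h0 : 0 ≤ (C₁ * K₁ + K₂) / t * E := by positivity
    calc _ ≤ |Real.exp (-t) * (Real.exp (t * symbol J ξ) - 1)| +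
          |Real.exp (-(B * t * ‖ξ‖ ^ 2))| := abs_sub _ _
      _ ≤ t * Real.exp (-(δ * t)) * |symbol J ξ| + K₃ / t * E := by
          rw [abs_of_pos (Real.exp_pos (-(B * t * ‖ξ‖ ^ 2)))]
          exact add_le_add h1 h2
      _ ≤ _ := by
          have : (C₁ * K₁ + K₂ + K₃) / t * E = (C₁ * K₁ + K₂) / t * E + K₃ / t * E := by ring
          linarith

theorem continuous_heatKernel (a t : ℝ) : Continuous fun x : Euc N => heatKernel a x t := by
  unfold heatKernel
  fun_prop

theorem heatKernel_nonneg {a t : ℝ} (ha : 0 ≤ a) (ht : 0 ≤ t) (x : Euc N) :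
    0 ≤ heatKernel a x t := by
  unfold heatKernel
  have := Real.pi_pos
  positivity

theorem heatKernel_eq (a t : ℝ) (x : Euc N) : heatKernel a x t =
    (4 * Real.pi * a * t) ^ (-((N : ℝ) / 2)) * Real.exp (-(1 / (4 * a * t)) * ‖x‖ ^ 2) := by
  rw [heatKernel]
  congr 2
  ring

theorem integrable_heatKernel {a t : ℝ} (ha : 0 < a) (ht : 0 < t) :
    Integrable fun x : Euc N => heatKernel a x t := by
  simp only [heatKernel_eq]
  exact (integrable_exp_neg_mul_norm_sq (by positivity)).const_mul _

theorem integral_heatKernel {a t : ℝ} (ha : 0 < a) (ht : 0 < t) :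
    ∫ x : Euc N, heatKernel a x t = 1 := by
  simp only [heatKernel_eq]
  have := Real.pi_pos
  rw [integral_const_mul, integral_exp_neg_mul_norm_sq (by positivity)]
  have h : Real.pi / (1 / (4 * a * t)) = 4 * Real.pi * a * t := by field_simp
  rw [h, ← Real.rpow_add (by positivity), neg_add_cancel, Real.rpow_zero]

/-- **Local limit theorem**: the kernel of the nonlocal operator is uniformly close to the heat
kernel. -/
theorem exists_abs_nonlocalKernel_sub_heatKernel_le [NeZero N] (hJ : IsDispersalKernel J) :
    ∃ C, 0 < C ∧ ∀ t : ℝ, 1 ≤ t → ∀ x : Euc N,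
      |nonlocalKernel J t x - heatKernel (diffusivity J) x t| ≤ C * t ^ (-((N : ℝ) / 2) - 1) := by
  obtain ⟨C, c, δ, hC, hc, hδ, h⟩ := exists_abs_symbol_error_le hJ
  obtain ⟨K, hK, hk⟩ := exists_rpow_mul_exp_neg_le ((N : ℝ) / 2 + 2) hδ
  have ha := diffusivity_pos hJ
  set S := ∫ ξ, |symbol J ξ|
  have hS : 0 ≤ S := integral_nonneg fun ξ => abs_nonneg _
  have hpi := Real.pi_pos
  refine ⟨C * (Real.pi / c) ^ ((N : ℝ) / 2) + K * S, by positivity, fun t ht x => ?_⟩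
  have ht0 : 0 < t := by linarith
  have hg1 : Integrable fun ξ : Euc N => C / t * Real.exp (-(c * t) * ‖ξ‖ ^ 2) :=
    (integrable_exp_neg_mul_norm_sq (by positivity)).const_mul _
  have hg2 : Integrable fun ξ : Euc N => t * Real.exp (-(δ * t)) * |symbol J ξ| :=
    (integrable_symbol hJ).abs.const_mul _
  -- Integrating the Gaussian in `ξ` yields `t^{-N/2}`, which with `C / t` is the claimed rate. The
  -- high-frequency part decays exponentially.
  have key := abs_le_integral_of_fourier_eq
    (D := fun x => nonlocalKernel J t x - heatKernel (diffusivity J) x t)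
    (φ := fun ξ => Real.exp (-t) * (Real.exp (t * symbol J ξ) - 1) -
        Real.exp (-(4 * Real.pi ^ 2 * diffusivity J * t * ‖ξ‖ ^ 2)))
    ((continuous_nonlocalKernel hJ t).sub (continuous_heatKernel _ _))
    ((integrable_nonlocalKernel hJ ht0.le).sub (integrable_heatKernel ha ht0)) (fun ξ => ?_) ?_
    (hg1.add hg2) (h t ht) x
  · refine key.trans ?_
    simp only [Pi.add_apply]
    rw [integral_add hg1 hg2, integral_const_mul, integral_const_mul,
      integral_exp_neg_mul_norm_sq (by positivity), add_mul]
    refine add_le_add (le_of_eq ?_) ?_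
    · rw [← div_div, Real.div_rpow (by positivity) ht0.le, Real.rpow_sub ht0,
        Real.rpow_neg ht0.le, Real.rpow_one]
      field_simp
    · have h1 : t * Real.exp (-(δ * t)) ≤ K * t ^ (-((N : ℝ) / 2) - 1) := by
        have h2 : t ^ ((N : ℝ) / 2 + 2) * t ^ (-((N : ℝ) / 2) - 1) = t := by
          rw [← Real.rpow_add ht0]
          ring_nf
          exact Real.rpow_one t
        calc t * Real.exp (-(δ * t)) = (t ^ ((N : ℝ) / 2 + 2) * Real.exp (-(δ * t))) *
              t ^ (-((N : ℝ) / 2) - 1) := by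
              rw [mul_right_comm, h2]
          _ ≤ _ := mul_le_mul_of_nonneg_right (hk t ht) (by positivity)
      calc _ ≤ K * t ^ (-((N : ℝ) / 2) - 1) * S := mul_le_mul_of_nonneg_right h1 hS
        _ = _ := by ring
  · have h1 := fourier_nonlocalKernel hJ ht0.le ξ
    have h2 := fourier_heatKernel ha ht0 ξ
    rw [Real.fourier_eq'] at h1 h2 ⊢
    have hb : ∀ k : Euc N → ℝ, Integrable k → Integrable fun z =>
        Complex.exp (↑(-2 * Real.pi * ⟪z, ξ⟫) * Complex.I) • (k z : ℂ) := fun k hk =>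
      (integrable_complex_ofReal hk).bdd_mul (c := 1)
        (Continuous.aestronglyMeasurable (by fun_prop))
        (ae_of_all _ fun z => (Complex.norm_exp_ofReal_mul_I _).le)
    rw [Complex.ofReal_sub, ← h1, ← h2, ← integral_sub (hb _ (integrable_nonlocalKernel hJ ht0.le))
      (hb _ (integrable_heatKernel ha ht0))]
    simp only [Complex.ofReal_sub, smul_sub]
  · have := continuous_symbol hJ
    fun_prop

end Fourier

/-! ### Convolution with algebraically decaying data -/

section PowerWeights

variable {N : ℕ}

theorem integrableOn_norm_rpow_ball [NeZero N] {β : ℝ} (hβ : β < N) (R : ℝ) :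
    IntegrableOn (fun y : Euc N => ‖y‖ ^ (-β)) (Metric.ball 0 R) := by
  rw [integrableOn_fun_norm_addHaar volume (f := fun s : ℝ => s ^ (-β)), finrank_euclideanSpace,
    Fintype.card_fin]
  rcases le_or_gt R 0 with hR | hR
  · simp [Ioo_eq_empty_of_le hR]
  have hN : (1 : ℝ) ≤ N := by exact_mod_cast Nat.one_le_iff_ne_zero.2 (NeZero.ne N)
  have h := (intervalIntegral.intervalIntegrable_rpow' (a := 0) (b := R)
    (r := (N : ℝ) - 1 - β) (by linarith))
  rw [intervalIntegrable_iff_integrableOn_Ioo_of_le hR.le] at h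
  refine h.congr_fun (fun s hs => ?_) measurableSet_Ioo
  simp only [smul_eq_mul]
  rw [← Real.rpow_natCast, ← Real.rpow_add hs.1, Nat.cast_sub (by exact_mod_cast hN)]
  ring_nf

theorem setIntegral_norm_rpow_ball (β : ℝ) {R : ℝ} (hR : 0 < R) :
    ∫ y in Metric.ball (0 : Euc N) R, ‖y‖ ^ (-β) =
      (∫ y in Metric.ball (0 : Euc N) 1, ‖y‖ ^ (-β)) * R ^ ((N : ℝ) - β) := by
  have h := Measure.setIntegral_comp_smul (volume : Measure (Euc N)) (fun y => ‖y‖ ^ (-β))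
    (Metric.ball 0 1) hR.ne'
  rw [smul_unitBall_of_pos hR, finrank_euclideanSpace, Fintype.card_fin, smul_eq_mul,
    abs_of_pos (by positivity)] at h
  have h2 : ∀ y : Euc N, ‖R • y‖ ^ (-β) = R ^ (-β) * ‖y‖ ^ (-β) := fun y => by
    rw [norm_smul, Real.norm_of_nonneg hR.le, Real.mul_rpow hR.le (norm_nonneg _)]
  simp only [h2, integral_const_mul] at h
  rw [inv_mul_eq_div, eq_div_iff (by positivity)] at h
  rw [← h, sub_eq_neg_add, Real.rpow_add hR, Real.rpow_natCast]
  ring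

/-- In polar coordinates the critical weight becomes `ds / s`, and `N |B₁|` is the area of the unit
sphere. This is the source of `log t` for `α = N`. -/
theorem integral_annulus_norm_rpow [NeZero N] {R R' : ℝ} (hR : 0 < R) (hRR : R ≤ R') :
    ∫ y : Euc N, (Ico R R').indicator (fun s : ℝ => s ^ (-(N : ℝ))) ‖y‖ =
      N * volume.real (Metric.ball (0 : Euc N) 1) * Real.log (R' / R) := by
  rw [integral_fun_norm_addHaar volume (fun s => (Ico R R').indicator (fun s : ℝ => s ^ (-(N : ℝ))) s),
    finrank_euclideanSpace, Fintype.card_fin, nsmul_eq_mul, smul_eq_mul, mul_assoc]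
  congr 2
  have h1 : ∀ s ∈ Ioi (0 : ℝ), s ^ (N - 1) • (Ico R R').indicator (fun s : ℝ => s ^ (-(N : ℝ))) s =
      (Ico R R').indicator (fun s : ℝ => s⁻¹) s := by
    intro s hs
    have hs : 0 < s := hs
    by_cases h : s ∈ Ico R R'
    · rw [indicator_of_mem h, indicator_of_mem h, smul_eq_mul, ← Real.rpow_natCast,
        ← Real.rpow_add hs, Nat.cast_sub (Nat.one_le_iff_ne_zero.2 (NeZero.ne N)),
        ← Real.rpow_neg_one]
      push_cast
      ring_nf
    · rw [indicator_of_notMem h, indicator_of_notMem h, smul_zero]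
  have hsub : Ico R R' ⊆ Ioi 0 := fun s hs => hR.trans_le hs.1
  rw [setIntegral_congr_fun measurableSet_Ioi h1, setIntegral_indicator measurableSet_Ico,
    inter_eq_right.2 hsub, integral_Ico_eq_integral_Ioc,
    ← intervalIntegral.integral_of_le hRR, integral_inv_of_pos hR (hR.trans_le hRR)]

/-- The constant in the bound of `∫_{|y| < R} |y|^{-β} dy`. -/
noncomputable def ballRpowConst (N : ℕ) (β : ℝ) : ℝ :=
  ∫ y in Metric.ball (0 : Euc N) 1, ‖y‖ ^ (-β)

theorem ballRpowConst_nonneg (N : ℕ) (β : ℝ) : 0 ≤ ballRpowConst N β :=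
  setIntegral_nonneg measurableSet_ball fun _ _ => by positivity

theorem integrable_indicator_norm_rpow [NeZero N] {β : ℝ} (hβ : β < N) (R : ℝ) :
    Integrable ((Metric.ball (0 : Euc N) R).indicator fun y => ‖y‖ ^ (-β)) :=
  (integrable_indicator_iff measurableSet_ball).2 (integrableOn_norm_rpow_ball hβ R)

theorem integral_indicator_norm_rpow (β : ℝ) {R : ℝ} (hR : 0 < R) :
    ∫ y, (Metric.ball (0 : Euc N) R).indicator (fun y => ‖y‖ ^ (-β)) y =
      ballRpowConst N β * R ^ ((N : ℝ) - β) := by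
  rw [integral_indicator measurableSet_ball, setIntegral_norm_rpow_ball β hR, ballRpowConst]

variable {κ f : Euc N → ℝ} {S I M β R : ℝ}

/-- Inside the ball the kernel is bounded by its supremum and the weight is integrable; outside, the
datum is bounded by its value scale at `R`, and the kernel contributes its mass. The radius is left
free for later optimisation. -/
theorem sub_mul_le_of_le_rpow (hβ0 : 0 ≤ β) (hκ0 : ∀ x, 0 ≤ κ x) (hκS : ∀ x, κ x ≤ S) (hM : 0 ≤ M)
    (hf0 : ∀ y, 0 ≤ f y) (hfM : ∀ y, f y ≤ M * ‖y‖ ^ (-β)) (hR : 0 < R) (x y : Euc N) :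
    κ (x - y) * f y ≤ S * M * (Metric.ball (0 : Euc N) R).indicator (fun y => ‖y‖ ^ (-β)) y +
      κ (x - y) * (M * R ^ (-β)) := by
  have hS : 0 ≤ S := (hκ0 0).trans (hκS 0)
  by_cases hy : y ∈ Metric.ball (0 : Euc N) R
  · rw [indicator_of_mem hy]
    have h1 : κ (x - y) * f y ≤ S * (M * ‖y‖ ^ (-β)) :=
      mul_le_mul (hκS _) (hfM y) (hf0 y) hS
    have h2 : 0 ≤ κ (x - y) * (M * R ^ (-β)) := mul_nonneg (hκ0 _) (by positivity)
    linarith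
  · rw [indicator_of_notMem hy, mul_zero, zero_add]
    refine mul_le_mul_of_nonneg_left ((hfM y).trans ?_) (hκ0 _)
    have : R ≤ ‖y‖ := by simpa using hy
    exact mul_le_mul_of_nonneg_left (Real.rpow_le_rpow_of_nonpos hR this (by linarith)) hM

theorem integrable_sub_mul_of_le_rpow [NeZero N] (hβ0 : 0 ≤ β) (hβ : β < N) (hκ0 : ∀ x, 0 ≤ κ x)
    (hκS : ∀ x, κ x ≤ S) (hκ : Integrable κ) (hf : Measurable f) (hM : 0 ≤ M)
    (hf0 : ∀ y, 0 ≤ f y) (hfM : ∀ y, f y ≤ M * ‖y‖ ^ (-β)) (x : Euc N) :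
    Integrable fun y => κ (x - y) * f y := by
  have hdom := ((integrable_indicator_norm_rpow (N := N) hβ 1).const_mul (S * M)).add
    ((hκ.comp_sub_left x).mul_const (M * 1 ^ (-β)))
  refine hdom.mono' ((hκ.comp_sub_left x).aestronglyMeasurable.mul hf.aestronglyMeasurable)
    (ae_of_all _ fun y => ?_)
  rw [Real.norm_of_nonneg (mul_nonneg (hκ0 _) (hf0 _))]
  exact sub_mul_le_of_le_rpow hβ0 hκ0 hκS hM hf0 hfM one_pos x y

/-- Convolution of a bounded integrable kernel with a function dominated by `M |y|^{-β}`. -/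
theorem integral_sub_mul_le_of_le_rpow [NeZero N] (hβ0 : 0 ≤ β) (hβ : β < N)
    (hκ0 : ∀ x, 0 ≤ κ x) (hκS : ∀ x, κ x ≤ S) (hκ : Integrable κ) (hI : ∫ x, κ x ≤ I)
    (hf : Measurable f) (hM : 0 ≤ M) (hf0 : ∀ y, 0 ≤ f y) (hfM : ∀ y, f y ≤ M * ‖y‖ ^ (-β))
    (hR : 0 < R) (x : Euc N) :
    ∫ y, κ (x - y) * f y ≤ M * (S * ballRpowConst N β * R ^ ((N : ℝ) - β) + I * R ^ (-β)) := by
  have h1 := (integrable_indicator_norm_rpow (N := N) hβ R).const_mul (S * M)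
  have h2 := (hκ.comp_sub_left x).mul_const (M * R ^ (-β))
  refine (integral_mono (integrable_sub_mul_of_le_rpow hβ0 hβ hκ0 hκS hκ hf hM hf0 hfM x)
    (h1.add h2) (sub_mul_le_of_le_rpow hβ0 hκ0 hκS hM hf0 hfM hR x)).trans ?_
  simp only [Pi.add_apply]
  rw [integral_add h1 h2, integral_const_mul, integral_indicator_norm_rpow β hR,
    integral_mul_const, integral_sub_left_eq κ x]
  have : (∫ x, κ x) * (M * R ^ (-β)) ≤ I * (M * R ^ (-β)) :=
    mul_le_mul_of_nonneg_right hI (by positivity)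
  linarith

theorem heatKernel_le {a t : ℝ} (ha : 0 < a) (ht : 0 < t) (x : Euc N) :
    heatKernel a x t ≤ (4 * Real.pi * a) ^ (-((N : ℝ) / 2)) * t ^ (-((N : ℝ) / 2)) := by
  have := Real.pi_pos
  rw [heatKernel_eq, Real.mul_rpow (by positivity) ht.le]
  refine mul_le_of_le_one_right (by positivity) (Real.exp_le_one_iff.2 ?_)
  rw [neg_mul]
  exact neg_nonpos.2 (by positivity)

variable {J : Euc N → ℝ}

theorem exists_nonlocalKernel_le [NeZero N] (hJ : IsDispersalKernel J) :
    ∃ D, 0 < D ∧ ∀ t : ℝ, 1 ≤ t → ∀ x, nonlocalKernel J t x ≤ D * t ^ (-((N : ℝ) / 2)) := by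
  obtain ⟨C, hC, h⟩ := exists_abs_nonlocalKernel_sub_heatKernel_le hJ
  have ha := diffusivity_pos hJ
  have := Real.pi_pos
  refine ⟨C + (4 * Real.pi * diffusivity J) ^ (-((N : ℝ) / 2)), by positivity, fun t ht x => ?_⟩
  have ht0 : 0 < t := by linarith
  have h1 := (abs_le.1 (h t ht x)).2
  have h2 := heatKernel_le ha ht0 x
  have h3 : t ^ (-((N : ℝ) / 2) - 1) ≤ t ^ (-((N : ℝ) / 2)) :=
    Real.rpow_le_rpow_of_exponent_le ht (by linarith)
  have h4 := mul_le_mul_of_nonneg_left h3 hC.le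
  linarith

theorem integral_nonlocalKernel_le_one (hJ : IsDispersalKernel J) {t : ℝ} (ht : 0 ≤ t) :
    ∫ x, nonlocalKernel J t x ≤ 1 := by
  rw [integral_nonlocalKernel hJ ht]
  linarith [Real.exp_pos (-t)]

theorem sqrt_rpow_mul_rpow {t : ℝ} (ht : 0 < t) (β : ℝ) :
    √t ^ ((N : ℝ) - β) * t ^ (-((N : ℝ) / 2)) = t ^ (-(β / 2)) := by
  rw [Real.sqrt_eq_rpow, ← Real.rpow_mul ht.le, ← Real.rpow_add ht]
  congr 1
  ring

/-- Decay of the linear nonlocal evolution of slowly decaying data. -/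
theorem exists_nonlocalEvol_le [NeZero N] (hJ : IsDispersalKernel J) (hβ0 : 0 < β) (hβ : β < N)
    (hf : Measurable f) (hM : 0 ≤ M) (hf0 : ∀ y, 0 ≤ f y) (hfM : ∀ y, f y ≤ M) {M' : ℝ}
    (hM' : 0 ≤ M') (hfM' : ∀ y, f y ≤ M' * ‖y‖ ^ (-β)) :
    ∃ C, 0 < C ∧ ∀ t : ℝ, 0 ≤ t → ∀ x, nonlocalEvol J f x t ≤ C * (1 + t) ^ (-(β / 2)) := by
  obtain ⟨D, hD, h⟩ := exists_nonlocalKernel_le hJ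
  obtain ⟨K, hK, hk⟩ := exists_rpow_mul_exp_neg_le (β / 2) one_pos
  have hb := ballRpowConst_nonneg N β
  set C₁ := K * M + M' * (D * ballRpowConst N β + 1)
  have hC₁ : 0 ≤ C₁ := by positivity
  -- The factor `2 ^ (β / 2)` converts decay in `t` into decay in `1 + t` for `t ≥ 1`, and
  -- compensates for `(1 + t) ^ (-β/2)` on `[0, 1]`.
  refine ⟨(M + C₁ + 1) * 2 ^ (β / 2), by positivity, fun t ht x => ?_⟩
  rcases le_total t 1 with ht1 | ht1
  · have h1 := (le_abs_self _).trans (abs_nonlocalEvol_le hJ hf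
      (fun y => (abs_of_nonneg (hf0 y)).trans_le (hfM y)) ht x)
    have h2 : (2 : ℝ) ^ (-(β / 2)) ≤ (1 + t) ^ (-(β / 2)) :=
      Real.rpow_le_rpow_of_nonpos (by positivity) (by linarith) (by linarith)
    calc _ ≤ M := h1
      _ ≤ (M + C₁ + 1) * 2 ^ (β / 2) * 2 ^ (-(β / 2)) := by
        rw [mul_assoc, ← Real.rpow_add two_pos, add_neg_cancel, Real.rpow_zero]
        linarith
      _ ≤ _ := mul_le_mul_of_nonneg_left h2 (by positivity)
  · have ht0 : 0 < t := by linarith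
    -- The radius `√t` balances the two parts, since the kernel is `O(t^{-N/2})`: both become
    -- `t^{-β/2}`.
    have h1 := integral_sub_mul_le_of_le_rpow hβ0.le hβ (nonlocalKernel_nonneg hJ ht)
      (h t ht1) (integrable_nonlocalKernel hJ ht) (integral_nonlocalKernel_le_one hJ ht) hf hM' hf0
      hfM' (Real.sqrt_pos.2 ht0) x
    have h2 : √t ^ (-β) = t ^ (-(β / 2)) := by
      rw [Real.sqrt_eq_rpow, ← Real.rpow_mul ht]
      congr 1
      ring
    have h3 : Real.exp (-t) * f x ≤ K * M * t ^ (-(β / 2)) := by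
      have : Real.exp (-t) ≤ K * t ^ (-(β / 2)) := by
        rw [Real.rpow_neg ht, ← div_eq_mul_inv, le_div_iff₀ (by positivity), mul_comm]
        simpa using hk t ht1
      calc Real.exp (-t) * f x ≤ K * t ^ (-(β / 2)) * M :=
            mul_le_mul this (hfM x) (hf0 x) (by positivity)
        _ = _ := by ring
    have h4 : nonlocalEvol J f x t ≤ C₁ * t ^ (-(β / 2)) := by
      rw [h2, mul_right_comm, mul_right_comm D, mul_assoc D, sqrt_rpow_mul_rpow ht0] at h1
      rw [nonlocalEvol]
      calc _ ≤ _ := add_le_add h3 h1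
        _ = _ := by ring
    have h5 : t ^ (-(β / 2)) ≤ 2 ^ (β / 2) * (1 + t) ^ (-(β / 2)) := by
      have : ((1 + t) / 2) ^ (-(β / 2)) = 2 ^ (β / 2) * (1 + t) ^ (-(β / 2)) := by
        rw [Real.div_rpow (by positivity) (by positivity), Real.rpow_neg two_pos.le, div_inv_eq_mul,
          mul_comm]
      rw [← this]
      exact Real.rpow_le_rpow_of_nonpos (by positivity) (by linarith) (by linarith)
    calc _ ≤ _ := h4
      _ ≤ (M + C₁ + 1) * (2 ^ (β / 2) * (1 + t) ^ (-(β / 2))) :=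
        mul_le_mul (by linarith) h5 (by positivity) (by positivity)
      _ = _ := by ring

/-- Decay of the linear nonlocal evolution of compactly supported data. -/
theorem exists_nonlocalEvol_indicator_ball_le [NeZero N] (hJ : IsDispersalKernel J)
    (hM : 0 ≤ M) (hf0 : ∀ y, 0 ≤ f y) (hfM : ∀ y, f y ≤ M) (R : ℝ) :
    ∃ C, 0 < C ∧ ∀ t : ℝ, 1 ≤ t → ∀ x,
      nonlocalEvol J ((Metric.ball 0 R).indicator f) x t ≤ C * t ^ (-((N : ℝ) / 2)) := by
  obtain ⟨D, hD, h⟩ := exists_nonlocalKernel_le hJ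
  obtain ⟨K, hK, hk⟩ := exists_rpow_mul_exp_neg_le ((N : ℝ) / 2) one_pos
  set V := volume.real (Metric.ball (0 : Euc N) R)
  have hV : 0 ≤ V := measureReal_nonneg
  refine ⟨K * M + D * M * V + 1, by positivity, fun t ht x => ?_⟩
  have ht0 : 0 < t := by linarith
  have h3 : Real.exp (-t) * (Metric.ball 0 R).indicator f x ≤ K * M * t ^ (-((N : ℝ) / 2)) := by
    have h1 : Real.exp (-t) ≤ K * t ^ (-((N : ℝ) / 2)) := by
      rw [Real.rpow_neg ht0.le, ← div_eq_mul_inv, le_div_iff₀ (by positivity), mul_comm]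
      simpa using hk t ht
    have h2 : (Metric.ball 0 R).indicator f x ≤ M :=
      indicator_le_self' (fun _ _ => hf0 _) x |>.trans (hfM x)
    calc _ ≤ K * t ^ (-((N : ℝ) / 2)) * M :=
          mul_le_mul h1 h2 (indicator_nonneg (fun y _ => hf0 y) x) (by positivity)
      _ = _ := by ring
  have hdom : Integrable ((Metric.ball (0 : Euc N) R).indicator fun _ =>
      D * t ^ (-((N : ℝ) / 2)) * M) :=
    (integrable_indicator_iff measurableSet_ball).2
      (integrableOn_const measure_ball_lt_top.ne)
  have h4 : ∫ y, nonlocalKernel J t (x - y) * (Metric.ball 0 R).indicator f y ≤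
      D * M * V * t ^ (-((N : ℝ) / 2)) := by
    calc _ ≤ ∫ y, (Metric.ball (0 : Euc N) R).indicator (fun _ => D * t ^ (-((N : ℝ) / 2)) * M) y := by
          refine integral_mono_of_nonneg (ae_of_all _ fun y =>
            mul_nonneg (nonlocalKernel_nonneg hJ ht0.le _) (indicator_nonneg (fun y _ => hf0 y) y))
            hdom (ae_of_all _ fun y => ?_)
          by_cases hy : y ∈ Metric.ball (0 : Euc N) R
          · simp only [indicator_of_mem hy]
            exact mul_le_mul (h t ht _) (hfM y) (hf0 y) (by positivity)
          · simp only [indicator_of_notMem hy, mul_zero, le_refl]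
      _ = _ := by
          rw [integral_indicator measurableSet_ball, setIntegral_const, smul_eq_mul]
          ring
  rw [nonlocalEvol]
  have : 0 ≤ t ^ (-((N : ℝ) / 2)) := by positivity
  linarith

end PowerWeights

/-! ### Smallness of the absorption effect -/

section Absorption

variable {N : ℕ} {J f : Euc N → ℝ} {M β p : ℝ} {u : Euc N → ℝ → ℝ}

/-- The nonlocal diffusion term of a bounded function. -/
theorem integral_mul_sub_const (hJ : IsDispersalKernel J) {g : Euc N → ℝ}
    (hg : AEStronglyMeasurable g) (hM : ∀ᵐ y, |g y| ≤ M) (x : Euc N) (c : ℝ) :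
    ∫ y, J (x - y) * (g y - c) = (∫ y, J (x - y) * g y) - c := by
  simp only [mul_sub]
  rw [integral_sub (integrable_sub_mul hJ.integrable hg hM x)
    ((hJ.integrable.comp_sub_left x).mul_const c), integral_mul_const, integral_sub_left_eq,
    hJ.integral_eq_one, one_mul]

theorem IsNonlocalAbsorptionSolution.ae_bound (hu : IsNonlocalAbsorptionSolution J p f u) {t : ℝ}
    (ht : 0 ≤ t) : ∃ M, ∀ᵐ y, |u y t| ≤ M := by
  obtain ⟨M, hM⟩ := hu.bounded (t + 1) (by linarith)
  exact ⟨M, hM.mono fun y hy => hy t ⟨ht, by linarith⟩⟩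

theorem IsNonlocalAbsorptionSolution.hasDerivAt (hJ : IsDispersalKernel J)
    (hu : IsNonlocalAbsorptionSolution J p f u) : ∀ᵐ x, ∀ t > 0,
      HasDerivAt (u x) ((∫ y, J (x - y) * u y t) - u x t - |u x t| ^ (p - 1) * u x t) t := by
  filter_upwards [hu.equation] with x hx t ht
  obtain ⟨M, hM⟩ := hu.ae_bound ht.le
  rw [← integral_mul_sub_const hJ (hu.measurable t ht.le) hM]
  exact hx t ht

theorem IsNonlocalAbsorptionSolution.nonneg (hJ : IsDispersalKernel J)
    (hu : IsNonlocalAbsorptionSolution J p f u) (hf : ∀ᵐ x, 0 ≤ f x) :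
    ∀ᵐ x, ∀ t, 0 ≤ t → 0 ≤ u x t := by
  refine nonneg_of_supersolution hJ hu.measurable hu.bounded ?_ hu.continuous_zero ?_
  · filter_upwards [hu.initial, hf] with x hx hfx
    rwa [hx]
  · filter_upwards [hu.hasDerivAt hJ] with x hx t ht
    refine ⟨_, hx t ht, fun hneg => ?_⟩
    have : 0 ≤ |u x t| ^ (p - 1) := by positivity
    nlinarith

/-- Comparison of the absorption problem with a supersolution of the problem solved by
`nonlocalEvol J f x t - u x t`. -/
theorem IsNonlocalAbsorptionSolution.nonlocalEvol_sub_le (hJ : IsDispersalKernel J)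
    (hu : IsNonlocalAbsorptionSolution J p f u) (hf : Measurable f) (hM : ∀ x, |f x| ≤ M)
    {z : Euc N → ℝ → ℝ} (hzm : ∀ t, 0 ≤ t → Measurable fun x => z x t)
    (hzb : ∃ K, ∀ x t, 0 ≤ t → |z x t| ≤ K) (hz0 : ∀ x, 0 ≤ z x 0)
    (hzc : ∀ x, ContinuousWithinAt (z x) (Ici 0) 0)
    (hzd : ∀ᵐ x, ∀ t > 0, ∃ s, |u x t| ^ (p - 1) * u x t ≤ s ∧
      HasDerivAt (z x) ((∫ y, J (x - y) * z y t) - z x t + s) t) :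
    ∀ᵐ x, ∀ t, 0 ≤ t → nonlocalEvol J f x t - u x t ≤ z x t := by
  obtain ⟨K, hK⟩ := hzb
  have hv := fun (x : Euc N) {t : ℝ} (ht : 0 ≤ t) => abs_nonlocalEvol_le hJ hf hM ht x
  have key := nonneg_of_supersolution hJ (w := fun x t => z x t - (nonlocalEvol J f x t - u x t))
    (fun t ht => (hzm t ht).aestronglyMeasurable.sub
      ((measurable_nonlocalEvol hJ hf t).aestronglyMeasurable.sub (hu.measurable t ht)))
    (fun T hT => ?_) ?_ ?_ ?_
  · filter_upwards [key] with x hx t ht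
    linarith [hx t ht]
  · obtain ⟨L, hL⟩ := hu.bounded T hT
    refine ⟨K + (M + L), ?_⟩
    filter_upwards [hL] with x hx t ht
    exact (abs_sub _ _).trans (add_le_add (hK x t ht.1)
      ((abs_sub _ _).trans (add_le_add (hv x ht.1) (hx t ht))))
  · filter_upwards [hu.initial] with x hx
    simpa [hx, nonlocalEvol_zero] using hz0 x
  · filter_upwards [hu.continuous_zero] with x hx
    exact (hzc x).sub ((continuousWithinAt_nonlocalEvol hJ hf hM x).sub hx)
  -- For `w = z - (v - u)`, with `v` the linear evolution, one has `w_t = J * w - w + (s -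
  -- |u|^{p-1}u)`. The last bracket is nonnegative, and so is `-w` wherever `w < 0`.
  · filter_upwards [hu.hasDerivAt hJ, hzd] with x hx hzx t ht
    obtain ⟨s, hs, hzs⟩ := hzx t ht
    obtain ⟨L, hL⟩ := hu.ae_bound ht.le
    refine ⟨_, hzs.sub ((hasDerivAt_nonlocalEvol hJ hf hM x ht).sub (hx t ht)), fun hneg => ?_⟩
    have i1 := integrable_sub_mul hJ.integrable (hzm t ht.le).aestronglyMeasurable
      (ae_of_all _ fun y => hK y t ht.le) x
    have i2 := integrable_sub_mul hJ.integrable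
      (measurable_nonlocalEvol hJ hf t).aestronglyMeasurable (ae_of_all _ fun y => hv y ht.le) x
    have i3 := integrable_sub_mul hJ.integrable (hu.measurable t ht.le) hL x
    have i4 : Integrable fun y => J (x - y) * nonlocalEvol J f y t - J (x - y) * u y t := i2.sub i3
    simp only [mul_sub]
    rw [integral_sub i1 i4, integral_sub i2 i3]
    linarith

/-- Once `u ≥ 0`, the absorption has a sign and the difference of the two evolutions is a
supersolution. -/
theorem IsNonlocalAbsorptionSolution.le_nonlocalEvol (hJ : IsDispersalKernel J)
    (hu : IsNonlocalAbsorptionSolution J p f u) (hf : Measurable f) (hf0 : ∀ x, 0 ≤ f x)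
    (hfM : ∀ x, f x ≤ M) : ∀ᵐ x, ∀ t, 0 ≤ t → u x t ≤ nonlocalEvol J f x t := by
  have hM : ∀ x, |f x| ≤ M := fun x => (abs_of_nonneg (hf0 x)).trans_le (hfM x)
  have hv := fun (x : Euc N) {t : ℝ} (ht : 0 ≤ t) => abs_nonlocalEvol_le hJ hf hM ht x
  have key := nonneg_of_supersolution hJ (w := fun x t => nonlocalEvol J f x t - u x t)
    (fun t ht => (measurable_nonlocalEvol hJ hf t).aestronglyMeasurable.sub (hu.measurable t ht))
    (fun T hT => ?_) ?_ ?_ ?_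
  · filter_upwards [key] with x hx t ht
    linarith [hx t ht]
  · obtain ⟨L, hL⟩ := hu.bounded T hT
    refine ⟨M + L, ?_⟩
    filter_upwards [hL] with x hx t ht
    exact (abs_sub _ _).trans (add_le_add (hv x ht.1) (hx t ht))
  · filter_upwards [hu.initial] with x hx
    simp [hx, nonlocalEvol_zero]
  · filter_upwards [hu.continuous_zero] with x hx
    exact (continuousWithinAt_nonlocalEvol hJ hf hM x).sub hx
  · filter_upwards [hu.hasDerivAt hJ, hu.nonneg hJ (ae_of_all _ hf0)] with x hx hx0 t ht
    obtain ⟨L, hL⟩ := hu.ae_bound ht.le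
    refine ⟨_, (hasDerivAt_nonlocalEvol hJ hf hM x ht).sub (hx t ht), fun hneg => ?_⟩
    have i2 := integrable_sub_mul hJ.integrable
      (measurable_nonlocalEvol hJ hf t).aestronglyMeasurable (ae_of_all _ fun y => hv y ht.le) x
    have i3 := integrable_sub_mul hJ.integrable (hu.measurable t ht.le) hL x
    simp only [mul_sub]
    rw [integral_sub i2 i3]
    have : 0 ≤ |u x t| ^ (p - 1) * u x t := mul_nonneg (by positivity) (hx0 t ht.le)
    linarith

theorem add_rpow_le_two_rpow_mul {a b p : ℝ} (ha : 0 ≤ a) (hb : 0 ≤ b) (hp : 0 ≤ p) :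
    (a + b) ^ p ≤ 2 ^ p * (a ^ p + b ^ p) := by
  wlog h : a ≤ b generalizing a b
  · rw [add_comm a b, add_comm (a ^ p)]
    exact this hb ha (le_of_not_ge h)
  calc (a + b) ^ p ≤ (2 * b) ^ p := Real.rpow_le_rpow (by positivity) (by linarith) hp
    _ = 2 ^ p * b ^ p := Real.mul_rpow two_pos.le hb
    _ ≤ _ := mul_le_mul_of_nonneg_left (le_add_of_nonneg_left (by positivity)) (by positivity)

/-- This primitive of `(1 + t) ^ (-q)` vanishes at `0` and is bounded by `1 / (q - 1)`; it is the
time factor of the barrier. -/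
theorem hasDerivAt_one_sub_rpow_div {q t : ℝ} (hq : 1 < q) (ht : 0 ≤ t) :
    HasDerivAt (fun s : ℝ => (1 - (1 + s) ^ (1 - q)) / (q - 1)) ((1 + t) ^ (-q)) t := by
  have h := ((((hasDerivAt_id t).const_add 1).rpow_const (p := 1 - q)
    (Or.inl (by simp only [id_eq]; positivity))).const_sub 1).div_const (q - 1)
  refine h.congr_deriv ?_
  have : q - 1 ≠ 0 := by linarith
  simp only [id_eq]
  rw [show 1 - q - 1 = -q by ring]
  field_simp
  ring

/-- The effect of a supercritical absorption: up to a small fraction of the linear evolution, it is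
controlled by the linear evolution of the datum cut off far away. -/
theorem IsNonlocalAbsorptionSolution.exists_nonlocalEvol_sub_le [NeZero N]
    (hJ : IsDispersalKernel J) (hu : IsNonlocalAbsorptionSolution J p f u) (hp : 1 < p)
    (hβ0 : 0 < β) (hβ : β < N) (hβp : 2 < β * (p - 1)) (hf : Measurable f) (hM : 0 ≤ M)
    (hf0 : ∀ y, 0 ≤ f y) (hfM : ∀ y, f y ≤ M) {M' : ℝ} (hM' : 0 ≤ M')
    (hfM' : ∀ y, f y ≤ M' * ‖y‖ ^ (-β)) {ε : ℝ} (hε : 0 < ε) :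
    ∃ R C, 0 < C ∧ ∀ᵐ x, ∀ t, 0 ≤ t → nonlocalEvol J f x t - u x t ≤
      ε * nonlocalEvol J f x t + C * nonlocalEvol J ((Metric.ball 0 R).indicator f) x t := by
  obtain ⟨C, hC, hdec⟩ := exists_nonlocalEvol_le hJ hβ0 hβ hf hM hf0 hfM hM' hfM'
  set q₀ := β * (p - 1) / 2 with hq₀
  have hq₀1 : 1 < q₀ := by rw [hq₀]; linarith
  -- The decay exponent of `v^{p-1}` is `q₀ > 1`. The midpoint `q ∈ (1, q₀)` is still integrable and
  -- uses only the power `m = 2q/β < p - 1`. The remaining power `κ` is available to produce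
  -- smallness.
  set q := (1 + q₀) / 2 with hq
  have hq1 : 1 < q := by rw [hq]; linarith
  set m := 2 * q / β with hm
  have hmβ : β / 2 * m = q := by rw [hm]; field_simp
  have hm0 : 0 < m := by positivity
  have hmp : m < p - 1 := by
    rw [hm, div_lt_iff₀ hβ0]
    linarith
  set κ := p - 1 - m with hκ
  have hκ0 : 0 < κ := by rw [hκ]; linarith
  have hCm : 0 < C ^ m := by positivity
  obtain ⟨δ, hδ0, hδ⟩ : ∃ δ, 0 < δ ∧ 2 ^ p * (δ ^ κ * C ^ m) / (q - 1) ≤ ε := by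
    have hlim : Tendsto (fun δ : ℝ => 2 ^ p * (δ ^ κ * C ^ m) / (q - 1)) (𝓝[>] 0) (𝓝 0) := by
      have h1 : Tendsto (fun δ : ℝ => δ ^ κ) (𝓝[>] 0) (𝓝 0) := by
        have := (Real.continuousAt_rpow_const 0 κ (Or.inr hκ0.le)).tendsto
        rw [Real.zero_rpow hκ0.ne'] at this
        exact this.mono_left nhdsWithin_le_nhds
      simpa using (((h1.mul_const (C ^ m)).const_mul (2 ^ p)).div_const (q - 1))
    obtain ⟨δ, h1, h2⟩ := ((hlim.eventually_le_const hε).and self_mem_nhdsWithin).exists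
    exact ⟨δ, h2, h1⟩
  -- The cut-off radius makes the far part `a₀` at most `δ`, a bound inherited by its evolution `a`.
  obtain ⟨R, hR⟩ : ∃ R : ℝ, ∀ y : Euc N, R ≤ ‖y‖ → f y ≤ δ := by
    have hlim : Tendsto (fun r : ℝ => M' * r ^ (-β)) atTop (𝓝 0) := by
      simpa using (tendsto_rpow_neg_atTop hβ0).const_mul M'
    obtain ⟨R, h⟩ := eventually_atTop.1 (hlim.eventually_le_const hδ0)
    exact ⟨R, fun y hy => (hfM' y).trans (h _ hy)⟩
  set b₀ := (Metric.ball (0 : Euc N) R).indicator f with hb₀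
  set a₀ := (Metric.ball (0 : Euc N) R)ᶜ.indicator f with ha₀
  have hsum : (fun y => a₀ y + b₀ y) = f := by
    funext y
    rw [ha₀, hb₀, add_comm]
    exact congrFun (indicator_self_add_compl _ f) y
  have ha₀m : Measurable a₀ := hf.indicator measurableSet_ball.compl
  have hb₀m : Measurable b₀ := hf.indicator measurableSet_ball
  have ha₀0 : ∀ y, 0 ≤ a₀ y := indicator_nonneg fun y _ => hf0 y
  have hb₀0 : ∀ y, 0 ≤ b₀ y := indicator_nonneg fun y _ => hf0 y
  have ha₀δ : ∀ y, |a₀ y| ≤ δ := fun y => by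
    rw [abs_of_nonneg (ha₀0 y)]
    by_cases hy : y ∈ Metric.ball (0 : Euc N) R
    · simpa [ha₀, hy] using hδ0.le
    · have : R ≤ ‖y‖ := by simpa using hy
      simpa [ha₀, hy] using hR y this
  have hb₀M : ∀ y, |b₀ y| ≤ M := fun y => by
    rw [abs_of_nonneg (hb₀0 y)]
    exact (indicator_le_self' (fun _ _ => hf0 _) y).trans (hfM y)
  have hvab : ∀ x t, 0 ≤ t →
      nonlocalEvol J f x t = nonlocalEvol J a₀ x t + nonlocalEvol J b₀ x t := fun x t ht => by
    rw [← nonlocalEvol_add hJ ha₀m ha₀δ hb₀m hb₀M ht, hsum]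
  set a := nonlocalEvol J a₀
  set b := nonlocalEvol J b₀
  have ha0 : ∀ x t, 0 ≤ t → 0 ≤ a x t := fun x t ht => nonlocalEvol_nonneg hJ ha₀0 ht x
  have hb0 : ∀ x t, 0 ≤ t → 0 ≤ b x t := fun x t ht => nonlocalEvol_nonneg hJ hb₀0 ht x
  have hab : ∀ x t, 0 ≤ t → |a x t| ≤ δ := fun x t ht => abs_nonlocalEvol_le hJ ha₀m ha₀δ ht x
  have hbb : ∀ x t, 0 ≤ t → |b x t| ≤ M := fun x t ht => abs_nonlocalEvol_le hJ hb₀m hb₀M ht x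
  set c₁ := 2 ^ p * (δ ^ κ * C ^ m)
  set c₂ := 2 ^ p * ((C + 1) ^ (p - 1) )
  have hc₁ : 0 < c₁ := by positivity
  have hc₂ : 0 < c₂ := by positivity
  set θ : ℝ → ℝ := fun t => (1 - (1 + t) ^ (1 - q)) / (q - 1) with hθ
  have hθ' : ∀ t, 0 ≤ t → HasDerivAt θ ((1 + t) ^ (-q)) t :=
    fun t ht => hasDerivAt_one_sub_rpow_div hq1 ht
  have hθ0 : ∀ t, 0 ≤ t → 0 ≤ θ t := fun t ht => by
    have : (1 + t) ^ (1 - q) ≤ 1 :=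
      Real.rpow_le_one_of_one_le_of_nonpos (by linarith) (by linarith)
    exact div_nonneg (by linarith) (by linarith)
  have hθ1 : ∀ t, 0 ≤ t → θ t ≤ 1 / (q - 1) := fun t ht => by
    have : 0 ≤ (1 + t) ^ (1 - q) := by positivity
    exact div_le_div_of_nonneg_right (by linarith) (by linarith)
  have hpow : ∀ {s r t : ℝ}, 0 ≤ s → 0 ≤ r → 0 ≤ t → s ≤ C * (1 + t) ^ (-(β / 2)) →
      s ^ r ≤ C ^ r * (1 + t) ^ (-(β / 2 * r)) := fun {s r t} hs hr ht h => by
    refine (Real.rpow_le_rpow hs h hr).trans_eq ?_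
    rw [Real.mul_rpow hC.le (by positivity), ← Real.rpow_mul (by positivity), neg_mul]
  have hsource : ∀ x t, 0 ≤ t →
      nonlocalEvol J f x t ^ p ≤ (1 + t) ^ (-q) * (c₁ * a x t + c₂ * b x t) := by
    intro x t ht
    have hd := hdec t ht x
    rw [hvab x t ht] at hd ⊢
    have ha := ha0 x t ht
    have hb := hb0 x t ht
    -- Factor `a^p = a^κ a^m a`: smallness of `a` bounds the first factor, and decay in time bounds
    -- the second. For `b` there is no smallness, so all of `p - 1` goes into decay.
    have e1 : a x t ^ p ≤ δ ^ κ * (C ^ m * (1 + t) ^ (-q)) * a x t := by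
      have : p = κ + m + 1 := by rw [hκ]; ring
      rw [this, Real.rpow_add_one' ha (by positivity), Real.rpow_add_of_nonneg ha hκ0.le hm0.le]
      refine mul_le_mul_of_nonneg_right (mul_le_mul ?_ ?_ (by positivity) (by positivity)) ha
      · exact Real.rpow_le_rpow ha ((le_abs_self _).trans (hab x t ht)) hκ0.le
      · have := hpow ha hm0.le ht (by linarith)
        rwa [hmβ] at this
    have e2 : b x t ^ p ≤ (C + 1) ^ (p - 1) * (1 + t) ^ (-q) * b x t := by
      have : p = (p - 1) + 1 := by ring
      nth_rw 1 [this]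
      rw [Real.rpow_add_one' hb (by linarith)]
      refine mul_le_mul_of_nonneg_right ((hpow hb (by linarith) ht (by linarith)).trans ?_) hb
      refine mul_le_mul (Real.rpow_le_rpow hC.le (by linarith) (by linarith)) ?_ (by positivity)
        (by positivity)
      refine Real.rpow_le_rpow_of_exponent_le (by linarith) (neg_le_neg ?_)
      rw [hq]
      linarith
    calc _ ≤ _ := add_rpow_le_two_rpow_mul ha hb (by linarith)
      _ ≤ 2 ^ p * (δ ^ κ * (C ^ m * (1 + t) ^ (-q)) * a x t +
          (C + 1) ^ (p - 1) * (1 + t) ^ (-q) * b x t) :=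
        mul_le_mul_of_nonneg_left (add_le_add e1 e2) (by positivity)
      _ = _ := by ring
  have hfabs : ∀ x, |f x| ≤ M := fun x => (abs_of_nonneg (hf0 x)).trans_le (hfM x)
  have hle := hu.le_nonlocalEvol hJ hf hf0 hfM
  have hnn := hu.nonneg hJ (ae_of_all _ hf0)
  have hda := fun x {t} (ht : 0 < t) => hasDerivAt_nonlocalEvol hJ ha₀m ha₀δ x ht
  have hdb := fun x {t} (ht : 0 < t) => hasDerivAt_nonlocalEvol hJ hb₀m hb₀M x ht
  -- Both `a` and `b` solve the linear equation, so multiplying by `θ` creates exactly the source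
  -- `θ' (c₁ a + c₂ b)`. It dominates `v^p ≥ u^p` by `hsource`.
  have key := hu.nonlocalEvol_sub_le hJ hf hfabs
    (z := fun x t => θ t * (c₁ * a x t + c₂ * b x t)) ?_ ?_ ?_ ?_ ?_
  · refine ⟨R, c₂ / (q - 1), div_pos hc₂ (by linarith), ?_⟩
    filter_upwards [key] with x hx t ht
    have ha := ha0 x t ht
    have hb := hb0 x t ht
    refine (hx t ht).trans ?_
    calc _ ≤ 1 / (q - 1) * (c₁ * a x t + c₂ * b x t) :=
          mul_le_mul_of_nonneg_right (hθ1 t ht) (by positivity)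
      _ = c₁ / (q - 1) * a x t + c₂ / (q - 1) * b x t := by ring
      _ ≤ ε * nonlocalEvol J f x t + c₂ / (q - 1) * b x t := by
          refine add_le_add_left (mul_le_mul hδ ?_ ha hε.le) _
          rw [hvab x t ht]
          linarith
  · intro t ht
    exact (((measurable_nonlocalEvol hJ ha₀m t).const_mul c₁).add
      ((measurable_nonlocalEvol hJ hb₀m t).const_mul c₂)).const_mul (θ t)
  · refine ⟨1 / (q - 1) * (c₁ * δ + c₂ * M), fun x t ht => ?_⟩
    have ha := ha0 x t ht
    have hb := hb0 x t ht
    have h1 := (le_abs_self _).trans (hab x t ht)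
    have h2 := (le_abs_self _).trans (hbb x t ht)
    have h3 := hθ0 t ht
    rw [abs_of_nonneg (by positivity)]
    exact mul_le_mul (hθ1 t ht) (by gcongr) (by positivity) ((hθ0 t ht).trans (hθ1 t ht))
  · intro x
    simp [hθ]
  · intro x
    exact (hθ' 0 le_rfl).continuousAt.continuousWithinAt.mul
      (((continuousWithinAt_nonlocalEvol hJ ha₀m ha₀δ x).const_mul c₁).add
        ((continuousWithinAt_nonlocalEvol hJ hb₀m hb₀M x).const_mul c₂))
  · filter_upwards [hle, hnn] with x hxle hx0 t ht
    refine ⟨(1 + t) ^ (-q) * (c₁ * a x t + c₂ * b x t), ?_, ?_⟩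
    · refine le_trans ?_ (hsource x t ht.le)
      have h0 := hx0 t ht.le
      rw [abs_of_nonneg h0, ← Real.rpow_add_one' h0 (by linarith), sub_add_cancel]
      exact Real.rpow_le_rpow h0 (hxle t ht.le) (by linarith)
    · refine ((hθ' t ht.le).mul (((hda x ht).const_mul c₁).add
        ((hdb x ht).const_mul c₂))).congr_deriv ?_
      have i1 := (integrable_sub_mul hJ.integrable
        (measurable_nonlocalEvol hJ ha₀m t).aestronglyMeasurable
        (ae_of_all _ fun y => hab y t ht.le) x).const_mul (θ t * c₁)
      have i2 := (integrable_sub_mul hJ.integrable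
        (measurable_nonlocalEvol hJ hb₀m t).aestronglyMeasurable
        (ae_of_all _ fun y => hbb y t ht.le) x).const_mul (θ t * c₂)
      have h1 : ∀ y, J (x - y) * (θ t * (c₁ * a y t + c₂ * b y t)) =
          θ t * c₁ * (J (x - y) * a y t) + θ t * c₂ * (J (x - y) * b y t) := fun y => by ring
      simp only [h1]
      rw [integral_add i1 i2, integral_const_mul, integral_const_mul]
      simp only [Pi.add_apply, a, b]
      ring

end Absorption

/-! ### Green's identity, differentiation under the integral, Gaussian weights -/

section HeatTools

open Laplacian RealInnerProductSpace

variable {N : ℕ}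

theorem laplacian_eq_sum_fderiv (V : Euc N → ℝ) (x : Euc N) :
    (Δ V) x = ∑ i : Fin N, fderiv ℝ (fderiv ℝ V) x (EuclideanSpace.basisFun (Fin N) ℝ i)
      (EuclideanSpace.basisFun (Fin N) ℝ i) := by
  rw [InnerProductSpace.laplacian_eq_iteratedFDeriv_orthonormalBasis V
    (EuclideanSpace.basisFun (Fin N) ℝ)]
  simp only [iteratedFDeriv_two_apply]
  rfl

/-- **Green's identity** against a compactly supported function. -/
theorem integral_laplacian_mul {V φ : Euc N → ℝ} (hV : ContDiff ℝ 2 V) (hφ : ContDiff ℝ 2 φ)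
    (hs : HasCompactSupport φ) : ∫ y, (Δ V) y * φ y = ∫ y, V y * (Δ φ) y := by
  set e := EuclideanSpace.basisFun (Fin N) ℝ
  have hV1 : ContDiff ℝ 1 (fderiv ℝ V) := hV.fderiv_right (by norm_num)
  have hφ1 : ContDiff ℝ 1 (fderiv ℝ φ) := hφ.fderiv_right (by norm_num)
  have hV2 : Continuous (fderiv ℝ (fderiv ℝ V)) := hV1.continuous_fderiv (by norm_num)
  have hφ2 : Continuous (fderiv ℝ (fderiv ℝ φ)) := hφ1.continuous_fderiv (by norm_num)
  have hVd : Differentiable ℝ V := hV.differentiable (by norm_num)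
  have hφd : Differentiable ℝ φ := hφ.differentiable (by norm_num)
  have hV1d : Differentiable ℝ (fderiv ℝ V) := hV1.differentiable (by norm_num)
  have hφ1d : Differentiable ℝ (fderiv ℝ φ) := hφ1.differentiable (by norm_num)
  have hVc := hV.continuous
  have hφc := hφ.continuous
  have hV1c := hV1.continuous
  have hφ1c := hφ1.continuous
  have hs1 : HasCompactSupport (fderiv ℝ φ) := hs.fderiv ℝ
  have hs1v : ∀ v, HasCompactSupport fun y => fderiv ℝ φ y v := fun v => hs.fderiv_apply ℝ v
  have hs2v : ∀ v, HasCompactSupport fun y => fderiv ℝ (fderiv ℝ φ) y v v := fun v =>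
    (hs1.fderiv_apply ℝ v).comp_left (g := fun l : Euc N →L[ℝ] ℝ => l v) (by simp)
  have hint : ∀ {g h : Euc N → ℝ}, Continuous g → Continuous h → HasCompactSupport h →
      Integrable fun y => g y * h y := fun hg hh hc =>
    (hg.mul hh).integrable_of_hasCompactSupport hc.mul_left
  have happ : ∀ {g : Euc N → ℝ} (v : Euc N), Differentiable ℝ (fderiv ℝ g) → ∀ y,
      fderiv ℝ (fun x => fderiv ℝ g x v) y v = fderiv ℝ (fderiv ℝ g) y v v := fun v hg y => by
    rw [fderiv_clm_apply (hg y) (differentiableAt_const v)]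
    simp
  have key : ∀ v : Euc N, ∫ y, fderiv ℝ (fderiv ℝ V) y v v * φ y =
      ∫ y, V y * fderiv ℝ (fderiv ℝ φ) y v v := by
    intro v
    have i1 : Integrable fun y => fderiv ℝ (fderiv ℝ V) y v v * φ y :=
      hint (by fun_prop) hφc hs
    have i2 : Integrable fun y => fderiv ℝ V y v * fderiv ℝ φ y v :=
      hint (by fun_prop) (by fun_prop) (hs1v v)
    have i3 : Integrable fun y => V y * fderiv ℝ (fderiv ℝ φ) y v v :=
      hint hVc (by fun_prop) (hs2v v)
    have s1 := integral_mul_fderiv_eq_neg_fderiv_mul_of_integrable (μ := volume)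
      (f := fun y => fderiv ℝ V y v) (g := φ) (v := v) (by simpa only [happ v hV1d] using i1) i2
      (hint (by fun_prop) hφc hs) (fun y _ => (hV1d y).clm_apply (differentiableAt_const v))
      (fun y _ => hφd y)
    have s2 := integral_mul_fderiv_eq_neg_fderiv_mul_of_integrable (μ := volume)
      (f := V) (g := fun y => fderiv ℝ φ y v) (v := v) i2
      (by simpa only [happ v hφ1d] using i3)
      (hint hVc (by fun_prop) (hs1v v)) (fun y _ => hVd y)
      (fun y _ => (hφ1d y).clm_apply (differentiableAt_const v))
    simp only [happ v hV1d] at s1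
    simp only [happ v hφ1d] at s2
    rw [s2, s1, neg_neg]
  simp only [laplacian_eq_sum_fderiv, Finset.sum_mul, Finset.mul_sum]
  rw [integral_finsetSum _ fun i _ => hint (by fun_prop) hφc hs,
    integral_finsetSum _ fun i _ => hint hVc (by fun_prop) (hs2v _)]
  exact Finset.sum_congr rfl fun i _ => key _

/-- The Laplacian of a function of the squared distance to a point. -/
theorem laplacian_comp_norm_sub_sq {H H₁ H₂ : ℝ → ℝ} (h₁ : ∀ s, HasDerivAt H (H₁ s) s)
    (h₂ : ∀ s, HasDerivAt H₁ (H₂ s) s) (x₀ y : Euc N) :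
    (Δ fun z : Euc N => H (‖z - x₀‖ ^ 2)) y =
      4 * ‖y - x₀‖ ^ 2 * H₂ (‖y - x₀‖ ^ 2) + 2 * N * H₁ (‖y - x₀‖ ^ 2) := by
  have hq : ∀ z : Euc N, HasFDerivAt (fun z : Euc N => ‖z - x₀‖ ^ 2)
      ((2 : ℝ) • innerSL ℝ (z - x₀)) z := fun z =>
    ((hasFDerivAt_id z).sub_const x₀).norm_sq.congr_fderiv (by ext v; simp [two_smul])
  have hf : fderiv ℝ (fun z : Euc N => H (‖z - x₀‖ ^ 2)) = fun z =>
      H₁ (‖z - x₀‖ ^ 2) • ((2 : ℝ) • innerSL ℝ (z - x₀)) :=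
    funext fun z => ((h₁ _).comp_hasFDerivAt z (hq z)).fderiv
  have hi : HasFDerivAt (fun z : Euc N => (2 : ℝ) • innerSL ℝ (z - x₀))
      ((2 : ℝ) • innerSL ℝ) y :=
    ((((innerSL ℝ).hasFDerivAt (x := y - x₀)).comp y
      ((hasFDerivAt_id y).sub_const x₀)).const_smul (2 : ℝ)).congr_fderiv (by ext v; simp)
  have hf2 := (((h₂ _).comp_hasFDerivAt y (hq y)).smul hi).fderiv
  rw [laplacian_eq_sum_fderiv, hf]
  change ∑ i, fderiv ℝ ((H₁ ∘ fun z : Euc N => ‖z - x₀‖ ^ 2) •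
    fun z : Euc N => (2 : ℝ) • innerSL ℝ (z - x₀)) y _ _ = _
  rw [hf2]
  set e := EuclideanSpace.basisFun (Fin N) ℝ
  have hn : ∀ i, ⟪e i, e i⟫ = (1 : ℝ) := fun i => by
    rw [real_inner_self_eq_norm_sq, e.norm_eq_one, one_pow]
  calc _ = ∑ i, (H₁ (‖y - x₀‖ ^ 2) * 2 + 4 * H₂ (‖y - x₀‖ ^ 2) * ⟪y - x₀, e i⟫ ^ 2) := by
        refine Finset.sum_congr rfl fun i _ => ?_
        change H₁ (‖y - x₀‖ ^ 2) * (2 * ⟪e i, e i⟫) +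
          (H₂ (‖y - x₀‖ ^ 2) * (2 * ⟪y - x₀, e i⟫)) * (2 * ⟪y - x₀, e i⟫) = _
        rw [hn]
        ring
    _ = _ := by
        rw [Finset.sum_add_distrib, ← Finset.mul_sum (Finset.univ) _ (4 * _),
          e.sum_sq_inner_left]
        simp
        ring

/-- A function with locally bounded time derivative is bounded near compact time slices. -/
theorem exists_bound_of_hasDerivAt {U U' : Euc N → ℝ → ℝ} {B : Set (Euc N)} (hB : IsCompact B)
    {t δ : ℝ} (hδ : 0 < δ) (hU : ∀ y, ∀ s ∈ Icc (t - δ) (t + δ), HasDerivAt (U y) (U' y s) s)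
    (hUc : Continuous fun y => U y t)
    (hU' : ContinuousOn (fun z : Euc N × ℝ => U' z.1 z.2) (univ ×ˢ Icc (t - δ) (t + δ))) :
    ∃ C, 0 ≤ C ∧ ∀ y ∈ B, ∀ s ∈ Icc (t - δ) (t + δ), |U y s| ≤ C ∧ |U' y s| ≤ C := by
  obtain ⟨C₁, h₁⟩ := hB.exists_bound_of_continuousOn hUc.continuousOn
  obtain ⟨C₂, h₂⟩ := (hB.prod (isCompact_Icc (a := t - δ) (b := t + δ))).exists_bound_of_continuousOn
    (hU'.mono (prod_mono (subset_univ _) subset_rfl))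
  have ht : t ∈ Icc (t - δ) (t + δ) := ⟨by linarith, by linarith⟩
  refine ⟨|C₁| + |C₂| * δ + |C₂|, by positivity, fun y hy s hs => ⟨?_, ?_⟩⟩
  · have h3 : ‖U y s - U y t‖ ≤ |C₂| * ‖s - t‖ :=
      (convex_Icc _ _).norm_image_sub_le_of_norm_hasDerivWithin_le
        (fun r hr => (hU y r hr).hasDerivWithinAt)
        (fun r hr => (h₂ (y, r) ⟨hy, hr⟩).trans (le_abs_self _)) ht hs
    have h4 : ‖s - t‖ ≤ δ := abs_le.2 ⟨by linarith [hs.1], by linarith [hs.2]⟩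
    have h5 := (h₁ y hy).trans (le_abs_self _)
    have h6 : |C₂| * ‖s - t‖ ≤ |C₂| * δ := mul_le_mul_of_nonneg_left h4 (abs_nonneg _)
    have h7 := norm_sub_norm_le (U y s) (U y t)
    rw [Real.norm_eq_abs, Real.norm_eq_abs] at h7
    rw [Real.norm_eq_abs] at h5
    have h8 := abs_nonneg C₂
    linarith
  · have h5 := (h₂ (y, s) ⟨hy, hs⟩).trans (le_abs_self _)
    rw [Real.norm_eq_abs] at h5
    have h8 : 0 ≤ |C₁| + |C₂| * δ := by positivity
    linarith

/-- The integrand lives on a fixed compact set. There `U` and `φ` are bounded near time `t` by their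
values at `t` plus the integrated time derivatives, which supplies a dominating function. -/
theorem hasDerivAt_integral_mul_of_compact {U U' φ φ' : Euc N → ℝ → ℝ} {B : Set (Euc N)}
    (hB : IsCompact B) {I : Set ℝ} (hI : IsOpen I)
    (hU : ∀ y, ∀ s ∈ I, HasDerivAt (U y) (U' y s) s)
    (hUc : ∀ s ∈ I, Continuous fun y => U y s)
    (hU' : ContinuousOn (fun z : Euc N × ℝ => U' z.1 z.2) (univ ×ˢ I))
    (hφ : ∀ y, ∀ s ∈ I, HasDerivAt (φ y) (φ' y s) s)
    (hφc : ∀ s ∈ I, Continuous fun y => φ y s)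
    (hφ' : ContinuousOn (fun z : Euc N × ℝ => φ' z.1 z.2) (univ ×ˢ I))
    (h0 : ∀ y ∉ B, ∀ s ∈ I, φ y s = 0) (h0' : ∀ y ∉ B, ∀ s ∈ I, φ' y s = 0) {t : ℝ}
    (ht : t ∈ I) :
    HasDerivAt (fun s => ∫ y, U y s * φ y s) (∫ y, (U' y t * φ y t + U y t * φ' y t)) t := by
  obtain ⟨δ, hδ, hδI⟩ := Metric.nhds_basis_closedBall.mem_iff.1 (hI.mem_nhds ht)
  rw [Real.closedBall_eq_Icc] at hδI
  have hmono : (univ : Set (Euc N)) ×ˢ Icc (t - δ) (t + δ) ⊆ univ ×ˢ I := prod_mono subset_rfl hδI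
  obtain ⟨C₁, hC₁, h₁⟩ := exists_bound_of_hasDerivAt hB hδ (fun y s hs => hU y s (hδI hs))
    (hUc t ht) (hU'.mono hmono)
  obtain ⟨C₂, hC₂, h₂⟩ := exists_bound_of_hasDerivAt hB hδ (fun y s hs => hφ y s (hδI hs))
    (hφc t ht) (hφ'.mono hmono)
  have hslice : ∀ {g : Euc N → ℝ → ℝ},
      ContinuousOn (fun z : Euc N × ℝ => g z.1 z.2) (univ ×ˢ I) → Continuous fun y => g y t := by
    intro g hg
    have := hg.comp (f := fun y : Euc N => (y, t)) (s := univ) (by fun_prop)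
      (fun y _ => ⟨mem_univ _, ht⟩)
    exact continuousOn_univ.1 this
  have hind : Integrable (B.indicator fun _ : Euc N => 2 * C₁ * C₂) :=
    (integrable_indicator_iff hB.measurableSet).2 (integrableOn_const hB.measure_lt_top.ne)
  have hzero : ∀ y ∉ B, ∀ s ∈ I, U y s * φ y s = 0 := fun y hy s hs => by rw [h0 y hy s hs, mul_zero]
  refine (hasDerivAt_integral_of_dominated_loc_of_deriv_le (s := Icc (t - δ) (t + δ))
    (F := fun s y => U y s * φ y s) (F' := fun s y => U' y s * φ y s + U y s * φ' y s)
    (bound := B.indicator fun _ => 2 * C₁ * C₂)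
    (Icc_mem_nhds (by linarith) (by linarith)) ?_ ?_ ?_ ?_ hind ?_).2
  · filter_upwards [hI.mem_nhds ht] with s hs
    exact ((hUc s hs).mul (hφc s hs)).aestronglyMeasurable
  · exact ((hUc t ht).mul (hφc t ht)).integrable_of_hasCompactSupport
      (HasCompactSupport.intro hB fun y hy => hzero y hy t ht)
  · exact (((hslice hU').mul (hφc t ht)).add ((hUc t ht).mul (hslice hφ'))).aestronglyMeasurable
  · refine ae_of_all _ fun y s hs => ?_
    by_cases hy : y ∈ B
    · rw [indicator_of_mem hy]
      obtain ⟨a1, a2⟩ := h₁ y hy s hs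
      obtain ⟨b1, b2⟩ := h₂ y hy s hs
      calc ‖U' y s * φ y s + U y s * φ' y s‖ ≤ ‖U' y s * φ y s‖ + ‖U y s * φ' y s‖ :=
            norm_add_le _ _
        _ ≤ C₁ * C₂ + C₁ * C₂ := by
            rw [norm_mul, norm_mul]
            exact add_le_add (mul_le_mul a2 b1 (norm_nonneg _) hC₁)
              (mul_le_mul a1 b2 (norm_nonneg _) hC₁)
        _ = 2 * C₁ * C₂ := by ring
    · rw [indicator_of_notMem hy, h0 y hy s (hδI hs), h0' y hy s (hδI hs)]
      simp
  · exact ae_of_all _ fun y s hs => (hU y s (hδI hs)).mul (hφ y s (hδI hs))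

/-- Uniformly local integrability implies integrability against Gaussians. -/
theorem exists_lintegral_mul_exp_le (N : ℕ) {c : ℝ} (hc : 0 < c) : ∃ K : ℝ≥0,
    ∀ g : Euc N → ℝ≥0∞, Measurable g → ∀ M : ℝ≥0,
      (∀ x, ∫⁻ y in Metric.ball x 1, g y ≤ M) → ∀ x₀ : Euc N,
        ∫⁻ y, g y * ENNReal.ofReal (Real.exp (-c * ‖y - x₀‖ ^ 2)) ≤ K * M := by
  set W : Euc N → ℝ≥0∞ := fun z => ENNReal.ofReal (Real.exp c * Real.exp (-(c / 2) * ‖z‖ ^ 2))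
  have hWm : Measurable W := by fun_prop
  have hW : ∫⁻ z, W z ≠ ⊤ :=
    ((integrable_exp_neg_mul_norm_sq (N := N) (half_pos hc)).const_mul
      (Real.exp c)).lintegral_lt_top.ne
  set V := volume (Metric.ball (0 : Euc N) 1)
  have hV0 : V ≠ 0 := (Metric.measure_ball_pos _ _ one_pos).ne'
  have hV : V ≠ ⊤ := measure_ball_lt_top.ne
  refine ⟨((∫⁻ z, W z) / V).toNNReal, fun g hg M hM x₀ => ?_⟩
  rw [ENNReal.coe_toNNReal (ENNReal.div_ne_top hW hV0), ENNReal.div_eq_inv_mul, mul_assoc,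
    ← ENNReal.div_eq_inv_mul, ENNReal.le_div_iff_mul_le (Or.inl hV0) (Or.inl hV)]
  set w : Euc N → ℝ≥0∞ := fun y => ENNReal.ofReal (Real.exp (-c * ‖y - x₀‖ ^ 2))
  have hwm : Measurable w := by fun_prop
  have hset : MeasurableSet {z : Euc N × Euc N | dist z.2 z.1 < 1} :=
    measurableSet_lt (by fun_prop) measurable_const
  -- Average the integrand at `y` over the unit ball about `y`. For `|x - y| < 1` the Gaussian at
  -- `y` is at most `e^c` times the one of half the rate at `x`, and Tonelli then turns the inner
  -- integral into a uniformly local norm of `g`.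
  calc (∫⁻ y, g y * w y) * V
      = ∫⁻ y, ∫⁻ x, (Metric.ball y 1).indicator (fun _ => g y * w y) x := by
        have hgw : Measurable fun y => g y * w y := hg.mul hwm
        rw [← lintegral_mul_const _ hgw]
        refine lintegral_congr fun y => ?_
        rw [lintegral_indicator measurableSet_ball, setLIntegral_const,
          Measure.addHaar_ball_center]
    _ ≤ ∫⁻ y, ∫⁻ x, {z : Euc N × Euc N | dist z.2 z.1 < 1}.indicator
          (fun z => g z.1 * W (z.2 - x₀)) (y, x) := by
        refine lintegral_mono fun y => lintegral_mono fun x => ?_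
        by_cases h : dist x y < 1
        · rw [indicator_of_mem (by simpa using h), indicator_of_mem (by simpa using h)]
          refine mul_le_mul_right (ENNReal.ofReal_le_ofReal ?_) _
          rw [← Real.exp_add]
          refine Real.exp_le_exp.2 ?_
          have h1 : ‖x - x₀‖ ≤ ‖y - x₀‖ + 1 := by
            calc ‖x - x₀‖ = ‖(y - x₀) + (x - y)‖ := by congr 1; abel
              _ ≤ ‖y - x₀‖ + ‖x - y‖ := norm_add_le _ _
              _ ≤ _ := by rw [← dist_eq_norm x y]; linarith
          have h2 : ‖x - x₀‖ ^ 2 ≤ 2 * ‖y - x₀‖ ^ 2 + 2 := by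
            nlinarith [norm_nonneg (x - x₀), norm_nonneg (y - x₀), sq_nonneg (‖y - x₀‖ - 1)]
          nlinarith
        · rw [indicator_of_notMem (by simpa using h)]
          exact zero_le
    _ = ∫⁻ x, ∫⁻ y, {z : Euc N × Euc N | dist z.2 z.1 < 1}.indicator
          (fun z => g z.1 * W (z.2 - x₀)) (y, x) := by
        refine lintegral_lintegral_swap (Measurable.aemeasurable ?_)
        exact Measurable.indicator (by fun_prop) hset
    _ = ∫⁻ x, (∫⁻ y in Metric.ball x 1, g y) * W (x - x₀) := by
        refine lintegral_congr fun x => ?_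
        rw [← lintegral_mul_const _ hg, ← lintegral_indicator measurableSet_ball]
        refine lintegral_congr fun y => ?_
        by_cases h : dist x y < 1
        · rw [indicator_of_mem (by simpa using h),
            indicator_of_mem (by simpa [dist_comm] using h)]
        · rw [indicator_of_notMem (by simpa using h),
            indicator_of_notMem (by simpa [dist_comm] using h)]
    _ ≤ ∫⁻ x, M * W (x - x₀) := lintegral_mono fun x => mul_le_mul_left (hM x) _
    _ = (∫⁻ z, W z) * M := by
        rw [lintegral_const_mul _ (by fun_prop), lintegral_sub_right_eq_self W, mul_comm]

end HeatTools

/-! ### Duality with the backward heat kernel -/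

section HeatRepresentation

open Laplacian

variable {N : ℕ}

/-- The heat kernel as a function of the squared norm. -/
noncomputable def heatProfile (N : ℕ) (𝔞 τ s : ℝ) : ℝ :=
  (4 * Real.pi * 𝔞 * τ) ^ (-((N : ℝ) / 2)) * Real.exp (-s / (4 * 𝔞 * τ))

theorem heatKernel_eq_heatProfile (𝔞 τ : ℝ) (x : Euc N) :
    heatKernel 𝔞 x τ = heatProfile N 𝔞 τ (‖x‖ ^ 2) := rfl

theorem heatProfile_nonneg {𝔞 τ : ℝ} (h𝔞 : 0 < 𝔞) (hτ : 0 < τ) (s : ℝ) :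
    0 ≤ heatProfile N 𝔞 τ s := by
  have := Real.pi_pos
  unfold heatProfile
  positivity

theorem hasDerivAt_heatProfile (N : ℕ) (𝔞 τ s : ℝ) :
    HasDerivAt (heatProfile N 𝔞 τ) (-(1 / (4 * 𝔞 * τ)) * heatProfile N 𝔞 τ s) s := by
  refine ((((hasDerivAt_id s).neg.div_const (4 * 𝔞 * τ)).exp).const_mul _).congr_deriv ?_
  simp only [heatProfile, id_eq, Pi.neg_apply]
  ring

theorem hasDerivAt_heatProfile_time (N : ℕ) {𝔞 τ : ℝ} (h𝔞 : 0 < 𝔞) (hτ : 0 < τ) (s : ℝ) :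
    HasDerivAt (fun r => heatProfile N 𝔞 r s)
      ((-((N : ℝ) / (2 * τ)) + s / (4 * 𝔞 * τ ^ 2)) * heatProfile N 𝔞 τ s) τ := by
  have hpi := Real.pi_pos
  have hb : 0 < 4 * Real.pi * 𝔞 * τ := by positivity
  have h1 := ((hasDerivAt_id τ).const_mul (4 * Real.pi * 𝔞)).rpow_const (p := -((N : ℝ) / 2))
    (Or.inl (by simpa using hb.ne'))
  have h2 := (((hasDerivAt_id τ).const_mul (4 * 𝔞)).fun_inv
    (by simp only [id_eq]; positivity)).const_mul (-s)
  refine (h1.mul h2.exp).congr_deriv ?_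
  simp only [heatProfile, id_eq, div_eq_mul_inv (-s)]
  rw [Real.rpow_sub_one hb.ne']
  field_simp

/-- Uniform Gaussian domination of the heat profile on compact time intervals. -/
theorem exists_one_add_mul_heatProfile_le (N : ℕ) {𝔞 ε S : ℝ} (h𝔞 : 0 < 𝔞) (hε : 0 < ε)
    (hεS : ε ≤ S) : ∃ K, 0 < K ∧ ∀ τ ∈ Icc ε S, ∀ s, 0 ≤ s →
      (1 + s) * heatProfile N 𝔞 τ s ≤ K * Real.exp (-(1 / (8 * 𝔞 * S)) * s) := by
  have hS : 0 < S := hε.trans_le hεS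
  have hpi := Real.pi_pos
  obtain ⟨K, hK, h⟩ := exists_pow_mul_exp_neg_le 1 (show 0 < 1 / (8 * 𝔞 * S) by positivity)
  refine ⟨(4 * Real.pi * 𝔞 * ε) ^ (-((N : ℝ) / 2)) * (1 + K), by positivity,
    fun τ hτ s hs => ?_⟩
  have hτ0 : 0 < τ := hε.trans_le hτ.1
  have h1 : (4 * Real.pi * 𝔞 * τ) ^ (-((N : ℝ) / 2)) ≤ (4 * Real.pi * 𝔞 * ε) ^ (-((N : ℝ) / 2)) :=
    Real.rpow_le_rpow_of_nonpos (by positivity)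
      (mul_le_mul_of_nonneg_left hτ.1 (by positivity)) (by
        have : (0 : ℝ) ≤ N := by positivity
        linarith)
  set e := Real.exp (-(1 / (8 * 𝔞 * S)) * s)
  have he : 0 < e := Real.exp_pos _
  have he1 : e ≤ 1 := Real.exp_le_one_iff.2 (by
    rw [neg_mul]
    exact neg_nonpos.2 (by positivity))
  have h2 : Real.exp (-s / (4 * 𝔞 * τ)) ≤ e * e := by
    rw [← Real.exp_add]
    refine Real.exp_le_exp.2 ?_
    have : s / (4 * 𝔞 * S) ≤ s / (4 * 𝔞 * τ) :=
      div_le_div_of_nonneg_left hs (by positivity) (mul_le_mul_of_nonneg_left hτ.2 (by positivity))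
    have h3 : -(1 / (8 * 𝔞 * S)) * s + -(1 / (8 * 𝔞 * S)) * s = -(s / (4 * 𝔞 * S)) := by
      field_simp
      ring
    rw [h3, neg_div]
    linarith
  have h3 : (1 + s) * e ≤ 1 + K := by
    have h4 := h s hs
    rw [pow_one, ← neg_mul] at h4
    have : s * e ≤ K := h4
    linarith
  calc (1 + s) * heatProfile N 𝔞 τ s ≤
        (1 + s) * ((4 * Real.pi * 𝔞 * ε) ^ (-((N : ℝ) / 2)) * (e * e)) := by
        unfold heatProfile
        gcongr
    _ = (4 * Real.pi * 𝔞 * ε) ^ (-((N : ℝ) / 2)) * ((1 + s) * e) * e := by ring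
    _ ≤ _ := by gcongr

theorem continuous_heatProfile (N : ℕ) (𝔞 τ : ℝ) : Continuous (heatProfile N 𝔞 τ) := by
  unfold heatProfile
  fun_prop

theorem exists_cutoff : ∃ (ψ : ℝ → ℝ) (C : ℝ), ContDiff ℝ 2 ψ ∧ 0 ≤ C ∧
    (∀ s, |ψ s| ≤ 1) ∧ (∀ s, |deriv ψ s| ≤ C) ∧ (∀ s, |deriv (deriv ψ) s| ≤ C) ∧
    (∀ s, |s| ≤ 1 → ψ s = 1) ∧ ∀ s, 2 ≤ |s| → ψ s = 0 := by
  let b : ContDiffBump (0 : ℝ) := ⟨1, 2, one_pos, one_lt_two⟩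
  have hb : ContDiff ℝ 2 b := b.contDiff
  have h1 : ContDiff ℝ 1 (deriv b) := ((contDiff_succ_iff_deriv (n := 1)).1 hb).2.2
  have h2 : Continuous (deriv (deriv b)) := h1.continuous_deriv le_rfl
  have hs1 : HasCompactSupport (deriv b) := b.hasCompactSupport.deriv
  obtain ⟨C₁, hC₁⟩ := hs1.exists_bound_of_continuous h1.continuous
  obtain ⟨C₂, hC₂⟩ := hs1.deriv.exists_bound_of_continuous h2
  refine ⟨b, max C₁ C₂, hb, (norm_nonneg _).trans ((hC₁ 0).trans (le_max_left _ _)),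
    fun s => ?_, fun s => (hC₁ s).trans (le_max_left _ _),
    fun s => (hC₂ s).trans (le_max_right _ _), fun s hs => ?_, fun s hs => ?_⟩
  · rw [abs_of_nonneg b.nonneg]
    exact b.le_one
  · exact b.one_of_mem_closedBall (by simpa [b] using hs)
  · exact b.zero_of_le_dist (by simpa [b] using hs)

variable {𝔞 : ℝ} {f : Euc N → ℝ} {U : Euc N → ℝ → ℝ}

theorem IsHeatSolution.exists_integral_abs_mul_exp_le (hU : IsHeatSolution 𝔞 f U) {c T : ℝ}
    (hc : 0 < c) (hT : 0 < T) : ∃ K, 0 ≤ K ∧ ∀ t ∈ Ioo 0 T, ∀ x₀ : Euc N,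
      Integrable (fun y => |U y t| * Real.exp (-c * ‖y - x₀‖ ^ 2)) ∧
      ∫ y, |U y t| * Real.exp (-c * ‖y - x₀‖ ^ 2) ≤ K := by
  obtain ⟨K, hK⟩ := exists_lintegral_mul_exp_le N hc
  obtain ⟨M, hM⟩ := hU.bounded_uloc T hT
  refine ⟨((K * M : ℝ≥0) : ℝ), NNReal.coe_nonneg _, fun t ht x₀ => ?_⟩
  have hcont : Continuous fun y => U y t := (hU.contDiff_space t ht.1).continuous
  have h := hK (fun y => ‖U y t‖ₑ) hcont.enorm.measurable M (hM t ht) x₀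
  have hc2 : Continuous fun y => |U y t| * Real.exp (-c * ‖y - x₀‖ ^ 2) := by fun_prop
  have h0 : ∀ y, 0 ≤ |U y t| * Real.exp (-c * ‖y - x₀‖ ^ 2) := fun y => by positivity
  have heq : ∀ y, ‖U y t‖ₑ * ENNReal.ofReal (Real.exp (-c * ‖y - x₀‖ ^ 2)) =
      ENNReal.ofReal (|U y t| * Real.exp (-c * ‖y - x₀‖ ^ 2)) := fun y => by
    rw [ENNReal.ofReal_mul (abs_nonneg _), Real.enorm_eq_ofReal_abs]
  simp only [heq] at h
  constructor
  · refine ⟨hc2.aestronglyMeasurable, ?_⟩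
    rw [hasFiniteIntegral_iff_ofReal (ae_of_all _ h0)]
    exact h.trans_lt (ENNReal.mul_lt_top ENNReal.coe_lt_top ENNReal.coe_lt_top)
  · rw [integral_eq_lintegral_of_nonneg_ae (ae_of_all _ h0) hc2.aestronglyMeasurable]
    refine ENNReal.toReal_le_coe_of_le_coe ?_
    rw [ENNReal.coe_mul]
    exact h

/-- Testing a heat solution against the backward heat kernel, cut off at distance `√ρ`, gives a
nearly conserved quantity. -/
theorem IsHeatSolution.exists_abs_integral_sub_le (h𝔞 : 0 < 𝔞) (hU : IsHeatSolution 𝔞 f U)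
    {T ε : ℝ} (hT : 0 < T) (hε : 0 < ε) (x₀ : Euc N) {ψ : ℝ → ℝ} {C : ℝ} (hψ : ContDiff ℝ 2 ψ)
    (hC : 0 ≤ C) (hψ1 : ∀ s, |deriv ψ s| ≤ C)
    (hψ2 : ∀ s, |deriv (deriv ψ) s| ≤ C) (hψ0 : ∀ s, 2 ≤ |s| → ψ s = 0) :
    ∃ K, ∀ ρ, 1 ≤ ρ → ∀ s ∈ Ioc 0 T,
      |(∫ y, U y T * (heatProfile N 𝔞 ε (‖y - x₀‖ ^ 2) * ψ (‖y - x₀‖ ^ 2 / ρ))) -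
        ∫ y, U y s * (heatProfile N 𝔞 (T + ε - s) (‖y - x₀‖ ^ 2) * ψ (‖y - x₀‖ ^ 2 / ρ))| ≤
      K / ρ := by
  -- On `(0, T]` the backward kernel at time `S - t` has age at least `ε`, so it stays away from its
  -- singularity and has a common Gaussian majorant.
  set S := T + ε with hS
  have hS0 : 0 < S := by positivity
  obtain ⟨K₁, hK₁, hprof⟩ := exists_one_add_mul_heatProfile_le N h𝔞 hε (show ε ≤ S by linarith)
  set c := 1 / (8 * 𝔞 * S)
  have hc : 0 < c := by positivity
  obtain ⟨K₂, hK₂, hint⟩ := hU.exists_integral_abs_mul_exp_le hc hS0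
  set L := 𝔞 * C * (4 * (1 / (2 * 𝔞 * ε) + 1) + 2 * N) with hL
  have hL0 : 0 ≤ L := by positivity
  refine ⟨L * K₁ * K₂ * T, fun ρ hρ s hs => ?_⟩
  have hρ0 : 0 < ρ := by linarith
  have hψd : ∀ r, HasDerivAt ψ (deriv ψ r) r := fun r =>
    (hψ.differentiable (by norm_num) r).hasDerivAt
  have hψ' : ContDiff ℝ 1 (deriv ψ) := ((contDiff_succ_iff_deriv (n := 1)).1 hψ).2.2
  have hψdd : ∀ r, HasDerivAt (deriv ψ) (deriv (deriv ψ) r) r := fun r =>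
    (hψ'.differentiable (by norm_num) r).hasDerivAt
  set q : Euc N → ℝ := fun y => ‖y - x₀‖ ^ 2 with hq
  have hqc : Continuous q := by fun_prop
  have hψc : Continuous ψ := hψ.continuous
  set φ : Euc N → ℝ → ℝ := fun y t => heatProfile N 𝔞 (S - t) (q y) * ψ (q y / ρ) with hφ
  set φ' : Euc N → ℝ → ℝ := fun y t => -((-((N : ℝ) / (2 * (S - t))) +
    q y / (4 * 𝔞 * (S - t) ^ 2)) * heatProfile N 𝔞 (S - t) (q y)) * ψ (q y / ρ) with hφ'
  have hzero : ∀ y ∉ Metric.closedBall x₀ (√(2 * ρ)), ψ (q y / ρ) = 0 := by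
    intro y hy
    refine hψ0 _ (le_trans ?_ (le_abs_self _))
    rw [le_div_iff₀ hρ0, hq]
    have h1 : √(2 * ρ) < ‖y - x₀‖ := by simpa [dist_eq_norm] using hy
    have := pow_le_pow_left₀ (Real.sqrt_nonneg _) h1.le 2
    rwa [Real.sq_sqrt (by positivity)] at this
  have hUlap : ContinuousOn (fun z : Euc N × ℝ => 𝔞 * (Δ fun x => U x z.2) z.1)
      (univ ×ˢ Ioo 0 S) :=
    (hU.continuous_laplacian.mono (prod_mono subset_rfl Ioo_subset_Ioi_self)).const_mul 𝔞
  have hderiv : ∀ t ∈ Ioo 0 S, HasDerivAt (fun s => ∫ y, U y s * φ y s)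
      (∫ y, (𝔞 * (Δ fun x => U x t) y * φ y t + U y t * φ' y t)) t := by
    intro t ht
    refine hasDerivAt_integral_mul_of_compact (U' := fun y t => 𝔞 * (Δ fun x => U x t) y)
      (isCompact_closedBall x₀ (√(2 * ρ))) isOpen_Ioo
      (fun y s hs => hU.equation y s hs.1) (fun s hs => (hU.contDiff_space s hs.1).continuous)
      hUlap ?_ ?_ ?_ ?_ ?_ ht
    · intro y s hs
      have h1 := (hasDerivAt_heatProfile_time N h𝔞 (sub_pos.2 hs.2) (q y)).comp s
        ((hasDerivAt_id s).const_sub S)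
      refine (h1.mul_const (ψ (q y / ρ))).congr_deriv ?_
      simp only [hφ']
      ring
    · intro s hs
      exact ((continuous_heatProfile N 𝔞 _).comp hqc).mul (by fun_prop)
    · have hpos : ∀ z ∈ (univ : Set (Euc N)) ×ˢ Ioo 0 S, 0 < S - z.2 := fun z hz =>
        sub_pos.2 hz.2.2
      have hpi := Real.pi_pos
      have hcpow : ContinuousOn (fun z : Euc N × ℝ =>
          (4 * Real.pi * 𝔞 * (S - z.2)) ^ (-((N : ℝ) / 2))) (univ ×ˢ Ioo 0 S) :=
        ContinuousOn.rpow_const (by fun_prop) fun z hz => Or.inl (by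
          have := hpos z hz
          positivity)
      simp only [hφ', heatProfile]
      refine ContinuousOn.mul (ContinuousOn.neg (ContinuousOn.mul (ContinuousOn.add ?_ ?_)
        (hcpow.mul ?_))) (by fun_prop)
      · exact (continuousOn_const.div (by fun_prop) fun z hz => by
          have := hpos z hz
          positivity).neg
      · exact ContinuousOn.div (by fun_prop) (by fun_prop) fun z hz => by
          have := hpos z hz
          positivity
      · exact (ContinuousOn.div (by fun_prop) (by fun_prop) fun z hz => by
          have := hpos z hz
          positivity).rexp
    · intro y hy s _
      simp only [hφ, hzero y hy, mul_zero]
    · intro y hy s _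
      simp only [hφ', hzero y hy, mul_zero]
  have hbound : ∀ t ∈ Icc s T,
      ‖∫ y, (𝔞 * (Δ fun x => U x t) y * φ y t + U y t * φ' y t)‖ ≤ L * K₁ * K₂ / ρ := by
    intro t ht
    have ht0 : 0 < t := hs.1.trans_le ht.1
    have hτ : S - t ∈ Icc ε S := ⟨by linarith [ht.2], by linarith⟩
    set τ := S - t with hτd
    have hτ0 : 0 < τ := hε.trans_le hτ.1
    set P := heatProfile N 𝔞 τ
    have hPc : Continuous P := continuous_heatProfile N 𝔞 τ
    have hP : ∀ r, HasDerivAt P (-(1 / (4 * 𝔞 * τ)) * P r) r := hasDerivAt_heatProfile N 𝔞 τ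
    have hsc : ∀ r : ℝ, HasDerivAt (fun r : ℝ => r / ρ) (1 / ρ) r := fun r =>
      (hasDerivAt_id r).div_const ρ
    have hH1 : ∀ r, HasDerivAt (fun r => P r * ψ (r / ρ))
        (P r * (-(1 / (4 * 𝔞 * τ)) * ψ (r / ρ) + deriv ψ (r / ρ) / ρ)) r := fun r => by
      refine ((hP r).mul ((hψd _).comp r (hsc r))).congr_deriv ?_
      simp only [Function.comp_apply]
      ring
    have hH2 : ∀ r, HasDerivAt (fun r => P r * (-(1 / (4 * 𝔞 * τ)) * ψ (r / ρ) +
        deriv ψ (r / ρ) / ρ)) (P r * ((1 / (4 * 𝔞 * τ)) ^ 2 * ψ (r / ρ) -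
          2 * (1 / (4 * 𝔞 * τ)) * (deriv ψ (r / ρ) / ρ) +
          deriv (deriv ψ) (r / ρ) / ρ ^ 2)) r := fun r => by
      refine ((hP r).mul ((((hψd _).comp r (hsc r)).const_mul (-(1 / (4 * 𝔞 * τ)))).add
        (((hψdd _).comp r (hsc r)).div_const ρ))).congr_deriv ?_
      simp only [Function.comp_apply, Pi.add_apply]
      ring
    have hφcd : ContDiff ℝ 2 fun y => φ y t := by
      have hPs : ContDiff ℝ 2 P := by
        simp only [P]
        unfold heatProfile
        fun_prop
      have hqs : ContDiff ℝ 2 q := (contDiff_id.sub contDiff_const).norm_sq ℝ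
      exact (hPs.comp hqs).mul (hψ.comp (hqs.div_const ρ))
    have hφs : HasCompactSupport fun y => φ y t :=
      HasCompactSupport.intro (isCompact_closedBall x₀ (√(2 * ρ))) fun y hy => by
        simp only [hφ, hzero y hy, mul_zero]
    have hVc := (hU.contDiff_space t ht0).continuous
    have hlapc : Continuous fun y => 𝔞 * (Δ fun x => U x t) y := by
      have := hUlap.comp (f := fun y : Euc N => (y, t)) (s := univ) (by fun_prop)
        (fun y _ => ⟨mem_univ _, ht0, by linarith [ht.2]⟩)
      exact continuousOn_univ.1 this
    have hφ'c : Continuous fun y => φ' y t :=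
      ((continuous_const.add (hqc.div_const _)).mul (hPc.comp hqc)).neg.mul (by fun_prop)
    have hφ's : HasCompactSupport fun y => φ' y t :=
      HasCompactSupport.intro (isCompact_closedBall x₀ (√(2 * ρ))) fun y hy => by
        simp only [hφ', hzero y hy, mul_zero]
    have hψ'c : Continuous (deriv ψ) := hψ'.continuous
    have hψ''c : Continuous (deriv (deriv ψ)) := hψ'.continuous_deriv le_rfl
    -- Since the kernel solves the backward equation, in `𝔞 Δφ + φ_t` every term without a
    -- derivative of the cut-off cancels. The remaining ones carry a factor `1 / ρ` or `1 / ρ²`.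
    set err : Euc N → ℝ := fun y => P (q y) * 𝔞 * (4 * q y * (-(2 * (1 / (4 * 𝔞 * τ))) *
      (deriv ψ (q y / ρ) / ρ) + deriv (deriv ψ) (q y / ρ) / ρ ^ 2) +
      2 * N * (deriv ψ (q y / ρ) / ρ)) with herr
    have hlapφ : ∀ y, 𝔞 * (Δ fun y => φ y t) y + φ' y t = err y := by
      intro y
      have h := laplacian_comp_norm_sub_sq hH1 hH2 x₀ y
      have h' : (Δ fun y => φ y t) y = _ := h
      have hφ't : φ' y t = -((-((N : ℝ) / (2 * τ)) + q y / (4 * 𝔞 * τ ^ 2)) * P (q y)) *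
          ψ (q y / ρ) := rfl
      rw [h', hφ't]
      simp only [herr, hq]
      field_simp
      ring
    have hΔφ : Continuous fun y => (Δ fun y => φ y t) y := by
      have : (fun y => (Δ fun y => φ y t) y) = _ :=
        funext fun y => laplacian_comp_norm_sub_sq hH1 hH2 x₀ y
      rw [this]
      fun_prop
    have hΔφs : HasCompactSupport fun y => (Δ fun y => φ y t) y := by
      refine HasCompactSupport.intro (isCompact_closedBall x₀ (√(2 * ρ))) fun y hy => ?_
      have : (fun y => φ y t) =ᶠ[𝓝 y] fun _ => 0 := by
        filter_upwards [Metric.isClosed_closedBall.isOpen_compl.mem_nhds hy] with z hz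
        simp only [hφ, hzero z hz, mul_zero]
      rw [(InnerProductSpace.laplacian_congr_nhds this).eq_of_nhds]
      simp
    have hgreen := integral_laplacian_mul (hU.contDiff_space t ht0) hφcd hφs
    have heq : ∫ y, (𝔞 * (Δ fun x => U x t) y * φ y t + U y t * φ' y t) =
        ∫ y, U y t * err y := by
      have i1 : Integrable fun y => 𝔞 * (Δ fun x => U x t) y * φ y t :=
        (hlapc.mul hφcd.continuous).integrable_of_hasCompactSupport hφs.mul_left
      have i2 : Integrable fun y => U y t * φ' y t :=
        (hVc.mul hφ'c).integrable_of_hasCompactSupport hφ's.mul_left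
      have i3 : Integrable fun y => 𝔞 * (U y t * (Δ fun y => φ y t) y) :=
        ((hVc.mul hΔφ).integrable_of_hasCompactSupport hΔφs.mul_left).const_mul 𝔞
      rw [integral_add i1 i2]
      simp only [mul_assoc]
      rw [integral_const_mul, hgreen, ← integral_const_mul, ← integral_add i3 i2]
      refine integral_congr_ae (ae_of_all _ fun y => ?_)
      simp only
      rw [← hlapφ y]
      ring
    obtain ⟨hi, hle⟩ := hint t ⟨ht0, by linarith [ht.2]⟩ x₀
    have herrb : ∀ y, |err y| ≤ L * K₁ / ρ * Real.exp (-c * q y) := by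
      intro y
      have hq0 : 0 ≤ q y := by positivity
      have hP0 : 0 ≤ P (q y) := heatProfile_nonneg h𝔞 hτ0 _
      have h1 := hψ1 (q y / ρ)
      have h2 := hψ2 (q y / ρ)
      have h3 : |-(2 * (1 / (4 * 𝔞 * τ))) * (deriv ψ (q y / ρ) / ρ)| ≤
          1 / (2 * 𝔞 * ε) * (C / ρ) := by
        rw [abs_mul, abs_neg, abs_div, abs_of_pos hρ0, abs_of_nonneg (by positivity)]
        refine mul_le_mul ?_ (by gcongr) (by positivity) (by positivity)
        rw [show 2 * (1 / (4 * 𝔞 * τ)) = 1 / (2 * 𝔞 * τ) by field_simp; norm_num]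
        exact one_div_le_one_div_of_le (by positivity)
          (mul_le_mul_of_nonneg_left hτ.1 (by positivity))
      have h4 : |deriv (deriv ψ) (q y / ρ) / ρ ^ 2| ≤ C / ρ := by
        rw [abs_div, abs_of_pos (show 0 < ρ ^ 2 by positivity)]
        exact div_le_div₀ hC h2 hρ0 (by nlinarith)
      have h5 : |deriv ψ (q y / ρ) / ρ| ≤ C / ρ := by
        rw [abs_div, abs_of_pos hρ0]
        gcongr
      rw [herr]
      simp only
      rw [abs_mul, abs_of_nonneg (by positivity : 0 ≤ P (q y) * 𝔞)]
      calc _ ≤ P (q y) * 𝔞 * (4 * q y * (1 / (2 * 𝔞 * ε) * (C / ρ) + C / ρ) +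
            2 * N * (C / ρ)) := by
            refine mul_le_mul_of_nonneg_left ((abs_add_le _ _).trans (add_le_add ?_ ?_))
              (by positivity)
            · rw [abs_mul, abs_of_nonneg (by positivity : 0 ≤ 4 * q y)]
              exact mul_le_mul_of_nonneg_left ((abs_add_le _ _).trans (add_le_add h3 h4))
                (by positivity)
            · rw [abs_mul, abs_of_nonneg (by positivity : 0 ≤ 2 * (N : ℝ))]
              exact mul_le_mul_of_nonneg_left h5 (by positivity)
        _ = 𝔞 * C / ρ * P (q y) * (q y * (4 * (1 / (2 * 𝔞 * ε) + 1)) + 1 * (2 * N)) := by ring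
        _ ≤ 𝔞 * C / ρ * P (q y) * ((1 + q y) * (4 * (1 / (2 * 𝔞 * ε) + 1)) +
              (1 + q y) * (2 * N)) := by
            gcongr
            · linarith
            · linarith
        _ = L / ρ * ((1 + q y) * P (q y)) := by rw [hL]; ring
        _ ≤ L / ρ * (K₁ * Real.exp (-c * q y)) :=
            mul_le_mul_of_nonneg_left (hprof τ hτ (q y) hq0) (by positivity)
        _ = _ := by ring
    rw [heq]
    calc ‖∫ y, U y t * err y‖ ≤ ∫ y, L * K₁ / ρ * (|U y t| * Real.exp (-c * ‖y - x₀‖ ^ 2)) := by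
          refine norm_integral_le_of_norm_le (hi.const_mul _) (ae_of_all _ fun y => ?_)
          rw [norm_mul, Real.norm_eq_abs, Real.norm_eq_abs]
          calc |U y t| * |err y| ≤ |U y t| * (L * K₁ / ρ * Real.exp (-c * q y)) :=
                mul_le_mul_of_nonneg_left (herrb y) (abs_nonneg _)
            _ = _ := by simp only [hq]; ring
      _ ≤ L * K₁ / ρ * K₂ := by
          rw [integral_const_mul]
          exact mul_le_mul_of_nonneg_left hle (by positivity)
      _ = _ := by ring
  -- The derivative bound does not depend on `s`, so the mean value inequality survives the later
  -- limit `s → 0`.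
  have hmv := (convex_Icc s T).norm_image_sub_le_of_norm_hasDerivWithin_le
    (fun t ht => (hderiv t ⟨hs.1.trans_le ht.1, by linarith [ht.2]⟩).hasDerivWithinAt)
    hbound (left_mem_Icc.2 hs.2) (right_mem_Icc.2 hs.2)
  have hfin : L * K₁ * K₂ / ρ * ‖T - s‖ ≤ L * K₁ * K₂ * T / ρ := by
    rw [Real.norm_of_nonneg (by linarith [hs.2])]
    calc _ ≤ L * K₁ * K₂ / ρ * T :=
          mul_le_mul_of_nonneg_left (by linarith [hs.1]) (by positivity)
      _ = _ := by ring
  have := hmv.trans hfin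
  simp only [hφ, hS, add_sub_cancel_left] at this
  rw [Real.norm_eq_abs] at this
  simpa only [hS, hq] using this

end HeatRepresentation

/-! ### Initial trace and uniqueness for the heat equation -/

section HeatRepresentation

variable {N : ℕ} {𝔞 : ℝ} {f : Euc N → ℝ} {U : Euc N → ℝ → ℝ}

theorem integrable_mul_of_abs_le_exp (hf : AEStronglyMeasurable f)
    (hfi : ∀ c, 0 < c → ∀ x₀ : Euc N, Integrable fun y => Real.exp (-c * ‖y - x₀‖ ^ 2) * f y)
    {g : Euc N → ℝ} (hg : Continuous g) {c K : ℝ} (hc : 0 < c) (x₀ : Euc N)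
    (hgK : ∀ y, |g y| ≤ K * Real.exp (-c * ‖y - x₀‖ ^ 2)) : Integrable fun y => f y * g y := by
  refine ((hfi c hc x₀).norm.const_mul K).mono' (hf.mul hg.aestronglyMeasurable)
    (ae_of_all _ fun y => ?_)
  rw [norm_mul, norm_mul, Real.norm_eq_abs, Real.norm_eq_abs, Real.norm_eq_abs, Real.abs_exp]
  calc |f y| * |g y| ≤ |f y| * (K * Real.exp (-c * ‖y - x₀‖ ^ 2)) :=
        mul_le_mul_of_nonneg_left (hgK y) (abs_nonneg _)
    _ = _ := by ring

/-- With the cut-off in place only a bounded region matters. There `U(s) → f` in `L¹` while the test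
function stays bounded; the motion of the test function against `f` is handled by dominated
convergence. -/
theorem IsHeatSolution.tendsto_integral_mul_cutoff (h𝔞 : 0 < 𝔞) (hU : IsHeatSolution 𝔞 f U)
    (hf : AEStronglyMeasurable f)
    (hfi : ∀ c, 0 < c → ∀ x₀ : Euc N, Integrable fun y => Real.exp (-c * ‖y - x₀‖ ^ 2) * f y)
    {T ε : ℝ} (hT : 0 < T) (hε : 0 < ε) (x₀ : Euc N) {ψ : ℝ → ℝ} (hψ : Continuous ψ)
    (hψ1 : ∀ s, |ψ s| ≤ 1) (hψ0 : ∀ s, 2 ≤ |s| → ψ s = 0) {ρ : ℝ} (hρ : 0 < ρ) :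
    Tendsto (fun s => ∫ y, U y s *
        (heatProfile N 𝔞 (T + ε - s) (‖y - x₀‖ ^ 2) * ψ (‖y - x₀‖ ^ 2 / ρ))) (𝓝[>] 0)
      (𝓝 (∫ y, f y * (heatProfile N 𝔞 (T + ε) (‖y - x₀‖ ^ 2) * ψ (‖y - x₀‖ ^ 2 / ρ)))) := by
  set S := T + ε with hS
  have hS0 : 0 < S := by positivity
  obtain ⟨K, hK, hprof⟩ := exists_one_add_mul_heatProfile_le N h𝔞 hε (show ε ≤ S by linarith)
  set c := 1 / (8 * 𝔞 * S)
  have hc : 0 < c := by positivity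
  set q : Euc N → ℝ := fun y => ‖y - x₀‖ ^ 2 with hq
  have hqc : Continuous q := by fun_prop
  set g : ℝ → Euc N → ℝ := fun s y => heatProfile N 𝔞 (S - s) (q y) * ψ (q y / ρ) with hg
  have hgc : ∀ s, Continuous (g s) := fun s =>
    ((continuous_heatProfile N 𝔞 _).comp hqc).mul (by fun_prop)
  have hgb : ∀ s, 0 ≤ s → s ≤ T → ∀ y, |g s y| ≤ K * Real.exp (-c * q y) := by
    intro s hs0 hs y
    have hq0 : 0 ≤ q y := by positivity
    have hP := heatProfile_nonneg (N := N) h𝔞 (show 0 < S - s by linarith) (q y)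
    rw [hg]
    simp only
    rw [abs_mul, abs_of_nonneg hP]
    calc _ ≤ heatProfile N 𝔞 (S - s) (q y) * 1 := mul_le_mul_of_nonneg_left (hψ1 _) hP
      _ ≤ (1 + q y) * heatProfile N 𝔞 (S - s) (q y) := by nlinarith
      _ ≤ _ := hprof _ ⟨by linarith, by linarith⟩ _ hq0
  have hzero : ∀ s, ∀ y ∉ Metric.closedBall x₀ (√(2 * ρ)), g s y = 0 := by
    intro s y hy
    have : ψ (q y / ρ) = 0 := by
      refine hψ0 _ (le_trans ?_ (le_abs_self _))
      rw [le_div_iff₀ hρ, hq]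
      have h1 : √(2 * ρ) < ‖y - x₀‖ := by simpa [dist_eq_norm] using hy
      have := pow_le_pow_left₀ (Real.sqrt_nonneg _) h1.le 2
      rwa [Real.sq_sqrt (by positivity)] at this
    simp only [hg, this, mul_zero]
  -- The initial condition is formulated on balls about the origin, so the support about `x₀` is
  -- enclosed in one.
  set R := ‖x₀‖ + √(2 * ρ) + 1 with hR
  have hzero' : ∀ s, ∀ y ∉ Metric.ball (0 : Euc N) R, g s y = 0 := by
    intro s y hy
    refine hzero s y fun h => hy ?_
    rw [mem_closedBall_iff_norm] at h
    rw [mem_ball_zero_iff]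
    have := norm_le_norm_add_norm_sub' y x₀
    linarith
  have hR0 : 0 < R := by positivity
  have hifg : ∀ s, 0 ≤ s → s ≤ T → Integrable fun y => f y * g s y := fun s hs0 hs =>
    integrable_mul_of_abs_le_exp hf hfi (hgc s) hc x₀ (hgb s hs0 hs)
  have hiUg : ∀ s, 0 < s → Integrable fun y => U y s * g s y := fun s hs =>
    ((hU.contDiff_space s hs).continuous.mul (hgc s)).integrable_of_hasCompactSupport
      (HasCompactSupport.mul_left
        (HasCompactSupport.intro (isCompact_closedBall x₀ (√(2 * ρ))) (hzero s)))
  have hnear : ∀ᶠ s in 𝓝[>] (0 : ℝ), s ∈ Ioc 0 T := Ioc_mem_nhdsGT hT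
  have h1 : Tendsto (fun s => ∫ y, (U y s - f y) * g s y) (𝓝[>] 0) (𝓝 0) := by
    rw [tendsto_zero_iff_enorm_tendsto_zero]
    have h2 := ENNReal.Tendsto.const_mul (a := ENNReal.ofReal K) (hU.initial R hR0)
      (Or.inr ENNReal.ofReal_ne_top)
    rw [mul_zero] at h2
    refine tendsto_of_tendsto_of_tendsto_of_le_of_le' tendsto_const_nhds h2
      (Eventually.of_forall fun _ => zero_le) ?_
    filter_upwards [hnear] with s hs
    rw [← lintegral_const_mul' _ _ ENNReal.ofReal_ne_top,
      ← lintegral_indicator Metric.isOpen_ball.measurableSet]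
    refine (enorm_integral_le_lintegral_enorm _).trans (lintegral_mono fun y => ?_)
    by_cases hy : y ∈ Metric.ball (0 : Euc N) R
    · rw [indicator_of_mem hy, enorm_mul, mul_comm]
      gcongr
      rw [Real.enorm_eq_ofReal_abs]
      refine ENNReal.ofReal_le_ofReal ((hgb s hs.1.le hs.2 y).trans ?_)
      have : Real.exp (-c * q y) ≤ 1 := Real.exp_le_one_iff.2 (by
        have : 0 ≤ q y := by positivity
        nlinarith)
      nlinarith
    · rw [hzero' s y hy]
      simp
  have h2 : Tendsto (fun s => ∫ y, f y * g s y) (𝓝[>] 0) (𝓝 (∫ y, f y * g 0 y)) := by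
    refine tendsto_integral_filter_of_dominated_convergence
      (fun y => K * ‖Real.exp (-c * ‖y - x₀‖ ^ 2) * f y‖)
      (Eventually.of_forall fun s => hf.mul (hgc s).aestronglyMeasurable) ?_
      ((hfi c hc x₀).norm.const_mul K) (ae_of_all _ fun y => ?_)
    · filter_upwards [hnear] with s hs
      refine ae_of_all _ fun y => ?_
      calc ‖f y * g s y‖ = |f y| * |g s y| := abs_mul _ _
        _ ≤ |f y| * (K * Real.exp (-c * ‖y - x₀‖ ^ 2)) :=
            mul_le_mul_of_nonneg_left (hgb s hs.1.le hs.2 y) (abs_nonneg _)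
        _ = _ := by
          rw [norm_mul, Real.norm_eq_abs, Real.norm_eq_abs, Real.abs_exp]
          ring
    · have h3 := (hasDerivAt_heatProfile_time N h𝔞 (show 0 < S - 0 by simpa) (q y)).continuousAt
      have h4 : ContinuousAt (fun s => S - s) 0 := by fun_prop
      have h5 : ContinuousAt (fun s => heatProfile N 𝔞 (S - s) (q y)) 0 :=
        ContinuousAt.comp (f := fun s : ℝ => S - s) (g := fun r => heatProfile N 𝔞 r (q y)) h3 h4
      exact (continuousAt_const.mul (h5.mul continuousAt_const)).mono_left nhdsWithin_le_nhds
  have h3 := h1.add h2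
  simp only [zero_add] at h3
  have h0 : g 0 = fun y => heatProfile N 𝔞 S (‖y - x₀‖ ^ 2) * ψ (‖y - x₀‖ ^ 2 / ρ) := by
    simp only [hg, sub_zero, hq]
  rw [h0] at h3
  refine h3.congr' ?_
  filter_upwards [hnear] with s hs
  have h4 : Integrable fun y => (U y s - f y) * g s y :=
    ((hiUg s hs.1).sub (hifg s hs.1.le hs.2)).congr (ae_of_all _ fun y => by
      simp only [Pi.sub_apply]
      ring)
  rw [← integral_add h4 (hifg s hs.1.le hs.2)]
  refine integral_congr_ae (ae_of_all _ fun y => ?_)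
  simp only [hg, hq]
  ring

theorem tendsto_integral_mul_comp_norm_sq_div {h : Euc N → ℝ} (hh : Integrable h) {ψ : ℝ → ℝ}
    (hψ : Continuous ψ) (hψ1 : ∀ s, |ψ s| ≤ 1) (hψ0 : ∀ s, |s| ≤ 1 → ψ s = 1) (x₀ : Euc N) :
    Tendsto (fun ρ => ∫ y, h y * ψ (‖y - x₀‖ ^ 2 / ρ)) atTop (𝓝 (∫ y, h y)) := by
  refine tendsto_integral_filter_of_dominated_convergence (fun y => ‖h y‖)
    (Eventually.of_forall fun ρ => hh.1.mul
      (Continuous.aestronglyMeasurable (by fun_prop))) (Eventually.of_forall fun ρ =>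
      ae_of_all _ fun y => ?_) hh.norm (ae_of_all _ fun y => ?_)
  · rw [norm_mul]
    exact mul_le_of_le_one_right (norm_nonneg _) (hψ1 _)
  · refine tendsto_const_nhds.congr' ?_
    filter_upwards [eventually_ge_atTop (max 1 (‖y - x₀‖ ^ 2))] with ρ hρ
    have h1 : 0 < ρ := one_pos.trans_le ((le_max_left _ _).trans hρ)
    rw [hψ0, mul_one]
    rw [abs_of_nonneg (by positivity), div_le_one h1]
    exact (le_max_right _ _).trans hρ

/-- Conservation of the pairing with the backward kernel: first `s → 0`, then `ρ → ∞`, where the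
cut-off error `K / ρ` disappears. The delay `ε` keeps the kernel regular at the final time. -/
theorem IsHeatSolution.integral_mul_heatProfile (h𝔞 : 0 < 𝔞) (hU : IsHeatSolution 𝔞 f U)
    (hf : AEStronglyMeasurable f)
    (hfi : ∀ c, 0 < c → ∀ x₀ : Euc N, Integrable fun y => Real.exp (-c * ‖y - x₀‖ ^ 2) * f y)
    {T ε : ℝ} (hT : 0 < T) (hε : 0 < ε) (x₀ : Euc N) :
    ∫ y, U y T * heatProfile N 𝔞 ε (‖y - x₀‖ ^ 2) =
      ∫ y, f y * heatProfile N 𝔞 (T + ε) (‖y - x₀‖ ^ 2) := by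
  obtain ⟨ψ, C, hψ, hC, hψb, hψ1, hψ2, hψe, hψ0⟩ := exists_cutoff
  obtain ⟨K, hK⟩ := hU.exists_abs_integral_sub_le h𝔞 hT hε x₀ hψ hC hψ1 hψ2 hψ0
  have hstep : ∀ ρ, 1 ≤ ρ →
      |(∫ y, U y T * (heatProfile N 𝔞 ε (‖y - x₀‖ ^ 2) * ψ (‖y - x₀‖ ^ 2 / ρ))) -
        ∫ y, f y * (heatProfile N 𝔞 (T + ε) (‖y - x₀‖ ^ 2) * ψ (‖y - x₀‖ ^ 2 / ρ))| ≤ K / ρ := by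
    intro ρ hρ
    refine le_of_tendsto ((hU.tendsto_integral_mul_cutoff h𝔞 hf hfi hT hε x₀ hψ.continuous hψb hψ0
      (by linarith)).const_sub _).abs ?_
    filter_upwards [Ioc_mem_nhdsGT hT] with s hs using hK ρ hρ s hs
  have hdom : ∀ τ, 0 < τ → ∃ c K : ℝ, 0 < c ∧ ∀ y : Euc N,
      |heatProfile N 𝔞 τ (‖y - x₀‖ ^ 2)| ≤ K * Real.exp (-c * ‖y - x₀‖ ^ 2) := by
    intro τ hτ
    refine ⟨1 / (4 * 𝔞 * τ), (4 * Real.pi * 𝔞 * τ) ^ (-((N : ℝ) / 2)), by positivity,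
      fun y => le_of_eq ?_⟩
    rw [abs_of_nonneg (heatProfile_nonneg h𝔞 hτ _), heatProfile]
    congr 2
    ring
  have hprofc : ∀ τ, Continuous fun y : Euc N => heatProfile N 𝔞 τ (‖y - x₀‖ ^ 2) := fun τ =>
    (continuous_heatProfile N 𝔞 τ).comp (by fun_prop)
  have hi1 : Integrable fun y => U y T * heatProfile N 𝔞 ε (‖y - x₀‖ ^ 2) := by
    obtain ⟨c, K', hc, hle⟩ := hdom ε hε
    refine integrable_mul_of_abs_le_exp
      (hU.contDiff_space T hT).continuous.aestronglyMeasurable ?_ (hprofc ε) hc x₀ hle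
    intro c hc x
    obtain ⟨_, _, h⟩ := hU.exists_integral_abs_mul_exp_le hc (show 0 < T + 1 by linarith)
    have hVc := (hU.contDiff_space T hT).continuous
    refine (h T ⟨hT, by linarith⟩ x).1.mono' (Continuous.aestronglyMeasurable (by fun_prop))
      (ae_of_all _ fun y => ?_)
    rw [norm_mul, Real.norm_eq_abs, Real.norm_eq_abs, Real.abs_exp, mul_comm]
  have hi2 : Integrable fun y => f y * heatProfile N 𝔞 (T + ε) (‖y - x₀‖ ^ 2) := by
    obtain ⟨c, K', hc, hle⟩ := hdom (T + ε) (by positivity)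
    exact integrable_mul_of_abs_le_exp hf hfi (hprofc _) hc x₀ hle
  have ht := (tendsto_integral_mul_comp_norm_sq_div hi1 hψ.continuous hψb hψe x₀).sub
    (tendsto_integral_mul_comp_norm_sq_div hi2 hψ.continuous hψb hψe x₀)
  simp only [mul_assoc] at ht
  have h0 : Tendsto (fun ρ : ℝ => K / ρ) atTop (𝓝 0) := tendsto_const_nhds.div_atTop tendsto_id
  have hz := squeeze_zero_norm' (f := fun ρ =>
    (∫ y, U y T * (heatProfile N 𝔞 ε (‖y - x₀‖ ^ 2) * ψ (‖y - x₀‖ ^ 2 / ρ))) -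
        ∫ y, f y * (heatProfile N 𝔞 (T + ε) (‖y - x₀‖ ^ 2) * ψ (‖y - x₀‖ ^ 2 / ρ))) (by
    filter_upwards [eventually_ge_atTop 1] with ρ hρ using hstep ρ hρ) h0
  exact sub_eq_zero.1 (tendsto_nhds_unique ht hz)

/-- Heat kernels with vanishing time tested against an exponentially bounded function. -/
theorem tendsto_integral_mul_heatProfile (h𝔞 : 0 < 𝔞) {V : Euc N → ℝ} (hV : Continuous V)
    (x₀ : Euc N) (hVi : Integrable fun y => V y * Real.exp (-‖y - x₀‖ ^ 2)) :
    Tendsto (fun c : ℝ => ∫ y, V y * heatProfile N 𝔞 (1 / (c ^ 2 + 4 * 𝔞)) (‖y - x₀‖ ^ 2))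
      atTop (𝓝 (V x₀)) := by
  have hpi := Real.pi_pos
  have hdecay : Tendsto (fun x : Euc N => ‖x‖ ^ Module.finrank ℝ (Euc N) * heatKernel 𝔞 x 1)
      (Bornology.cobounded (Euc N)) (𝓝 0) := by
    have h1 : Tendsto (fun r : ℝ => r ^ N * Real.exp (-(1 / (4 * 𝔞)) * r)) atTop (𝓝 0) := by
      have := tendsto_rpow_mul_exp_neg_mul_atTop_nhds_zero N (1 / (4 * 𝔞)) (by positivity)
      simpa only [Real.rpow_natCast] using this
    have h2 := (h1.const_mul ((4 * Real.pi * 𝔞 * 1) ^ (-((N : ℝ) / 2)))).comp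
      (tendsto_norm_cobounded_atTop (E := Euc N))
    rw [mul_zero] at h2
    refine squeeze_zero' (Eventually.of_forall fun x => mul_nonneg (by positivity)
      (heatKernel_nonneg h𝔞.le zero_le_one x)) ?_ h2
    filter_upwards [(tendsto_norm_cobounded_atTop (E := Euc N)).eventually_ge_atTop 1] with x hx
    rw [finrank_euclideanSpace_fin, heatKernel_eq]
    simp only [Function.comp_apply]
    rw [mul_left_comm]
    refine mul_le_mul_of_nonneg_left (mul_le_mul_of_nonneg_left (Real.exp_le_exp.2 ?_)
      (by positivity)) (by positivity)
    have h3 : ‖x‖ ≤ ‖x‖ ^ 2 := by nlinarith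
    have h4 : 0 < 1 / (4 * 𝔞) := by positivity
    rw [mul_one]
    nlinarith
  -- The time `1 / (c² + 4𝔞)` is chosen so that the heat exponent is that of the rescaled unit-time
  -- kernel plus `-|y - x₀|²`. The extra Gaussian makes `V` integrable, and the mismatch of
  -- prefactors is `hratio`.
  have key := tendsto_integral_comp_smul_smul_of_integrable' (μ := (volume : Measure (Euc N)))
    (φ := fun x => heatKernel 𝔞 x 1) (heatKernel_nonneg h𝔞.le zero_le_one)
    (integral_heatKernel h𝔞 one_pos) hdecay (x₀ := x₀) hVi
    (Continuous.continuousAt (by fun_prop))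
  have hratio : Tendsto (fun c : ℝ => (1 + 4 * 𝔞 * (c ^ 2)⁻¹) ^ ((N : ℝ) / 2)) atTop (𝓝 1) := by
    have h1 : Tendsto (fun c : ℝ => 1 + 4 * 𝔞 * (c ^ 2)⁻¹) atTop (𝓝 (1 + 4 * 𝔞 * 0)) :=
      ((tendsto_inv_atTop_zero.comp (tendsto_pow_atTop two_ne_zero)).const_mul _).const_add _
    have h2 := h1.rpow_const (p := (N : ℝ) / 2) (Or.inl (by norm_num))
    simpa using h2
  have h := hratio.mul key
  simp only [sub_self, norm_zero, ne_eq, OfNat.ofNat_ne_zero, not_false_eq_true, zero_pow,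
    neg_zero, Real.exp_zero, mul_one, one_mul] at h
  refine h.congr' ?_
  filter_upwards [eventually_gt_atTop 0] with c hc
  rw [← integral_const_mul]
  refine integral_congr_ae (ae_of_all _ fun y => ?_)
  simp only [heatKernel, heatProfile, smul_eq_mul, norm_smul, finrank_euclideanSpace_fin]
  rw [norm_sub_rev x₀ y, Real.norm_of_nonneg hc.le]
  have e1 : (4 * Real.pi * 𝔞 * (1 / (c ^ 2 + 4 * 𝔞))) ^ (-((N : ℝ) / 2)) =
      (1 + 4 * 𝔞 * (c ^ 2)⁻¹) ^ ((N : ℝ) / 2) * c ^ N *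
        (4 * Real.pi * 𝔞 * 1) ^ (-((N : ℝ) / 2)) := by
    have e2 : c ^ N = (c ^ 2) ^ ((N : ℝ) / 2) := by
      rw [← Real.rpow_natCast c 2, ← Real.rpow_mul hc.le, ← Real.rpow_natCast c N]
      congr 1
      push_cast
      ring
    rw [e2, ← Real.mul_rpow (by positivity) (by positivity), Real.rpow_neg (by positivity),
      Real.rpow_neg (by positivity), ← Real.inv_rpow (by positivity), ← Real.inv_rpow (by positivity),
      ← Real.mul_rpow (by positivity) (by positivity)]
    congr 1
    field_simp
  have e3 : -‖y - x₀‖ ^ 2 / (4 * 𝔞 * (1 / (c ^ 2 + 4 * 𝔞))) =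
      -(c * ‖y - x₀‖) ^ 2 / (4 * 𝔞 * 1) + -‖y - x₀‖ ^ 2 := by
    field_simp
    ring
  rw [e1, e3, Real.exp_add]
  ring

/-- Uniqueness for the heat equation: a solution is given by the heat kernel. -/
theorem IsHeatSolution.eq_integral (h𝔞 : 0 < 𝔞) (hU : IsHeatSolution 𝔞 f U)
    (hf : AEStronglyMeasurable f)
    (hfi : ∀ c, 0 < c → ∀ x₀ : Euc N, Integrable fun y => Real.exp (-c * ‖y - x₀‖ ^ 2) * f y)
    {T : ℝ} (hT : 0 < T) (x₀ : Euc N) : U x₀ T = ∫ y, heatKernel 𝔞 (x₀ - y) T * f y := by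
  have hVc := (hU.contDiff_space T hT).continuous
  have hi : Integrable fun y => U y T * Real.exp (-‖y - x₀‖ ^ 2) := by
    obtain ⟨_, _, h⟩ := hU.exists_integral_abs_mul_exp_le one_pos (show 0 < T + 1 by linarith)
    refine (h T ⟨hT, by linarith⟩ x₀).1.mono'
      (Continuous.aestronglyMeasurable (by fun_prop)) (ae_of_all _ fun y => ?_)
    rw [norm_mul, Real.norm_eq_abs, Real.norm_eq_abs, Real.abs_exp, neg_one_mul]
  -- In the conservation identity let the delay tend to `0`: the side of `U` concentrates at `x₀`,
  -- and the side of `f` converges by domination.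
  have h1 := tendsto_integral_mul_heatProfile h𝔞 hVc x₀ hi
  have hε : Tendsto (fun c : ℝ => 1 / (c ^ 2 + 4 * 𝔞)) atTop (𝓝 0) :=
    tendsto_const_nhds.div_atTop
      (tendsto_atTop_add_const_right _ _ (tendsto_pow_atTop two_ne_zero))
  have hpos : ∀ c : ℝ, 0 < 1 / (c ^ 2 + 4 * 𝔞) := fun c => by positivity
  have h2 : Tendsto (fun c : ℝ => ∫ y, f y * heatProfile N 𝔞 (T + 1 / (c ^ 2 + 4 * 𝔞))
      (‖y - x₀‖ ^ 2)) atTop (𝓝 (∫ y, f y * heatProfile N 𝔞 T (‖y - x₀‖ ^ 2))) := by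
    obtain ⟨K, hK, hprof⟩ := exists_one_add_mul_heatProfile_le N h𝔞 hT
      (show T ≤ T + 1 by linarith)
    set c := 1 / (8 * 𝔞 * (T + 1))
    refine tendsto_integral_filter_of_dominated_convergence
      (fun y => K * ‖Real.exp (-c * ‖y - x₀‖ ^ 2) * f y‖)
      (Eventually.of_forall fun s => hf.mul (Continuous.aestronglyMeasurable
        ((continuous_heatProfile N 𝔞 _).comp (by fun_prop)))) ?_
      ((hfi c (by positivity) x₀).norm.const_mul K) (ae_of_all _ fun y => ?_)
    · filter_upwards [hε.eventually_le_const one_pos] with b hb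
      refine ae_of_all _ fun y => ?_
      have hP := heatProfile_nonneg (N := N) h𝔞 (add_pos hT (hpos b)) (‖y - x₀‖ ^ 2)
      have hle := hprof (T + 1 / (b ^ 2 + 4 * 𝔞)) ⟨by linarith [hpos b], by linarith⟩
        (‖y - x₀‖ ^ 2) (by positivity)
      rw [norm_mul, norm_mul, Real.norm_eq_abs, Real.norm_eq_abs, Real.norm_eq_abs, Real.abs_exp,
        abs_of_nonneg hP]
      calc _ ≤ |f y| * (K * Real.exp (-c * ‖y - x₀‖ ^ 2)) := by
            refine mul_le_mul_of_nonneg_left (le_trans ?_ hle) (abs_nonneg _)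
            have : 0 ≤ ‖y - x₀‖ ^ 2 := by positivity
            nlinarith
        _ = _ := by ring
    · have h3 := (hasDerivAt_heatProfile_time N h𝔞 hT (‖y - x₀‖ ^ 2)).continuousAt.tendsto
      have h4 := hε.const_add T
      rw [add_zero] at h4
      exact (h3.comp h4).const_mul (f y)
  have h3 := h2.congr fun c => (hU.integral_mul_heatProfile h𝔞 hf hfi hT (hpos c) x₀).symm
  rw [tendsto_nhds_unique h1 h3]
  refine integral_congr_ae (ae_of_all _ fun y => ?_)
  simp only
  rw [heatKernel_eq_heatProfile, norm_sub_rev x₀ y]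
  ring

end HeatRepresentation

/-! ### Preparation of the datum and removal of the absorption -/

section Asymptotics

variable {N : ℕ} {J : Euc N → ℝ} {α A : ℝ} {u₀ f : Euc N → ℝ}

theorem exists_forall_ae_abs_sub_le
    (hlim : Tendsto (fun x => ‖x‖ ^ α * u₀ x) (cocompact (Euc N) ⊓ ae volume) (𝓝 A)) {ε : ℝ}
    (hε : 0 < ε) :
    ∃ R, 1 ≤ R ∧ ∀ᵐ y, R ≤ ‖y‖ → |u₀ y - A * ‖y‖ ^ (-α)| ≤ ε * ‖y‖ ^ (-α) := by
  have h := hlim.eventually (Metric.ball_mem_nhds A hε)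
  obtain ⟨s, hs, t, ht, h⟩ := eventually_inf.1 h
  obtain ⟨r, hr⟩ := Metric.closedBall_compl_subset_of_mem_cocompact hs 0
  refine ⟨max 1 (r + 1), le_max_left _ _, ?_⟩
  filter_upwards [ht] with y hy hyR
  have hy1 : 1 ≤ ‖y‖ := (le_max_left _ _).trans hyR
  have hyr : r < ‖y‖ := by linarith [(le_max_right 1 (r + 1)).trans hyR]
  have h1 := h y ⟨hr (by simpa using hyr), hy⟩
  rw [Real.dist_eq] at h1
  have hpos : 0 < ‖y‖ := by linarith
  have h2 : u₀ y - A * ‖y‖ ^ (-α) = (‖y‖ ^ α * u₀ y - A) * ‖y‖ ^ (-α) := by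
    rw [Real.rpow_neg hpos.le]
    have := Real.rpow_pos_of_pos hpos α
    field_simp
  rw [h2, abs_mul, abs_of_nonneg (Real.rpow_nonneg hpos.le _)]
  exact mul_le_mul_of_nonneg_right h1.le (Real.rpow_nonneg hpos.le _)

/-- A nonnegative bounded datum with algebraic decay has a representative for which all the bounds
hold everywhere. -/
theorem exists_representative [NeZero N] (hα : 0 < α) (hA : 0 < A) (hu : MemLp u₀ ∞ volume)
    (hu0 : ∀ᵐ x, 0 ≤ u₀ x)
    (hlim : Tendsto (fun x => ‖x‖ ^ α * u₀ x) (cocompact (Euc N) ⊓ ae volume) (𝓝 A)) :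
    ∃ f : Euc N → ℝ, Measurable f ∧ f =ᵐ[volume] u₀ ∧ (∀ y, 0 ≤ f y) ∧
      ∃ M, 0 ≤ M ∧ (∀ y, f y ≤ M) ∧ ∀ y, f y ≤ M * ‖y‖ ^ (-α) := by
  obtain ⟨R, hR1, hR⟩ := exists_forall_ae_abs_sub_le hlim one_pos
  have hR0 : 0 < R := by linarith
  set M₀ := (eLpNormEssSup u₀ volume).toReal
  have hM₀ : 0 ≤ M₀ := ENNReal.toReal_nonneg
  have hfin := hu.2
  rw [eLpNorm_exponent_top] at hfin
  have hMb : ∀ᵐ x, |u₀ x| ≤ M₀ := by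
    filter_upwards [ae_le_eLpNormEssSup (f := u₀) (μ := volume)] with x hx
    simpa using ENNReal.toReal_mono hfin.ne hx
  -- The summand `A + 1` bounds `|y|^α u₀` for `|y| ≥ R`, and `M₀ R^α` bounds it for `|y| < R`. As
  -- `R ≥ 1`, the same constant dominates the essential supremum.
  set M := A + 1 + M₀ * R ^ α with hM
  have hRα : 1 ≤ R ^ α := Real.one_le_rpow hR1 hα.le
  have hMM : M₀ ≤ M := by nlinarith
  set g := hu.1.mk u₀
  have hgm : Measurable g := hu.1.stronglyMeasurable_mk.measurable
  set S := {y | (0 ≤ g y ∧ g y ≤ M) ∧ g y ≤ M * ‖y‖ ^ (-α)} with hS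
  have hSm : MeasurableSet S :=
    ((measurableSet_le measurable_const hgm).inter (measurableSet_le hgm measurable_const)).inter
      (measurableSet_le hgm (by fun_prop))
  have hSae : ∀ᵐ y, y ∈ S := by
    have hne : ∀ᵐ y : Euc N, y ≠ 0 := by
      rw [ae_iff]
      simp
    filter_upwards [hu.1.ae_eq_mk, hMb, hu0, hR, hne] with y h1 h2 h3 h4 h5
    have hy : 0 < ‖y‖ := norm_pos_iff.2 h5
    have hyα := Real.rpow_pos_of_pos hy (-α)
    rw [abs_of_nonneg h3] at h2
    have h1' : g y = u₀ y := h1.symm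
    simp only [hS, mem_ofPred_eq]
    rw [h1']
    refine ⟨⟨h3, h2.trans hMM⟩, ?_⟩
    rcases le_or_gt R ‖y‖ with h | h
    · have := (abs_le.1 (h4 h)).2
      have h6 : 0 ≤ M₀ * R ^ α * ‖y‖ ^ (-α) := by positivity
      rw [hM, add_mul, add_mul]
      linarith
    · have h6 : 1 ≤ R ^ α * ‖y‖ ^ (-α) := by
        rw [Real.rpow_neg hy.le, ← div_eq_mul_inv, one_le_div (Real.rpow_pos_of_pos hy _)]
        exact Real.rpow_le_rpow hy.le h.le hα.le
      have h7 : 0 ≤ (A + 1) * ‖y‖ ^ (-α) := by positivity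
      have h8 : M₀ ≤ M₀ * (R ^ α * ‖y‖ ^ (-α)) := le_mul_of_one_le_right hM₀ h6
      rw [hM, add_mul]
      linarith
  have hM0 : 0 ≤ M := hM₀.trans hMM
  refine ⟨S.indicator g, hgm.indicator hSm, ?_, fun y => indicator_nonneg (fun y hy => hy.1.1) y,
    M, hM0, fun y => ?_, fun y => ?_⟩
  · filter_upwards [hSae, hu.1.ae_eq_mk] with y hy h1
    rw [indicator_of_mem hy]
    exact h1.symm
  · by_cases hy : y ∈ S
    · rw [indicator_of_mem hy]
      exact hy.1.2
    · rwa [indicator_of_notMem hy]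
  · by_cases hy : y ∈ S
    · rw [indicator_of_mem hy]
      exact hy.2
    · rw [indicator_of_notMem hy]
      positivity

theorem le_mul_norm_rpow_of_le {M β : ℝ} (hα : 0 < α) (hβ : β ≤ α) (hβ0 : 0 ≤ β) (hM : 0 ≤ M)
    (hfM : ∀ y, f y ≤ M) (hfα : ∀ y, f y ≤ M * ‖y‖ ^ (-α)) (y : Euc N) :
    f y ≤ M * ‖y‖ ^ (-β) := by
  rcases eq_or_ne y 0 with rfl | hy
  -- At the origin `0 ^ (-α) = 0` by convention, so the hypothesis forces `f 0 ≤ 0`.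
  · refine (hfα 0).trans ?_
    rw [norm_zero, Real.zero_rpow (by linarith), mul_zero]
    positivity
  have hy0 : 0 < ‖y‖ := norm_pos_iff.2 hy
  rcases le_total ‖y‖ 1 with h | h
  · exact (hfM y).trans (le_mul_of_one_le_right hM
      (Real.one_le_rpow_of_pos_of_le_one_of_nonpos hy0 h (by linarith)))
  · exact (hfα y).trans (mul_le_mul_of_nonneg_left
      (Real.rpow_le_rpow_of_exponent_le h (by linarith)) hM)

/-- Absorption is negligible for large times, up to the decay rate `t ^ (-N / 2)`. -/
theorem IsNonlocalAbsorptionSolution.exists_abs_sub_nonlocalEvol_le [NeZero N]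
    (hJ : IsDispersalKernel J) {p : ℝ} {u : Euc N → ℝ → ℝ}
    (hu : IsNonlocalAbsorptionSolution J p f u) (hα : 0 < α) (hαN : α ≤ N) (hp : 1 + 2 / α < p)
    (hf : Measurable f) (hf0 : ∀ y, 0 ≤ f y) {M : ℝ} (hM : 0 ≤ M) (hfM : ∀ y, f y ≤ M)
    (hfα : ∀ y, f y ≤ M * ‖y‖ ^ (-α)) {ε : ℝ} (hε : 0 < ε) :
    ∃ C, 0 < C ∧ ∀ᵐ x, ∀ t, 1 ≤ t →
      |u x t - nonlocalEvol J f x t| ≤ ε * nonlocalEvol J f x t + C * t ^ (-((N : ℝ) / 2)) := by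
  have hp1 : 1 < p := by
    have : 0 < 2 / α := by positivity
    linarith
  have hβ' : 2 / (p - 1) < α := by
    rw [div_lt_iff₀ (by linarith)]
    have : 2 / α < p - 1 := by linarith
    rw [div_lt_iff₀ hα] at this
    linarith
  -- A strictly smaller exponent than `α` keeps `β < N` also in the critical case, and `p > 1 + 2/α`
  -- leaves room for `β(p-1) > 2`.
  obtain ⟨β, hβ1, hβ2⟩ := exists_between hβ'
  have hβ0 : 0 < β := lt_trans (div_pos two_pos (by linarith)) hβ1
  have hβp : 2 < β * (p - 1) := (div_lt_iff₀ (by linarith)).1 hβ1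
  have hfβ := le_mul_norm_rpow_of_le hα hβ2.le hβ0.le hM hfM hfα
  obtain ⟨R, C, hC, h⟩ := hu.exists_nonlocalEvol_sub_le hJ hp1 hβ0 (hβ2.trans_le hαN) hβp hf hM
    hf0 hfM hM hfβ hε
  obtain ⟨D, hD, hb⟩ := exists_nonlocalEvol_indicator_ball_le hJ hM hf0 hfM R
  refine ⟨C * D, by positivity, ?_⟩
  filter_upwards [h, hu.le_nonlocalEvol hJ hf hf0 hfM] with x h1 h2 t ht
  have ht0 : 0 ≤ t := by linarith
  have hv := nonlocalEvol_nonneg hJ hf0 ht0 x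
  have h3 := mul_le_mul_of_nonneg_left (hb t ht x) hC.le
  rw [abs_sub_comm, abs_of_nonneg (sub_nonneg.2 (h2 t ht0)), mul_assoc]
  linarith [h1 t ht0]

/-- Restricting a measure can only decrease an essential supremum, so a bound on the whole space
suffices for any family of sets. -/
theorem tendsto_ofReal_mul_eLpNorm_top {w : ℝ → ℝ} {g : Euc N → ℝ → ℝ} (S : ℝ → Set (Euc N))
    (h : ∀ δ, 0 < δ → ∀ᶠ t in atTop, 0 ≤ w t ∧ ∀ᵐ x, w t * |g x t| ≤ δ) :
    Tendsto (fun t => ENNReal.ofReal (w t) *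
      eLpNorm (fun x => g x t) ∞ (volume.restrict (S t))) atTop (𝓝 0) := by
  rw [ENNReal.tendsto_nhds_zero]
  intro δ hδ
  obtain ⟨δ', hδ'0, hδ'⟩ : ∃ δ' : ℝ, 0 < δ' ∧ ENNReal.ofReal δ' ≤ δ := by
    rcases eq_or_ne δ ∞ with rfl | htop
    · exact ⟨1, one_pos, le_top⟩
    · exact ⟨δ.toReal, ENNReal.toReal_pos hδ.ne' htop, ENNReal.ofReal_toReal_le⟩
  filter_upwards [h δ' hδ'0] with t ⟨hw, ht⟩
  rcases hw.eq_or_lt with hw0 | hw0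
  · rw [← hw0]
    simp
  refine le_trans ?_ hδ'
  have h1 : eLpNorm (fun x => g x t) ∞ (volume.restrict (S t)) ≤ ENNReal.ofReal (δ' / w t) := by
    rw [eLpNorm_exponent_top]
    refine eLpNormEssSup_le_of_ae_bound (ae_restrict_of_ae ?_)
    filter_upwards [ht] with x hx
    rw [le_div_iff₀ hw0, mul_comm]
    exact hx
  calc _ ≤ ENNReal.ofReal (w t) * ENNReal.ofReal (δ' / w t) := by gcongr
    _ = ENNReal.ofReal δ' := by
      rw [← ENNReal.ofReal_mul hw, mul_div_cancel₀ _ hw0.ne']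

theorem abs_heatKernel_sub_le {a t : ℝ} (ha : 0 < a) (ht : 0 < t) (z w : Euc N) :
    |heatKernel a z t - heatKernel a w t| ≤
      (4 * Real.pi * a * t) ^ (-((N : ℝ) / 2)) * √(1 / (4 * a * t)) * ‖z - w‖ := by
  have hpi := Real.pi_pos
  set b := 1 / (4 * a * t) with hb
  have hb0 : 0 < b := by positivity
  have hd : ∀ r ∈ (univ : Set ℝ), HasDerivWithinAt (fun r => Real.exp (-b * r ^ 2))
      (Real.exp (-b * r ^ 2) * (-b * (2 * r))) univ r := fun r _ => by
    have h1 := (((hasDerivAt_id r).pow 2).const_mul (-b)).exp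
    refine (h1.congr_deriv ?_).hasDerivWithinAt
    simp
  have hbd : ∀ r ∈ (univ : Set ℝ), ‖Real.exp (-b * r ^ 2) * (-b * (2 * r))‖ ≤ √b := fun r _ => by
    rw [norm_mul, Real.norm_eq_abs, Real.norm_eq_abs, Real.abs_exp]
    set s := √b with hs
    have hs0 : 0 < s := Real.sqrt_pos.2 hb0
    have hsb : b = s ^ 2 := (Real.sq_sqrt hb0.le).symm
    rw [hsb]
    have h1 : |-s ^ 2 * (2 * r)| = s * (2 * (s * |r|)) := by
      rw [abs_mul, abs_neg, abs_mul, abs_of_pos (by positivity : 0 < s ^ 2), abs_two]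
      ring
    -- With `X = s|r|` this is `2X ≤ 1 + X² ≤ e^{X²}`.
    have h2 : 2 * (s * |r|) ≤ Real.exp (s ^ 2 * r ^ 2) := by
      have h3 := Real.add_one_le_exp (s ^ 2 * r ^ 2)
      have h4 : s ^ 2 * r ^ 2 = (s * |r|) ^ 2 := by rw [mul_pow, sq_abs]
      nlinarith [sq_nonneg (s * |r| - 1)]
    rw [h1, show -s ^ 2 * r ^ 2 = -(s ^ 2 * r ^ 2) by ring, Real.exp_neg, inv_mul_eq_div,
      div_le_iff₀ (Real.exp_pos _)]
    exact mul_le_mul_of_nonneg_left h2 hs0.le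
  have hmv := convex_univ.norm_image_sub_le_of_norm_hasDerivWithin_le hd hbd (mem_univ ‖w‖)
    (mem_univ ‖z‖)
  rw [heatKernel_eq, heatKernel_eq, ← mul_sub, abs_mul, abs_of_nonneg (by positivity),
    mul_assoc (_ ^ (-((N : ℝ) / 2)))]
  refine mul_le_mul_of_nonneg_left (hmv.trans ?_) (by positivity)
  exact mul_le_mul_of_nonneg_left (abs_norm_sub_norm_le z w) (Real.sqrt_nonneg _)

end Asymptotics

/-! ### The case `α < N` -/

section SubcriticalDecay

variable {N : ℕ} {J : Euc N → ℝ} {α A M : ℝ} {f : Euc N → ℝ}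

/-- The kernel difference is `O(t^{-N/2-1})` in sup norm and at most `2` in `L¹`. The cut radius
`t^{1/2+1/N}` balances these two bounds and gains `t^{-α/N}` over the size of the solution. -/
theorem exists_integral_abs_kernel_sub_mul_le [NeZero N] (hJ : IsDispersalKernel J) (hα : 0 < α)
    (hαN : α < N) (hf : Measurable f) (hM : 0 ≤ M) (hf0 : ∀ y, 0 ≤ f y)
    (hfα : ∀ y, f y ≤ M * ‖y‖ ^ (-α)) :
    ∃ C, 0 ≤ C ∧ ∀ t, 1 ≤ t → ∀ x, ∫ y, |nonlocalKernel J t (x - y) -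
      heatKernel (diffusivity J) (x - y) t| * f y ≤ C * t ^ (-(α / 2) - α / N) := by
  obtain ⟨C, hC, h⟩ := exists_abs_nonlocalKernel_sub_heatKernel_le hJ
  have hb := ballRpowConst_nonneg N α
  have ha := diffusivity_pos hJ
  have hN : (0 : ℝ) < N := hα.trans hαN
  refine ⟨M * (C * ballRpowConst N α + 2), by positivity, fun t ht x => ?_⟩
  have ht0 : 0 < t := by linarith
  have hki := integrable_nonlocalKernel hJ ht0.le
  have hGi := integrable_heatKernel (N := N) ha ht0
  have hI : ∫ x, |nonlocalKernel J t x - heatKernel (diffusivity J) x t| ≤ 2 := by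
    calc _ ≤ ∫ x, (nonlocalKernel J t x + heatKernel (diffusivity J) x t) := by
          refine integral_mono (hki.sub hGi).abs (hki.add hGi) fun x => ?_
          have h1 := nonlocalKernel_nonneg hJ ht0.le x
          have h2 := heatKernel_nonneg ha.le ht0.le x
          exact abs_le.2 ⟨by linarith, by linarith⟩
      _ ≤ 2 := by
          rw [integral_add hki hGi, integral_heatKernel ha ht0]
          linarith [integral_nonlocalKernel_le_one hJ ht0.le]
  have hmain := integral_sub_mul_le_of_le_rpow
    (κ := fun z => |nonlocalKernel J t z - heatKernel (diffusivity J) z t|) hα.le hαN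
    (fun _ => abs_nonneg _) (h t ht) (hki.sub hGi).abs hI hf hM hf0 hfα
    (R := t ^ ((1 : ℝ) / 2 + 1 / N)) (Real.rpow_pos_of_pos ht0 _) x
  refine hmain.trans (le_of_eq ?_)
  rw [← Real.rpow_mul ht0.le, ← Real.rpow_mul ht0.le, mul_right_comm C, mul_assoc (C * _),
    ← Real.rpow_add ht0, mul_assoc M, add_mul]
  congr 4
  field_simp
  ring_nf

/-- Far out, the two data differ by `ε |y|^{-α}`, whose heat flow is at most a multiple of `ε
t^{-α/2}`. Near the origin the difference has finite mass because `α < N`, and spreads at rate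
`t^{-N/2}`. -/
theorem exists_integral_heatKernel_mul_abs_sub_le [NeZero N] {a : ℝ} (ha : 0 < a) (hα : 0 < α)
    (hαN : α < N) (hA : 0 < A) (hM : 0 ≤ M) (hf0 : ∀ y, 0 ≤ f y)
    (hfα : ∀ y, f y ≤ M * ‖y‖ ^ (-α))
    (happ : ∀ ε, 0 < ε → ∃ R, 1 ≤ R ∧
      ∀ᵐ y, R ≤ ‖y‖ → |f y - A * ‖y‖ ^ (-α)| ≤ ε * ‖y‖ ^ (-α)) {δ : ℝ} (hδ : 0 < δ) :
    ∃ C, 0 ≤ C ∧ ∀ t, 0 < t → ∀ x, ∫ y, heatKernel a (x - y) t * |f y - A * ‖y‖ ^ (-α)| ≤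
      δ * t ^ (-(α / 2)) + C * t ^ (-((N : ℝ) / 2)) := by
  have hpi := Real.pi_pos
  set c := (4 * Real.pi * a) ^ (-((N : ℝ) / 2))
  have hc : 0 ≤ c := by positivity
  set b := ballRpowConst N α
  have hb : 0 ≤ b := ballRpowConst_nonneg N α
  set ε := δ / (c * b + 1) with hε
  have hε0 : 0 < ε := by positivity
  have hεδ : ε * (c * b + 1) = δ := div_mul_cancel₀ _ (by positivity)
  obtain ⟨R, hR1, hR⟩ := happ ε hε0
  have hR0 : 0 < R := by linarith
  refine ⟨c * (M + A) * (b * R ^ ((N : ℝ) - α)), by positivity, fun t ht x => ?_⟩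
  set ind := (Metric.ball (0 : Euc N) R).indicator fun y => ‖y‖ ^ (-α)
  have hindi : Integrable ind := integrable_indicator_norm_rpow hαN R
  have hGle : ∀ z : Euc N, heatKernel a z t ≤ c * t ^ (-((N : ℝ) / 2)) := heatKernel_le ha ht
  have hG0 : ∀ z : Euc N, 0 ≤ heatKernel a z t := heatKernel_nonneg ha.le ht.le
  have hm : Measurable fun y : Euc N => ε * ‖y‖ ^ (-α) := by fun_prop
  have hm0 : ∀ y : Euc N, 0 ≤ ε * ‖y‖ ^ (-α) := fun y => by positivity
  have hi1 := integrable_sub_mul_of_le_rpow (κ := fun z : Euc N => heatKernel a z t) hα.le hαN hG0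
    hGle (integrable_heatKernel ha ht) hm hε0.le hm0 (fun _ => le_rfl) x
  have h1 := integral_sub_mul_le_of_le_rpow (κ := fun z : Euc N => heatKernel a z t) hα.le hαN hG0
    hGle (integrable_heatKernel ha ht) (integral_heatKernel ha ht).le hm hε0.le hm0
    (fun _ => le_rfl) (Real.sqrt_pos.2 ht) x
  have hi2 : Integrable fun y => c * t ^ (-((N : ℝ) / 2)) * (M + A) * ind y := hindi.const_mul _
  have hle : ∀ᵐ y, heatKernel a (x - y) t * |f y - A * ‖y‖ ^ (-α)| ≤
      heatKernel a (x - y) t * (ε * ‖y‖ ^ (-α)) +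
        c * t ^ (-((N : ℝ) / 2)) * (M + A) * ind y := by
    filter_upwards [hR] with y hy
    have hyα : 0 ≤ ‖y‖ ^ (-α) := by positivity
    have hind0 : 0 ≤ ind y := indicator_nonneg (fun y _ => by positivity) y
    rcases le_or_gt R ‖y‖ with h | h
    · have := mul_le_mul_of_nonneg_left (hy h) (hG0 (x - y))
      have h2 : 0 ≤ c * t ^ (-((N : ℝ) / 2)) * (M + A) * ind y := by positivity
      linarith
    · have hi : ind y = ‖y‖ ^ (-α) := indicator_of_mem (by simpa using h) _
      have h3 : |f y - A * ‖y‖ ^ (-α)| ≤ (M + A) * ‖y‖ ^ (-α) := by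
        rw [add_mul]
        have := mul_nonneg hA.le hyα
        have := mul_nonneg hM hyα
        exact abs_le.2 ⟨by linarith [hf0 y], by linarith [hfα y]⟩
      have h4 := mul_le_mul (hGle (x - y)) h3 (abs_nonneg _) (by positivity)
      have h5 := mul_nonneg (hG0 (x - y)) (hm0 y)
      rw [hi, mul_assoc (c * _)]
      linarith
  calc _ ≤ ∫ y, (heatKernel a (x - y) t * (ε * ‖y‖ ^ (-α)) +
        c * t ^ (-((N : ℝ) / 2)) * (M + A) * ind y) :=
        integral_mono_of_nonneg (ae_of_all _ fun y => mul_nonneg (hG0 _) (abs_nonneg _))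
          (hi1.add hi2) hle
    _ ≤ ε * (c * t ^ (-((N : ℝ) / 2)) * b * √t ^ ((N : ℝ) - α) + 1 * √t ^ (-α)) +
        c * t ^ (-((N : ℝ) / 2)) * (M + A) * (b * R ^ ((N : ℝ) - α)) := by
        rw [integral_add hi1 hi2, integral_const_mul]
        refine add_le_add h1 (le_of_eq ?_)
        rw [integral_indicator_norm_rpow α hR0]
    _ = _ := by
        have e1 : √t ^ (-α) = t ^ (-(α / 2)) := by
          rw [Real.sqrt_eq_rpow, ← Real.rpow_mul ht.le]
          congr 1
          ring
        have e2 := sqrt_rpow_mul_rpow (N := N) ht α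
        rw [e1, ← hεδ]
        linear_combination ε * c * b * e2

/-- For `α < N` the linear nonlocal evolution of an algebraically decaying datum is asymptotic to
the heat flow of the homogeneous datum `A |x| ^ (-α)`. -/
theorem eventually_rpow_mul_abs_nonlocalEvol_sub_le [NeZero N] (hJ : IsDispersalKernel J)
    (hα : 0 < α) (hαN : α < N) (hA : 0 < A) (hf : Measurable f) (hM : 0 ≤ M) (hf0 : ∀ y, 0 ≤ f y)
    (hfM : ∀ y, f y ≤ M) (hfα : ∀ y, f y ≤ M * ‖y‖ ^ (-α))
    (happ : ∀ ε, 0 < ε → ∃ R, 1 ≤ R ∧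
      ∀ᵐ y, R ≤ ‖y‖ → |f y - A * ‖y‖ ^ (-α)| ≤ ε * ‖y‖ ^ (-α)) {δ : ℝ} (hδ : 0 < δ) :
    ∀ᶠ t : ℝ in atTop, ∀ x, t ^ (α / 2) * |nonlocalEvol J f x t -
      ∫ y, heatKernel (diffusivity J) (x - y) t * (A * ‖y‖ ^ (-α))| ≤ δ := by
  have ha := diffusivity_pos hJ
  obtain ⟨C₁, hC₁, h1⟩ := exists_integral_abs_kernel_sub_mul_le hJ hα hαN hf hM hf0 hfα
  obtain ⟨C₂, hC₂, h2⟩ := exists_integral_heatKernel_mul_abs_sub_le ha hα hαN hA hM hf0 hfα happ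
    (half_pos hδ)
  have hN : (0 : ℝ) < N := hα.trans hαN
  have hlim : Tendsto (fun t : ℝ => t ^ (α / 2) * Real.exp (-1 * t) * M + C₁ * t ^ (-(α / N)) +
      (δ / 2 + C₂ * t ^ (-(((N : ℝ) - α) / 2)))) atTop
      (𝓝 (0 * M + C₁ * 0 + (δ / 2 + C₂ * 0))) :=
    (((tendsto_rpow_mul_exp_neg_mul_atTop_nhds_zero _ 1 one_pos).mul_const M).add
      ((tendsto_rpow_neg_atTop (by positivity)).const_mul C₁)).add
      (((tendsto_rpow_neg_atTop (by linarith)).const_mul C₂).const_add _)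
  filter_upwards [hlim.eventually_le_const (show _ < δ by linarith), eventually_ge_atTop 1] with
    t htδ ht x
  refine le_trans ?_ htδ
  have ht0 : 0 < t := by linarith
  have hki := integrable_nonlocalKernel hJ ht0.le
  have hGi := integrable_heatKernel (N := N) ha ht0
  obtain ⟨D, _, hD⟩ := exists_nonlocalKernel_le hJ
  have hG0 : ∀ z : Euc N, 0 ≤ heatKernel (diffusivity J) z t := heatKernel_nonneg ha.le ht0.le
  have hik := integrable_sub_mul_of_le_rpow (κ := nonlocalKernel J t) hα.le hαN
    (nonlocalKernel_nonneg hJ ht0.le) (hD t ht) hki hf hM hf0 hfα x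
  have hiG := integrable_sub_mul_of_le_rpow (κ := fun z : Euc N => heatKernel (diffusivity J) z t)
    hα.le hαN hG0 (heatKernel_le ha ht0) hGi hf hM hf0 hfα x
  have hiA := integrable_sub_mul_of_le_rpow (κ := fun z : Euc N => heatKernel (diffusivity J) z t)
    (f := fun y => A * ‖y‖ ^ (-α)) hα.le hαN hG0 (heatKernel_le ha ht0) hGi (by fun_prop) hA.le
    (fun y => by positivity) (fun _ => le_rfl) x
  -- Three errors: the undispersed mass `e^{-t} f`, the replacement of the kernel, and the
  -- replacement of the datum.
  have hdec : nonlocalEvol J f x t -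
      ∫ y, heatKernel (diffusivity J) (x - y) t * (A * ‖y‖ ^ (-α)) =
      Real.exp (-t) * f x +
      (∫ y, (nonlocalKernel J t (x - y) - heatKernel (diffusivity J) (x - y) t) * f y) +
      ∫ y, heatKernel (diffusivity J) (x - y) t * (f y - A * ‖y‖ ^ (-α)) := by
    simp only [sub_mul, mul_sub]
    rw [integral_sub hik hiG, integral_sub hiG hiA, nonlocalEvol]
    ring
  have e1 : |Real.exp (-t) * f x| ≤ Real.exp (-t) * M := by
    rw [abs_of_nonneg (mul_nonneg (Real.exp_pos _).le (hf0 x))]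
    exact mul_le_mul_of_nonneg_left (hfM x) (Real.exp_pos _).le
  have e2 : |∫ y, (nonlocalKernel J t (x - y) - heatKernel (diffusivity J) (x - y) t) * f y| ≤
      C₁ * t ^ (-(α / 2) - α / N) := by
    refine (abs_integral_le_integral_abs).trans (le_trans (le_of_eq ?_) (h1 t ht x))
    simp only [abs_mul, abs_of_nonneg (hf0 _)]
  have e3 : |∫ y, heatKernel (diffusivity J) (x - y) t * (f y - A * ‖y‖ ^ (-α))| ≤
      δ / 2 * t ^ (-(α / 2)) + C₂ * t ^ (-((N : ℝ) / 2)) := by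
    refine (abs_integral_le_integral_abs).trans (le_trans (le_of_eq ?_) (h2 t ht0 x))
    simp only [abs_mul, abs_of_nonneg (hG0 _)]
  rw [hdec]
  calc _ ≤ t ^ (α / 2) * (Real.exp (-t) * M + C₁ * t ^ (-(α / 2) - α / N) +
        (δ / 2 * t ^ (-(α / 2)) + C₂ * t ^ (-((N : ℝ) / 2)))) := by
        refine mul_le_mul_of_nonneg_left ?_ (by positivity)
        exact (abs_add_le _ _).trans (add_le_add ((abs_add_le _ _).trans (add_le_add e1 e2)) e3)
    _ = t ^ (α / 2) * Real.exp (-1 * t) * M + C₁ * (t ^ (α / 2) * t ^ (-(α / 2) - α / N)) +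
        (δ / 2 * (t ^ (α / 2) * t ^ (-(α / 2))) +
          C₂ * (t ^ (α / 2) * t ^ (-((N : ℝ) / 2)))) := by
        rw [neg_one_mul]
        ring
    _ = _ := by
        rw [← Real.rpow_add ht0, ← Real.rpow_add ht0, ← Real.rpow_add ht0, add_neg_cancel,
          Real.rpow_zero, mul_one]
        congr 4
        · ring
        · ring

/-- The linear evolution is `O(t^{-α/2})`, so an `ε`-fraction of it lost by absorption is harmless,
and the compact part decays faster since `α < N`. -/
theorem IsNonlocalAbsorptionSolution.eventually_rpow_mul_abs_sub_le [NeZero N]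
    (hJ : IsDispersalKernel J) {p : ℝ} {u U : Euc N → ℝ → ℝ}
    (hu : IsNonlocalAbsorptionSolution J p f u) (hα : 0 < α) (hαN : α < N) (hp : 1 + 2 / α < p)
    (hA : 0 < A) (hf : Measurable f) (hM : 0 ≤ M) (hf0 : ∀ y, 0 ≤ f y)
    (hfM : ∀ y, f y ≤ M) (hfα : ∀ y, f y ≤ M * ‖y‖ ^ (-α))
    (happ : ∀ ε, 0 < ε → ∃ R, 1 ≤ R ∧
      ∀ᵐ y, R ≤ ‖y‖ → |f y - A * ‖y‖ ^ (-α)| ≤ ε * ‖y‖ ^ (-α))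
    (hU : IsHeatSolution (diffusivity J) (fun x => A / ‖x‖ ^ α) U) {δ : ℝ} (hδ : 0 < δ) :
    ∀ᶠ t : ℝ in atTop, ∀ᵐ x, t ^ (α / 2) * |u x t - U x t| ≤ δ := by
  have ha := diffusivity_pos hJ
  have hAeq : (fun x : Euc N => A / ‖x‖ ^ α) = fun x => A * ‖x‖ ^ (-α) := funext fun x => by
    rw [Real.rpow_neg (norm_nonneg _), div_eq_mul_inv]
  rw [hAeq] at hU
  have hfm : Measurable fun x : Euc N => A * ‖x‖ ^ (-α) := by fun_prop
  have hfi : ∀ c, 0 < c → ∀ x₀ : Euc N,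
      Integrable fun y => Real.exp (-c * ‖y - x₀‖ ^ 2) * (A * ‖y‖ ^ (-α)) := fun c hc x₀ => by
    have := integrable_sub_mul_of_le_rpow (κ := fun z : Euc N => Real.exp (-c * ‖z‖ ^ 2)) (S := 1)
      hα.le hαN (fun _ => (Real.exp_pos _).le) (fun z => Real.exp_le_one_iff.2 (by
        have : 0 ≤ c * ‖z‖ ^ 2 := by positivity
        linarith)) (integrable_exp_neg_mul_norm_sq hc) hfm hA.le (fun y => by positivity)
      (fun _ => le_rfl) x₀
    simpa only [norm_sub_rev x₀] using this
  obtain ⟨D, hD, hv⟩ := exists_nonlocalEvol_le hJ hα hαN hf hM hf0 hfM hM hfα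
  obtain ⟨C, hC, hcmp⟩ := hu.exists_abs_sub_nonlocalEvol_le hJ hα hαN.le hp hf hf0 hM hfM hfα
    (show 0 < δ / 4 / D by positivity)
  have hlim : Tendsto (fun t : ℝ => C * t ^ (-(((N : ℝ) - α) / 2))) atTop (𝓝 (C * 0)) :=
    (tendsto_rpow_neg_atTop (by linarith)).const_mul C
  rw [mul_zero] at hlim
  filter_upwards [eventually_rpow_mul_abs_nonlocalEvol_sub_le hJ hα hαN hA hf hM hf0 hfM hfα happ
    (half_pos hδ), hlim.eventually_le_const (show 0 < δ / 4 by positivity),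
    eventually_ge_atTop 1] with t h1 h2 ht
  have ht0 : 0 < t := by linarith
  filter_upwards [hcmp] with x hx
  have hrep := hU.eq_integral ha hfm.aestronglyMeasurable hfi ht0 x
  have h3 := h1 x
  rw [← hrep] at h3
  have hvt : nonlocalEvol J f x t ≤ D * t ^ (-(α / 2)) :=
    (hv t ht0.le x).trans (mul_le_mul_of_nonneg_left
      (Real.rpow_le_rpow_of_nonpos ht0 (by linarith) (by linarith)) hD.le)
  have h4 : t ^ (α / 2) * |u x t - nonlocalEvol J f x t| ≤ δ / 4 + δ / 4 := by
    calc _ ≤ t ^ (α / 2) * (δ / 4 / D * (D * t ^ (-(α / 2))) + C * t ^ (-((N : ℝ) / 2))) := by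
          refine mul_le_mul_of_nonneg_left ((hx t ht).trans ?_) (by positivity)
          gcongr
      _ = δ / 4 * (t ^ (α / 2) * t ^ (-(α / 2))) +
          C * (t ^ (α / 2) * t ^ (-((N : ℝ) / 2))) := by
          field_simp
      _ = δ / 4 + C * t ^ (-(((N : ℝ) - α) / 2)) := by
          rw [← Real.rpow_add ht0, ← Real.rpow_add ht0, add_neg_cancel, Real.rpow_zero, mul_one]
          congr 3
          ring
      _ ≤ _ := by linarith
  calc _ ≤ t ^ (α / 2) * (|u x t - nonlocalEvol J f x t| + |nonlocalEvol J f x t - U x t|) :=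
        mul_le_mul_of_nonneg_left (abs_sub_le _ _ _) (by positivity)
    _ ≤ δ := by
        rw [mul_add]
        linarith

end SubcriticalDecay

/-! ### The case `α = N` and the final statement -/

section CriticalDecay

variable {N : ℕ} {J : Euc N → ℝ} {A M : ℝ} {f : Euc N → ℝ}

theorem integrable_indicator_ball (hf : Measurable f) (hf0 : ∀ y, 0 ≤ f y) (hfM : ∀ y, f y ≤ M)
    (R : ℝ) : Integrable ((Metric.ball (0 : Euc N) R).indicator f) := by
  refine (integrable_indicator_iff measurableSet_ball).2
    (Measure.integrableOn_of_bounded measure_ball_lt_top.ne hf.aestronglyMeasurable (M := M)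
      (ae_of_all _ fun y => ?_))
  rw [Real.norm_of_nonneg (hf0 y)]
  exact hfM y

/-- The mass of a datum asymptotic to `A |x| ^ (-N)` in large balls grows logarithmically. -/
theorem tendsto_integral_ball_div_log [NeZero N] (hf : Measurable f) (hM : 0 ≤ M)
    (hf0 : ∀ y, 0 ≤ f y) (hfM : ∀ y, f y ≤ M)
    (happ : ∀ ε, 0 < ε → ∃ R, 1 ≤ R ∧
      ∀ᵐ y, R ≤ ‖y‖ → |f y - A * ‖y‖ ^ (-(N : ℝ))| ≤ ε * ‖y‖ ^ (-(N : ℝ))) :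
    Tendsto (fun t : ℝ => (∫ y, (Metric.ball (0 : Euc N) √t).indicator f y) / Real.log t) atTop
      (𝓝 (A * N * volume.real (Metric.ball (0 : Euc N) 1) / 2)) := by
  set μ₁ := volume.real (Metric.ball (0 : Euc N) 1) with hμ
  have hμ0 : 0 ≤ μ₁ := measureReal_nonneg
  have hN : (0 : ℝ) < N := Nat.cast_pos.2 (NeZero.pos N)
  rw [Metric.tendsto_nhds]
  intro δ hδ
  set ε := δ / (N * μ₁ + 1) with hε
  have hε0 : 0 < ε := by positivity
  have hεδ : ε * (N * μ₁ + 1) = δ := div_mul_cancel₀ _ (by positivity)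
  obtain ⟨R, hR1, hR⟩ := happ ε hε0
  have hR0 : 0 < R := by linarith
  have hlogR : 0 ≤ Real.log R := Real.log_nonneg hR1
  -- Everything that stays bounded as `t → ∞`: the mass inside radius `R`, and the `log R` missing
  -- from the annulus. The main term involves `log √t = (log t) / 2`.
  set D := M * volume.real (Metric.ball (0 : Euc N) R) + |A| * N * μ₁ * Real.log R with hD
  have hD0 : 0 ≤ D := by positivity
  filter_upwards [eventually_gt_atTop (R ^ 2), Real.tendsto_log_atTop.eventually_gt_atTop
    (2 * D / δ), Real.tendsto_log_atTop.eventually_gt_atTop 0] with t ht hlog hlog0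
  have hRt : R < √t := Real.lt_sqrt_of_sq_lt ht
  have ht0 : 0 < t := by nlinarith
  have hμ1 : 0 < μ₁ := by
    rw [hμ, measureReal_def]
    exact ENNReal.toReal_pos (Metric.measure_ball_pos _ _ one_pos).ne' measure_ball_lt_top.ne
  set ann : Euc N → ℝ := fun y => (Ico R √t).indicator (fun s : ℝ => s ^ (-(N : ℝ))) ‖y‖
  have hann := integral_annulus_norm_rpow (N := N) hR0 hRt.le
  have hlogq : 0 < Real.log (√t / R) := Real.log_pos ((one_lt_div hR0).2 hRt)
  have hanni : Integrable ann := Integrable.of_integral_ne_zero (by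
    rw [hann]
    positivity)
  have hlogeq : Real.log (√t / R) = Real.log t / 2 - Real.log R := by
    rw [Real.log_div (Real.sqrt_pos.2 ht0).ne' hR0.ne', Real.log_sqrt ht0.le]
  set g := ∫ y, (Metric.ball (0 : Euc N) √t).indicator f y
  have hfi := integrable_indicator_ball (N := N) hf hf0 hfM √t
  have hbi : Integrable ((Metric.ball (0 : Euc N) R).indicator fun _ => M) :=
    integrable_indicator_ball measurable_const (fun _ => hM) (fun _ => le_rfl) R
  have hpt : ∀ᵐ y, ‖(Metric.ball (0 : Euc N) √t).indicator f y - A * ann y‖ ≤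
      (Metric.ball (0 : Euc N) R).indicator (fun _ => M) y + ε * ann y := by
    filter_upwards [hR] with y hy
    rcases lt_or_ge ‖y‖ R with h | h
    · have h1 : ann y = 0 := indicator_of_notMem (fun h' => absurd h'.1 (not_le.2 h)) _
      rw [h1, indicator_of_mem (by simpa using h.trans hRt), indicator_of_mem (by simpa using h)]
      simpa [abs_of_nonneg (hf0 y)] using hfM y
    · rcases lt_or_ge ‖y‖ √t with h' | h'
      · have h1 : ann y = ‖y‖ ^ (-(N : ℝ)) := indicator_of_mem (show ‖y‖ ∈ Ico R √t from ⟨h, h'⟩) _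
        rw [h1, indicator_of_mem (by simpa using h'), indicator_of_notMem (by simpa using h),
          zero_add]
        exact hy h
      · have h1 : ann y = 0 := indicator_of_notMem (fun h'' => absurd h''.2 (not_lt.2 h')) _
        rw [h1, indicator_of_notMem (by simpa using h'), indicator_of_notMem (by simpa using h)]
        simp
  have hball : ∫ y, (Metric.ball (0 : Euc N) R).indicator (fun _ => M) y =
      M * volume.real (Metric.ball (0 : Euc N) R) := by
    rw [integral_indicator measurableSet_ball, setIntegral_const, smul_eq_mul, mul_comm]
  have hmain := norm_integral_le_of_norm_le (hbi.add (hanni.const_mul ε)) hpt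
  rw [integral_sub hfi (hanni.const_mul A)] at hmain
  simp only [Pi.add_apply] at hmain
  rw [integral_add hbi (hanni.const_mul ε), integral_const_mul,
    integral_const_mul, hann, hball, hlogeq, ← hμ, Real.norm_eq_abs] at hmain
  rw [Real.dist_eq, div_sub' hlog0.ne', abs_div, abs_of_pos hlog0, div_lt_iff₀ hlog0]
  have h2 : |g - Real.log t * (A * N * μ₁ / 2)| ≤ D + ε * (N * μ₁) * (Real.log t / 2) := by
    have e1 : g - Real.log t * (A * N * μ₁ / 2) =
        (g - A * (N * μ₁ * (Real.log t / 2 - Real.log R))) + -(A * N * μ₁ * Real.log R) := by ring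
    have e2 : |-(A * N * μ₁ * Real.log R)| = |A| * N * μ₁ * Real.log R := by
      rw [abs_neg, abs_mul, abs_mul, abs_mul, abs_of_pos hN, abs_of_nonneg hμ0,
        abs_of_nonneg hlogR]
    rw [e1]
    refine (abs_add_le _ _).trans ?_
    have h3 : 0 ≤ ε * (N * μ₁) * Real.log R := by positivity
    rw [e2, hD]
    linarith
  have h3 : 2 * D < δ * Real.log t := by
    rw [div_lt_iff₀ hδ] at hlog
    linarith
  have h4 : ε * (N * μ₁) * Real.log t ≤ δ * Real.log t :=
    mul_le_mul_of_nonneg_right (by linarith) hlog0.le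
  linarith

/-- In the critical case the linear nonlocal evolution is, up to `O(t ^ (-N / 2))`, the heat kernel
times the mass of the datum in the ball of radius `√t`. -/
theorem exists_rpow_mul_abs_nonlocalEvol_sub_le [NeZero N] (hJ : IsDispersalKernel J)
    (hf : Measurable f) (hM : 0 ≤ M) (hf0 : ∀ y, 0 ≤ f y) (hfM : ∀ y, f y ≤ M)
    (hfN : ∀ y, f y ≤ M * ‖y‖ ^ (-(N : ℝ))) :
    ∃ C, 0 ≤ C ∧ ∀ t : ℝ, 1 ≤ t → ∀ x, t ^ ((N : ℝ) / 2) * |nonlocalEvol J f x t -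
      (∫ y, (Metric.ball (0 : Euc N) √t).indicator f y) * heatKernel (diffusivity J) x t| ≤ C := by
  have hpi := Real.pi_pos
  have ha := diffusivity_pos hJ
  set a := diffusivity J
  have hN1 : (1 : ℝ) ≤ N := Nat.one_le_cast.2 (NeZero.pos N)
  have hN : (0 : ℝ) < N := by linarith
  obtain ⟨C₁, hC₁, h1⟩ := exists_abs_nonlocalKernel_sub_heatKernel_le hJ
  obtain ⟨C₂, hC₂, h2⟩ := exists_rpow_mul_exp_neg_le ((N : ℝ) / 2) one_pos
  set b := ballRpowConst N ((N : ℝ) - 1)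
  have hb : 0 ≤ b := ballRpowConst_nonneg _ _
  set c := (4 * Real.pi * a) ^ (-((N : ℝ) / 2))
  have hc : 0 ≤ c := by positivity
  set l := √(1 / (4 * a))
  refine ⟨C₂ * M + M + C₁ * (M * b) + c * l * (M * b), by positivity, fun t ht x => ?_⟩
  have ht0 : 0 < t := by linarith
  have hst : 0 < √t := Real.sqrt_pos.2 ht0
  have hki := integrable_nonlocalKernel hJ ht0.le
  have hk0 := nonlocalKernel_nonneg hJ ht0.le
  have hGi := integrable_heatKernel (N := N) ha ht0
  -- Cut at the diffusive scale. The outer part is at most `M t^{-N/2}` pointwise, hence so is its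
  -- evolution.
  set f₁ := (Metric.ball (0 : Euc N) √t).indicator f with hf₁
  set f₂ : Euc N → ℝ := fun y => f y - f₁ y with hf₂
  have hf₁m : Measurable f₁ := hf.indicator measurableSet_ball
  have hf₁0 : ∀ y, 0 ≤ f₁ y := fun y => indicator_nonneg (fun y _ => hf0 y) y
  have hf₁M : ∀ y, f₁ y ≤ f y := fun y => indicator_le_self' (fun y _ => hf0 y) y
  have hf₁i : Integrable f₁ := integrable_indicator_ball hf hf0 hfM _
  have hf₂0 : ∀ y, 0 ≤ f₂ y := fun y => sub_nonneg.2 (hf₁M y)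
  have hsq : √t ^ (-(N : ℝ)) = t ^ (-((N : ℝ) / 2)) := by
    rw [Real.sqrt_eq_rpow, ← Real.rpow_mul ht0.le]
    congr 1
    ring
  have hf₂M : ∀ y, f₂ y ≤ M * t ^ (-((N : ℝ) / 2)) := fun y => by
    by_cases hy : y ∈ Metric.ball (0 : Euc N) √t
    · simp only [hf₂, hf₁, indicator_of_mem hy, sub_self]
      positivity
    · simp only [hf₂, hf₁, indicator_of_notMem hy, sub_zero]
      rw [← hsq]
      refine (hfN y).trans (mul_le_mul_of_nonneg_left ?_ hM)
      exact Real.rpow_le_rpow_of_nonpos hst (by simpa using hy) (by linarith)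
  have hind := integrable_indicator_norm_rpow (N := N) (β := (N : ℝ) - 1) (by linarith) √t
  have hindI := integral_indicator_norm_rpow (N := N) ((N : ℝ) - 1) hst
  rw [sub_sub_cancel, Real.rpow_one] at hindI
  -- The weaker weight `|y|^{-(N-1)}` gives `√t` in place of the true `log t`. This suffices because
  -- the kernel error has a spare factor `1 / t`.
  have hmass : ∫ y, f₁ y ≤ M * b * √t := by
    calc _ ≤ ∫ y, M * (Metric.ball (0 : Euc N) √t).indicator
          (fun y => ‖y‖ ^ (-((N : ℝ) - 1))) y := by
          refine integral_mono hf₁i (hind.const_mul M) fun y => ?_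
          by_cases hy : y ∈ Metric.ball (0 : Euc N) √t
          · simp only [hf₁, indicator_of_mem hy]
            exact le_mul_norm_rpow_of_le hN (by linarith) (by linarith) hM hfM hfN y
          · simp only [hf₁, indicator_of_notMem hy, mul_zero, le_refl]
      _ = _ := by
          rw [integral_const_mul, hindI]
          ring
  have hmom : ∀ y, ‖y‖ * f₁ y ≤ M * (Metric.ball (0 : Euc N) √t).indicator
      (fun y => ‖y‖ ^ (-((N : ℝ) - 1))) y := fun y => by
    by_cases hy : y ∈ Metric.ball (0 : Euc N) √t
    · simp only [hf₁, indicator_of_mem hy]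
      rcases eq_or_ne y 0 with rfl | hy0
      · rw [norm_zero, zero_mul]
        positivity
      · have hyp : 0 < ‖y‖ := norm_pos_iff.2 hy0
        have e : ‖y‖ ^ (-((N : ℝ) - 1)) = ‖y‖ * ‖y‖ ^ (-(N : ℝ)) := by
          rw [neg_sub, sub_eq_add_neg, Real.rpow_add hyp, Real.rpow_one]
        rw [e, mul_left_comm]
        exact mul_le_mul_of_nonneg_left (hfN y) hyp.le
    · simp only [hf₁, indicator_of_notMem hy, mul_zero, le_refl]
  have hf₁b : ∀ᵐ y, |f₁ y| ≤ M := ae_of_all _ fun y => by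
    rw [abs_of_nonneg (hf₁0 y)]
    exact (hf₁M y).trans (hfM y)
  have hf₂b : ∀ᵐ y, |f₂ y| ≤ M * t ^ (-((N : ℝ) / 2)) := ae_of_all _ fun y => by
    rw [abs_of_nonneg (hf₂0 y)]
    exact hf₂M y
  have hik1 := integrable_sub_mul hki hf₁m.aestronglyMeasurable hf₁b x
  have hik2 := integrable_sub_mul (g := f₂) hki (hf.sub hf₁m).aestronglyMeasurable hf₂b x
  have hiG1 := integrable_sub_mul hGi hf₁m.aestronglyMeasurable hf₁b x
  have hiGx : Integrable fun y => heatKernel a x t * f₁ y := hf₁i.const_mul _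
  have hdec : nonlocalEvol J f x t - (∫ y, f₁ y) * heatKernel a x t =
      Real.exp (-t) * f x + (∫ y, nonlocalKernel J t (x - y) * f₂ y) +
      (∫ y, (nonlocalKernel J t (x - y) - heatKernel a (x - y) t) * f₁ y) +
      ∫ y, (heatKernel a (x - y) t - heatKernel a x t) * f₁ y := by
    have e1 : ∫ y, nonlocalKernel J t (x - y) * f y =
        (∫ y, nonlocalKernel J t (x - y) * f₁ y) + ∫ y, nonlocalKernel J t (x - y) * f₂ y := by
      rw [← integral_add hik1 hik2]
      refine integral_congr_ae (ae_of_all _ fun y => ?_)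
      simp only [hf₂]
      ring
    simp only [sub_mul]
    rw [integral_sub hik1 hiG1, integral_sub hiG1 hiGx, integral_const_mul, nonlocalEvol, e1]
    ring
  have b1 : |Real.exp (-t) * f x| ≤ Real.exp (-t) * M := by
    rw [abs_of_nonneg (mul_nonneg (Real.exp_pos _).le (hf0 x))]
    exact mul_le_mul_of_nonneg_left (hfM x) (Real.exp_pos _).le
  have b2 : |∫ y, nonlocalKernel J t (x - y) * f₂ y| ≤ M * t ^ (-((N : ℝ) / 2)) := by
    have hkx : Integrable fun y => nonlocalKernel J t (x - y) := hki.comp_sub_left x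
    calc _ ≤ ∫ y, nonlocalKernel J t (x - y) * (M * t ^ (-((N : ℝ) / 2))) := by
          rw [← Real.norm_eq_abs]
          refine norm_integral_le_of_norm_le (hkx.mul_const _) (ae_of_all _ fun y => ?_)
          rw [Real.norm_of_nonneg (mul_nonneg (hk0 _) (hf₂0 _))]
          exact mul_le_mul_of_nonneg_left (hf₂M y) (hk0 _)
      _ ≤ 1 * (M * t ^ (-((N : ℝ) / 2))) := by
          rw [integral_mul_const, integral_sub_left_eq]
          exact mul_le_mul_of_nonneg_right (integral_nonlocalKernel_le_one hJ ht0.le)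
            (by positivity)
      _ = _ := one_mul _
  have b3 : |∫ y, (nonlocalKernel J t (x - y) - heatKernel a (x - y) t) * f₁ y| ≤
      C₁ * t ^ (-((N : ℝ) / 2) - 1) * (M * b * √t) := by
    calc _ ≤ ∫ y, C₁ * t ^ (-((N : ℝ) / 2) - 1) * f₁ y := by
          rw [← Real.norm_eq_abs]
          refine norm_integral_le_of_norm_le (hf₁i.const_mul _) (ae_of_all _ fun y => ?_)
          rw [norm_mul, Real.norm_of_nonneg (hf₁0 y)]
          exact mul_le_mul_of_nonneg_right (h1 t ht _) (hf₁0 y)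
      _ ≤ _ := by
          rw [integral_const_mul]
          exact mul_le_mul_of_nonneg_left hmass (by positivity)
  have hlip : (4 * Real.pi * a * t) ^ (-((N : ℝ) / 2)) * √(1 / (4 * a * t)) =
      c * t ^ (-((N : ℝ) / 2)) * (l * (√t)⁻¹) := by
    rw [Real.mul_rpow (by positivity) ht0.le, ← Real.sqrt_inv, ← Real.sqrt_mul (by positivity)]
    congr 2
    rw [one_div, one_div, mul_inv]
  -- Moving the mass to the origin costs the Lipschitz constant, of order `t^{-N/2} t^{-1/2}`, times
  -- the first moment of `f₁`, which is only `O(√t)`.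
  have b4 : |∫ y, (heatKernel a (x - y) t - heatKernel a x t) * f₁ y| ≤
      c * t ^ (-((N : ℝ) / 2)) * (l * (√t)⁻¹) * (M * (b * √t)) := by
    calc _ ≤ ∫ y, c * t ^ (-((N : ℝ) / 2)) * (l * (√t)⁻¹) *
          (M * (Metric.ball (0 : Euc N) √t).indicator (fun y => ‖y‖ ^ (-((N : ℝ) - 1))) y) := by
          rw [← Real.norm_eq_abs]
          refine norm_integral_le_of_norm_le ((hind.const_mul M).const_mul _)
            (ae_of_all _ fun y => ?_)
          rw [norm_mul, Real.norm_of_nonneg (hf₁0 y)]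
          have h3 := abs_heatKernel_sub_le ha ht0 (x - y) x
          rw [hlip, sub_sub_cancel_left, norm_neg] at h3
          calc _ ≤ c * t ^ (-((N : ℝ) / 2)) * (l * (√t)⁻¹) * ‖y‖ * f₁ y :=
                mul_le_mul_of_nonneg_right h3 (hf₁0 y)
            _ = c * t ^ (-((N : ℝ) / 2)) * (l * (√t)⁻¹) * (‖y‖ * f₁ y) := by ring
            _ ≤ _ := mul_le_mul_of_nonneg_left (hmom y) (by positivity)
      _ = _ := by rw [integral_const_mul, integral_const_mul, hindI]
  rw [hdec]
  have hcancel : t ^ ((N : ℝ) / 2) * t ^ (-((N : ℝ) / 2)) = 1 := by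
    rw [← Real.rpow_add ht0, add_neg_cancel, Real.rpow_zero]
  have hexp := h2 t ht
  rw [one_mul] at hexp
  calc _ ≤ t ^ ((N : ℝ) / 2) * (Real.exp (-t) * M + M * t ^ (-((N : ℝ) / 2)) +
        C₁ * t ^ (-((N : ℝ) / 2) - 1) * (M * b * √t) +
        c * t ^ (-((N : ℝ) / 2)) * (l * (√t)⁻¹) * (M * (b * √t))) := by
        refine mul_le_mul_of_nonneg_left ?_ (by positivity)
        exact (abs_add_le _ _).trans (add_le_add ((abs_add_le _ _).trans (add_le_add
          ((abs_add_le _ _).trans (add_le_add b1 b2)) b3)) b4)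
    _ = t ^ ((N : ℝ) / 2) * Real.exp (-t) * M +
        (t ^ ((N : ℝ) / 2) * t ^ (-((N : ℝ) / 2))) * (M + C₁ * (M * b) * (√t / t) +
          c * l * (M * b) * ((√t)⁻¹ * √t)) := by
        rw [Real.rpow_sub_one ht0.ne']
        ring
    _ ≤ C₂ * M + 1 * (M + C₁ * (M * b) * 1 + c * l * (M * b) * 1) := by
        rw [hcancel, inv_mul_cancel₀ hst.ne']
        have h3 : √t / t ≤ 1 := by
          rw [div_le_one ht0]
          exact Real.sqrt_le_self_iff.2 (Or.inr ht)
        gcongr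
    _ = _ := by ring

/-- Division by `log t` eliminates the `O(t^{-N/2})` errors from the point-source approximation and
from the compact part, and turns the mass in the ball into the constant. -/
theorem IsNonlocalAbsorptionSolution.eventually_rpow_mul_abs_div_log_sub_le [NeZero N]
    (hJ : IsDispersalKernel J) {p : ℝ} {u : Euc N → ℝ → ℝ}
    (hu : IsNonlocalAbsorptionSolution J p f u) (hp : 1 + 2 / (N : ℝ) < p)
    (hf : Measurable f) (hM : 0 ≤ M) (hf0 : ∀ y, 0 ≤ f y)
    (hfM : ∀ y, f y ≤ M) (hfN : ∀ y, f y ≤ M * ‖y‖ ^ (-(N : ℝ)))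
    (happ : ∀ ε, 0 < ε → ∃ R, 1 ≤ R ∧
      ∀ᵐ y, R ≤ ‖y‖ → |f y - A * ‖y‖ ^ (-(N : ℝ))| ≤ ε * ‖y‖ ^ (-(N : ℝ))) {δ : ℝ}
    (hδ : 0 < δ) :
    ∀ᶠ t : ℝ in atTop, ∀ᵐ x, t ^ ((N : ℝ) / 2) * |u x t / Real.log t -
      A * N * volume.real (Metric.ball (0 : Euc N) 1) / 2 * heatKernel (diffusivity J) x t| ≤
      δ := by
  have hpi := Real.pi_pos
  have ha := diffusivity_pos hJ
  set a := diffusivity J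
  set C := A * N * volume.real (Metric.ball (0 : Euc N) 1) / 2
  have hN : (0 : ℝ) < N := Nat.cast_pos.2 (NeZero.pos N)
  obtain ⟨D, hD, hv⟩ := exists_rpow_mul_abs_nonlocalEvol_sub_le hJ hf hM hf0 hfM hfN
  set c := (4 * Real.pi * a) ^ (-((N : ℝ) / 2))
  have hc : 0 ≤ c := by positivity
  -- The rescaled linear evolution is eventually at most `δ + |C| c`, so the fraction `η` absorbed
  -- costs at most `δ / 3`.
  set η := δ / 3 / (δ + |C| * c + 1) with hη
  have hη0 : 0 < η := by positivity
  have hηδ : η * (δ + |C| * c + 1) = δ / 3 := div_mul_cancel₀ _ (by positivity)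
  obtain ⟨K, hK, hcmp⟩ := hu.exists_abs_sub_nonlocalEvol_le hJ hN le_rfl hp hf hf0 hM hfM hfN hη0
  have hlogt : Tendsto (fun t : ℝ => K / Real.log t) atTop (𝓝 0) :=
    tendsto_const_nhds.div_atTop Real.tendsto_log_atTop
  have hlin : Tendsto (fun t : ℝ => D / Real.log t +
      |(∫ y, (Metric.ball (0 : Euc N) √t).indicator f y) / Real.log t - C| * c) atTop (𝓝 0) := by
    have h1 := ((tendsto_integral_ball_div_log hf hM hf0 hfM happ).sub_const C).abs.mul_const c
    have h2 : Tendsto (fun t : ℝ => D / Real.log t) atTop (𝓝 0) :=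
      tendsto_const_nhds.div_atTop Real.tendsto_log_atTop
    simpa [C] using h2.add h1
  filter_upwards [hlogt.eventually_le_const (show 0 < δ / 3 by positivity),
    hlin.eventually_le_const (show 0 < δ / 3 by positivity), eventually_ge_atTop 1,
    Real.tendsto_log_atTop.eventually_gt_atTop 0] with t h1 h2 ht hlog
  have ht0 : 0 < t := by linarith
  filter_upwards [hcmp] with x hx
  set w := t ^ ((N : ℝ) / 2) with hw
  have hw0 : 0 ≤ w := by positivity
  have hcancel : w * t ^ (-((N : ℝ) / 2)) = 1 := by
    rw [hw, ← Real.rpow_add ht0, add_neg_cancel, Real.rpow_zero]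
  set v := nonlocalEvol J f x t
  set g := ∫ y, (Metric.ball (0 : Euc N) √t).indicator f y
  set G := heatKernel a x t
  have hG0 : 0 ≤ G := heatKernel_nonneg ha.le ht0.le x
  have hGc : w * G ≤ c := by
    calc w * G ≤ w * (c * t ^ (-((N : ℝ) / 2))) :=
          mul_le_mul_of_nonneg_left (heatKernel_le ha ht0 x) hw0
      _ = c * (w * t ^ (-((N : ℝ) / 2))) := by ring
      _ = c := by rw [hcancel, mul_one]
  have hvC : w * |v / Real.log t - C * G| ≤ δ / 3 := by
    have e : v / Real.log t - C * G = (v - g * G) / Real.log t + (g / Real.log t - C) * G := by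
      field_simp
      ring
    calc _ ≤ w * (|(v - g * G) / Real.log t| + |(g / Real.log t - C) * G|) := by
          rw [e]
          exact mul_le_mul_of_nonneg_left (abs_add_le _ _) hw0
      _ = w * |v - g * G| / Real.log t + |g / Real.log t - C| * (w * G) := by
          rw [abs_div, abs_of_pos hlog, abs_mul, abs_of_nonneg hG0]
          ring
      _ ≤ D / Real.log t + |g / Real.log t - C| * c :=
          add_le_add (div_le_div_of_nonneg_right (hv t ht x) hlog.le)
            (mul_le_mul_of_nonneg_left hGc (abs_nonneg _))
      _ ≤ _ := h2
  have hvb : w * (v / Real.log t) ≤ δ + |C| * c := by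
    have h3 : w * (v / Real.log t - C * G) ≤ δ / 3 :=
      (mul_le_mul_of_nonneg_left (le_abs_self _) hw0).trans hvC
    have h4 : C * (w * G) ≤ |C| * c :=
      mul_le_mul (le_abs_self _) hGc (by positivity) (abs_nonneg _)
    have h5 : w * (v / Real.log t - C * G) = w * (v / Real.log t) - C * (w * G) := by ring
    linarith
  have huv : w * |u x t / Real.log t - v / Real.log t| ≤ δ / 3 + δ / 3 := by
    rw [← sub_div, abs_div, abs_of_pos hlog]
    calc _ ≤ w * ((η * v + K * t ^ (-((N : ℝ) / 2))) / Real.log t) :=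
          mul_le_mul_of_nonneg_left (div_le_div_of_nonneg_right (hx t ht) hlog.le) hw0
      _ = η * (w * (v / Real.log t)) + K * (w * t ^ (-((N : ℝ) / 2))) / Real.log t := by ring
      _ ≤ η * (δ + |C| * c) + K / Real.log t := by
          rw [hcancel, mul_one]
          gcongr
      _ ≤ _ := by linarith
  calc _ ≤ w * (|u x t / Real.log t - v / Real.log t| + |v / Real.log t - C * G|) :=
        mul_le_mul_of_nonneg_left (abs_sub_le _ _ _) hw0
    _ ≤ δ := by
        rw [mul_add]
        linarith

/-- A solution only depends on the class of its datum up to null sets. -/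
theorem IsNonlocalAbsorptionSolution.congr_datum {p : ℝ} {u₀ : Euc N → ℝ} {u : Euc N → ℝ → ℝ}
    (hu : IsNonlocalAbsorptionSolution J p u₀ u) (h : f =ᵐ[volume] u₀) :
    IsNonlocalAbsorptionSolution J p f u where
  measurable := hu.measurable
  bounded := hu.bounded
  initial := by
    filter_upwards [hu.initial, h] with x h1 h2
    rw [h1, h2]
  continuous_zero := hu.continuous_zero
  equation := hu.equation

end CriticalDecay

theorem theorem4p1 (N : ℕ) (A : ℝ) (hA : 0 < A) :
    ∃ C : ℝ, ∀ (J : EuclideanSpace ℝ (Fin N) → ℝ), IsDispersalKernel J →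
      ∀ (α p : ℝ), 0 < α → α ≤ N → 1 + 2 / α < p →
      ∀ (u₀ : EuclideanSpace ℝ (Fin N) → ℝ), MemLp u₀ ∞ volume → (∀ᵐ x, 0 ≤ u₀ x) →
        Tendsto (fun x => ‖x‖ ^ α * u₀ x)
          (cocompact (EuclideanSpace ℝ (Fin N)) ⊓ ae volume) (𝓝 A) →
      ∀ (u : EuclideanSpace ℝ (Fin N) → ℝ → ℝ), IsNonlocalAbsorptionSolution J p u₀ u →
        (α < N → ∀ (U : EuclideanSpace ℝ (Fin N) → ℝ → ℝ),
          IsHeatSolution (diffusivity J) (fun x => A / ‖x‖ ^ α) U → ∀ K > 0,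
          Tendsto (fun t : ℝ => ENNReal.ofReal (t ^ (α / 2)) *
              eLpNorm (fun x => u x t - U x t) ∞
                (volume.restrict (Metric.closedBall 0 (K * √t))))
            atTop (𝓝 0)) ∧
        (α = N → ∀ K > 0,
          Tendsto (fun t : ℝ => ENNReal.ofReal (t ^ ((N : ℝ) / 2)) *
              eLpNorm (fun x => u x t / Real.log t - C * heatKernel (diffusivity J) x t) ∞
                (volume.restrict (Metric.closedBall 0 (K * √t))))
            atTop (𝓝 0)) := by
  -- Here `N |B₁|` is the area of the unit sphere, and the factor `1 / 2` comes from measuring mass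
  -- up to radius `√t`.
  refine ⟨A * N * volume.real (Metric.ball (0 : EuclideanSpace ℝ (Fin N)) 1) / 2, ?_⟩
  intro J hJ α p hα hαN hp u₀ hu₀ hu₀0 hlim u hu
  have hN : N ≠ 0 := by
    rintro rfl
    rw [Nat.cast_zero] at hαN
    linarith
  have : NeZero N := ⟨hN⟩
  obtain ⟨f, hf, hfu, hf0, M, hM, hfM, hfα⟩ := exists_representative hα hA hu₀ hu₀0 hlim
  have happ : ∀ ε, 0 < ε → ∃ R, 1 ≤ R ∧
      ∀ᵐ y, R ≤ ‖y‖ → |f y - A * ‖y‖ ^ (-α)| ≤ ε * ‖y‖ ^ (-α) := fun ε hε => by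
    obtain ⟨R, hR1, hR⟩ := exists_forall_ae_abs_sub_le hlim hε
    refine ⟨R, hR1, ?_⟩
    filter_upwards [hR, hfu] with y h1 h2
    rwa [h2]
  have huf := hu.congr_datum hfu
  refine ⟨fun hαN U hU K _ => ?_, fun hαN K _ => ?_⟩
  · refine tendsto_ofReal_mul_eLpNorm_top _ fun δ hδ => ?_
    filter_upwards [huf.eventually_rpow_mul_abs_sub_le hJ hα hαN hp hA hf hM hf0 hfM hfα happ hU
      hδ, eventually_ge_atTop 0] with t h1 h2 using ⟨Real.rpow_nonneg h2 _, h1⟩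
  · subst hαN
    refine tendsto_ofReal_mul_eLpNorm_top _ fun δ hδ => ?_
    filter_upwards [huf.eventually_rpow_mul_abs_div_log_sub_le hJ hp hf hM hf0 hfM hfα happ hδ,
      eventually_ge_atTop 0] with t h1 h2 using ⟨Real.rpow_nonneg h2 _, h1⟩
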